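/- Theorem. Fix a dimension $l$. The exact Fréchet distance between two polygonal curves $A$ and $B$ in $\mathbb{R}^l$ can be computed by a randomized algorithm in $O(N^2\log^2 N)$ expected time and $O(N^2)$ space, where $N$ is the larger of the complexities (numbers of vertices) of $A$ and $B$. Here the Fréchet distance of two curves $A,B:[0,1]\to\mathbb{R}^l$ is $$\delta_F(A,B)=\inf_{f,g}\ \sup_{t\in[0,1]}\ \|A(f(t))-B(g(t))\|_2 ,$$ where $f,g$ range over the continuous non-decreasing maps of $[0,1]$ onto itself. A polygonal curve is given by the list of its vertices and has at least one edge (edges may have length zero). The model of computation is a randomized real RAM. It has word cells, which hold natural numbers, and real cells, which hold exact real numbers; both kinds are indirectly addressed. At unit cost it performs arithmetic and comparisons on words, $+,-,\cdot,/,\sqrt{\phantom{x}}$ and comparisons on reals, conversion of words to reals (but not of reals to words), and the choice of a uniformly random integer from $\{0,\dots,n\}$ for a given word $n$. Precisely: for every $l$ there are a program of this machine and a constant $C$ such that, for all polygonal curves $A,B$ in $\mathbb{R}^l$ with at least two vertices each, on the input $A,B$ - whenever the program halts, its output is exactly $\delta_F(A,B)$, whatever the random choices; - the expectation of the running time over the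 random choices is at most $C\,N^2\log^2 N$ (so the program halts with probability one); - whatever the random choices, the program only needs memory cells with addresses less than $C\,N^2$, and all words are at most $N^{C}$, i.e. have $O(\log N)$ bits. -/

import Mathlib

open scoped ENNReal unitInterval

noncomputable section

/-! ## Polygonal curves and the Fréchet distance -/

/-- The polygonal curve `[0,1] → ℝˡ` with vertices `P 0, …, P m`: each of its `m` edges is traversed
affinely, the `i`-th one during the parameter interval `[i / m, (i + 1) / m]`
(see `polyline_apply_edge`). -/
def polyline {m l : ℕ} (P : Fin (m + 1) → EuclideanSpace ℝ (Fin l)) :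
    C(I, EuclideanSpace ℝ (Fin l)) where
  toFun t := P 0 + ∑ i : Fin m, (max 0 (min 1 ((m : ℝ) * (t : ℝ) - (i : ℝ)))) •
    (P i.succ - P i.castSucc)
  continuous_toFun := by fun_prop

/-- At the parameter `(i + s) / m` the polygonal curve is at the point of its `i`-th edge that
divides this edge in the ratio `s : (1 - s)`. -/
theorem polyline_apply_edge {m l : ℕ} (P : Fin (m + 1) → EuclideanSpace ℝ (Fin l))
    (i : Fin m) (s : ℝ) (hs : s ∈ I) (t : I) (ht : (t : ℝ) = ((i : ℝ) + s) / m) :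
    polyline P t = AffineMap.lineMap (P i.castSucc) (P i.succ) s := by
  have hm : (m : ℝ) ≠ 0 := by
    have := i.pos
    positivity
  have hmt : (m : ℝ) * (t : ℝ) = (i : ℝ) + s := by rw [ht]; field_simp
  have key : ∀ (k : ℕ) (hk : k ≤ m),
      P 0 + ∑ j : Fin m, (if (j : ℕ) < k then (1 : ℝ) else 0) • (P j.succ - P j.castSucc)
        = P ⟨k, Nat.lt_succ_of_le hk⟩ := by
    intro k
    induction k with
    | zero => intro _; simp
    | succ k ih =>
      intro hk
      have h1 : ∀ j : Fin m, (if (j : ℕ) < k + 1 then (1 : ℝ) else 0) • (P j.succ - P j.castSucc)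
          = (if (j : ℕ) < k then (1 : ℝ) else 0) • (P j.succ - P j.castSucc)
            + if j = ⟨k, hk⟩ then (P j.succ - P j.castSucc) else 0 := by
        intro j
        rcases lt_trichotomy (j : ℕ) k with h | h | h
        · simp [h, Nat.lt_succ_of_lt h, Fin.ext_iff, h.ne]
        · simp [h, Fin.ext_iff]
        · simp [not_lt.2 h.le, not_lt.2 (Nat.succ_le_of_lt h), Fin.ext_iff, h.ne']
      rw [Finset.sum_congr rfl fun j _ => h1 j, Finset.sum_add_distrib, ← add_assoc,
        ih (Nat.le_of_succ_le hk)]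
      simp
  have h2 : ∀ j : Fin m,
      (max 0 (min 1 ((m : ℝ) * (t : ℝ) - (j : ℝ)))) • (P j.succ - P j.castSucc)
        = (if (j : ℕ) < (i : ℕ) then (1 : ℝ) else 0) • (P j.succ - P j.castSucc)
          + if j = i then s • (P j.succ - P j.castSucc) else 0 := by
    intro j
    rw [hmt]
    rcases lt_trichotomy (j : ℕ) (i : ℕ) with h | h | h
    · have h' : ((j : ℕ) : ℝ) + 1 ≤ ((i : ℕ) : ℝ) := by exact_mod_cast h
      have : min 1 (((i : ℕ) : ℝ) + s - ((j : ℕ) : ℝ)) = 1 := min_eq_left (by linarith [hs.1])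
      simp [this, h, Fin.ext_iff, h.ne]
    · have : j = i := Fin.ext h
      subst this
      simp [hs.1, hs.2]
    · have h' : ((i : ℕ) : ℝ) + 1 ≤ ((j : ℕ) : ℝ) := by exact_mod_cast h
      have : max 0 (min 1 (((i : ℕ) : ℝ) + s - ((j : ℕ) : ℝ))) = 0 :=
        max_eq_left ((min_le_right _ _).trans (by linarith [hs.2]))
      simp [this, not_lt.2 h.le, Fin.ext_iff, h.ne']
  change P 0 + ∑ j : Fin m, _ = _
  rw [Finset.sum_congr rfl fun j _ => h2 j, Finset.sum_add_distrib, ← add_assoc,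
    key i i.isLt.le, AffineMap.lineMap_apply]
  simp only [Finset.sum_ite_eq', Finset.mem_univ, if_true, vsub_eq_sub, vadd_eq_add]
  rw [add_comm]
  rfl

/-- The continuous non-decreasing reparametrizations of `[0,1]`, i.e. the continuous monotone maps
of `[0,1]` onto itself. -/
def reparametrizations : Set C(I, I) := {f | Monotone f ∧ f 0 = 0 ∧ f 1 = 1}

/-- The Fréchet distance of two curves,
`inf_{f, g} sup_{t} d (A (f t)) (B (g t))`. -/
def frechetDist {E : Type*} [PseudoMetricSpace E] (A B : C(I, E)) : ℝ :=
  ⨅ fg : reparametrizations × reparametrizations,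
    ⨆ t : I, dist (A (fg.1.1 t)) (B (fg.2.1 t))

/-! ## A randomized real RAM

The memory has two banks of cells, numbered `0, 1, 2, …`: word cells, which hold natural numbers, and
real cells, which hold exact real numbers.  Cells of both banks are addressed indirectly, through
words.  There is no conversion of reals into words (no floor function).  A program is a fixed,
finite, structured piece of code, without recursion; every command costs one unit of time.  (The
expressions in a program have a fixed size, so a command performs a bounded number of arithmetic
operations, comparisons and memory accesses.) -/

namespace RealRAM

/-- Contents of the memory. -/
structure Mem where
  word : ℕ → ℕ
  real : ℕ → ℝ

/-- Word expressions. -/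
inductive WExp : Type
  | const (n : ℕ)
  | load (addr : WExp)
  | add (a b : WExp)
  | sub (a b : WExp)
  | mul (a b : WExp)
  | div (a b : WExp)

/-- Real expressions; `ofWord` converts a word to a real number. -/
inductive RExp : Type
  | ofWord (a : WExp)
  | load (addr : WExp)
  | add (x y : RExp)
  | sub (x y : RExp)
  | mul (x y : RExp)
  | div (x y : RExp)
  | sqrt (x : RExp)

/-- Tests. -/
inductive Test : Type
  | wordLT (a b : WExp)
  | realLT (x y : RExp)
  | not (b : Test)
  | and (b c : Test)

/-- Commands.  `rand addr n` stores a fresh uniformly random element of `{0, …, n}` in the word cell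
`addr`. -/
inductive Cmd : Type
  | skip
  | setWord (addr : WExp) (e : WExp)
  | setReal (addr : WExp) (e : RExp)
  | rand (addr : WExp) (n : WExp)
  | seq (c d : Cmd)
  | ite (b : Test) (c d : Cmd)
  | loop (b : Test) (c : Cmd)

/-- Value of a word expression (subtraction is truncated at `0`, division rounds down). -/
def WExp.eval (M : Mem) : WExp → ℕ
  | const n => n
  | load a => M.word (a.eval M)
  | add a b => a.eval M + b.eval M
  | sub a b => a.eval M - b.eval M
  | mul a b => a.eval M * b.eval M
  | div a b => a.eval M / b.eval M

/-- Value of a real expression (exact arithmetic; a quotient by `0` and the square root of a negative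
number have the value `0`). -/
def RExp.eval (M : Mem) : RExp → ℝ
  | ofWord a => (a.eval M : ℝ)
  | load a => M.real (a.eval M)
  | add x y => x.eval M + y.eval M
  | sub x y => x.eval M - y.eval M
  | mul x y => x.eval M * y.eval M
  | div x y => x.eval M / y.eval M
  | sqrt x => Real.sqrt (x.eval M)

/-- Truth of a test. -/
def Test.Holds (M : Mem) : Test → Prop
  | wordLT a b => a.eval M < b.eval M
  | realLT x y => x.eval M < y.eval M
  | not b => ¬ b.Holds M
  | and b c => b.Holds M ∧ c.Holds M

/-- A configuration of the machine: the commands that remain to be executed, and the memory. -/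
structure Config where
  code : List Cmd
  mem : Mem

/-- The machine has halted. -/
def Config.Halted (c : Config) : Prop := c.code = []

open Classical in
/-- The distribution of the configuration after one unit of time. -/
def step : Config → PMF Config
  | ⟨[], M⟩ => PMF.pure ⟨[], M⟩
  | ⟨Cmd.skip :: k, M⟩ => PMF.pure ⟨k, M⟩
  | ⟨Cmd.setWord a e :: k, M⟩ =>
      PMF.pure ⟨k, { M with word := Function.update M.word (a.eval M) (e.eval M) }⟩
  | ⟨Cmd.setReal a e :: k, M⟩ =>
      PMF.pure ⟨k, { M with real := Function.update M.real (a.eval M) (e.eval M) }⟩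
  | ⟨Cmd.rand a n :: k, M⟩ =>
      (PMF.uniformOfFintype (Fin (n.eval M + 1))).map fun r =>
        ⟨k, { M with word := Function.update M.word (a.eval M) (r : ℕ) }⟩
  | ⟨Cmd.seq c d :: k, M⟩ => PMF.pure ⟨c :: d :: k, M⟩
  | ⟨Cmd.ite b c d :: k, M⟩ => PMF.pure (if b.Holds M then ⟨c :: k, M⟩ else ⟨d :: k, M⟩)
  | ⟨Cmd.loop b c :: k, M⟩ =>
      PMF.pure (if b.Holds M then ⟨c :: Cmd.loop b c :: k, M⟩ else ⟨k, M⟩)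

/-- The distribution of the configuration after `t` units of time, when `prog` is started on the
memory `M`. -/
def run (prog : Cmd) (M : Mem) : ℕ → PMF Config
  | 0 => PMF.pure ⟨[prog], M⟩
  | t + 1 => (run prog M t).bind step

/-- The expectation of the running time `T ∈ {0, 1, 2, …, ∞}` of `prog` on `M`, as the sum over
`t = 0, 1, 2, …` of the probabilities of `T > t`, i.e. of not having halted after `t` units of time.
(If it is finite, then the program halts with probability one.) -/
def expectedTime (prog : Cmd) (M : Mem) : ℝ≥0∞ :=
  ∑' t : ℕ, (run prog M t).toOuterMeasure {c | ¬ c.Halted}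

/-- Whatever the random choices, `prog` started on `M` has the real number `r` in the real cell `0`
whenever it halts. -/
def Outputs (prog : Cmd) (M : Mem) (r : ℝ) : Prop :=
  ∀ t : ℕ, ∀ c ∈ (run prog M t).support, c.Halted → c.mem.real 0 = r

/-- Whatever the random choices, `prog` started on `M` needs at most `S` memory cells of each kind
and words of size at most `W`: at all times, all cells with an address `≥ S` are empty (they
hold `0`), and all words are `≤ W`. -/
def RunsInSpace (prog : Cmd) (M : Mem) (S W : ℕ) : Prop :=
  ∀ t : ℕ, ∀ c ∈ (run prog M t).support,
    (∀ a : ℕ, S ≤ a → c.mem.word a = 0 ∧ c.mem.real a = 0) ∧ ∀ a : ℕ, c.mem.word a ≤ W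

end RealRAM

/-- The `a`-th number in the list of the coordinates of the points `P 0, P 1, …, P (k - 1)`, point by
point (the `j`-th coordinate of `P i` has the position `i * l + j`); `0` past the end. -/
def coordList {k l : ℕ} (P : Fin k → EuclideanSpace ℝ (Fin l)) (a : ℕ) : ℝ :=
  if h : a < k * l then P (Fin.divNat ⟨a, h⟩) (Fin.modNat ⟨a, h⟩) else 0

/-- The memory that presents two polygonal curves to the machine: the numbers of their vertices are in
the word cells `0` and `1`, and the coordinates of the vertices of the first curve, followed by those
of the second curve, are in the real cells `0, 1, 2, …`.  All other cells hold `0`. -/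
def curvePairInput {p q l : ℕ} (A : Fin p → EuclideanSpace ℝ (Fin l))
    (B : Fin q → EuclideanSpace ℝ (Fin l)) : RealRAM.Mem where
  word a := if a = 0 then p else if a = 1 then q else 0
  real a := if a < p * l then coordList A a else coordList B (a - p * l)

end

/-!
The algorithm is a random search among critical values, driven by a decision procedure that needs
no sorting.

*Decision.* The vertices of both curves form one list `P 0, …, P (K - 1)`. For an edge `e` and two
vertices `q ≤ k`, the critical value `crit P e q k` is the smallest squared distance at which `q`
and `k`, in this order, are matched to points `y ≤ y'` of `e`. A monotone path through the free
space diagram of a threshold `r` that has entered the strip of `e` from the side, just before the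
line of the vertex `s`, and has come to the line of the vertex `k`, can cross it if and only if
`crit P e q k ≤ r` for all `q` with `s ≤ q ≤ k`: it keeps as low as possible, at the highest one
of the lower ends of the free intervals that it has passed (`LeastFree.advance`). So all that
matters about `r` is its table (`IsTable`), whose entry at `(e, k)` is the least such `s`, and a
dynamic program over the cells (`dpV`, `dpH`), which keeps for every cell side one line that a
path to it may have come from, decides in time `O(K ^ 2)` from the table whether the Fréchet
distance is at most `√r` (`entered_of_frechetLE`, `frechetLE_of_entered`). For a fixed edge, `crit
P e q k ≤ r` compares the lower end of the free interval of `q` with the upper end of that of `k`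
(`cmpLE_critSq_iff`). Range maxima over windows whose lengths are powers of two, and a descent
through these lengths, therefore give the table in time `O(K ^ 2 log K)` and space `O(K ^ 2)`
(`ends_tableC`).

*Search.* Let `α` be a threshold below the squared Fréchet distance and `β` one that is not, with
the table `a` of `α` and the table `b` of the strict inequalities for `β`. The pairs of a place
`(e, k)` and a number `s ∈ [b e k, a e k)` are the candidates; the value of a candidate, `critMax
P e k s`, lies strictly between `α` and `β`, and the entry at `(e, k)` of the table of `r` is at
most `s` if and only if this value is at most `r`. If no candidate is left, then all thresholds in
`[α, β)` have the same table as `α`, so the Fréchet distance is `√β`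
(`FrechetBracket.frechetDist_eq`). Otherwise a uniformly random candidate is picked, and its value
replaces `α` or `β`. Only the candidates with values strictly on the other side survive, so the
sum of the harmonic numbers of the numbers of candidates below and above the squared Fréchet
distance decreases by at least one on average (`sum_searchPotential_remaining_le`). There are at
most `K ^ 3` candidates, hence the expected number of rounds is `O(log K)`, which gives the
expected time `O(K ^ 2 (log K) ^ 2)`. The search starts with `α` the squared larger distance of
matching endpoints; `β` is at first above all critical values, which is the table `0`.

*Machine.* `Ends` is total correctness with a time bound for the deterministic commands, proved
with invariants that run over a known number of rounds of a loop (`Ends.loop`). `Good` combines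
the output, the bounds on space and word size, and the expected time from an arbitrary
configuration; for the random loop it is proved by induction on the number of remaining candidates
(`good_search`).
-/

noncomputable section

/-! ### Critical values of two points and a segment -/

section Segment

/-- The squared distance of a point from the point with parameter `y` of a segment, where `a` is the
squared length of the segment, `c` the squared distance of the point from the beginning of the
segment, and `b` the inner product of the differences. -/
def segQuad (a b c y : ℝ) : ℝ := a * y * y - 2 * b * y + c

/-- The parameter of the point of the segment that is closest. For a segment of length zero, where
`a = b = 0`, it is `0`. -/
def segFoot (a b : ℝ) : ℝ := max 0 (min 1 (b / a))

/-- The square root whose multiples by `± 1 / a` are added to `b / a` to get the parameters where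
the squared distance is `r`. -/
def segRoot (a b c r : ℝ) : ℝ := √(b * b - a * (c - r))

/-- The lower end of the set of parameters in `[0, 1]` where `segQuad` is `≤ r`. -/
def segLow (a b c r : ℝ) : ℝ := max 0 ((b - segRoot a b c r) / a)

/-- The upper end of the set of parameters in `[0, 1]` where `segQuad` is `≤ r`. The summand
`1 - a / a` vanishes unless `a = 0`, where it is `1`. -/
def segHigh (a b c r : ℝ) : ℝ := min 1 ((b + segRoot a b c r) / a + (1 - a / a))

/-- The smallest `r` such that two points, with the data `(b, c)` and `(b', c')`, are within the
squared distance `r` of points of the segment with parameters `y ≤ y'`. -/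
def critSq (a b c b' c' : ℝ) : ℝ :=
  max (segQuad a b c (min (segFoot a b) (max (segFoot a b') ((c - c') / (2 * (b - b'))))))
    (segQuad a b' c' (max (segFoot a b') (min (segFoot a b) ((c - c') / (2 * (b - b'))))))

variable {a b c b' c' r : ℝ}

theorem segFoot_mem : 0 ≤ segFoot a b ∧ segFoot a b ≤ 1 :=
  ⟨le_max_left _ _, max_le zero_le_one (min_le_left _ _)⟩

/-- To the left of its minimum point in `[0, 1]`, the quadratic decreases. -/
theorem segQuad_anti (ha : 0 ≤ a) (hb : a = 0 → b = 0) {y z : ℝ} (hy : 0 ≤ y) (hyz : y ≤ z)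
    (hz : z ≤ segFoot a b) : segQuad a b c z ≤ segQuad a b c y := by
  rcases ha.eq_or_lt with rfl | ha
  · simp [segQuad, hb rfl]
  · rcases le_or_gt (b / a) 0 with h | h
    · have h0 : segFoot a b = 0 := by
        rw [segFoot, min_eq_right (by linarith), max_eq_left h]
      rw [show z = y by linarith]
    · have h1 : z ≤ b / a := by
        refine hz.trans (max_le h.le (min_le_right _ _))
      have h2 : a * z ≤ b := by rwa [le_div_iff₀ ha, mul_comm] at h1
      unfold segQuad
      nlinarith [mul_nonneg (sub_nonneg.2 hyz) (sub_nonneg.2 h2),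
        mul_nonneg (sub_nonneg.2 hyz) (mul_nonneg ha.le (sub_nonneg.2 hyz))]

/-- To the right of its minimum point in `[0, 1]`, the quadratic increases. -/
theorem segQuad_mono (ha : 0 ≤ a) (hb : a = 0 → b = 0) {y z : ℝ} (hy : y ≤ 1) (hzy : z ≤ y)
    (hz : segFoot a b ≤ z) : segQuad a b c z ≤ segQuad a b c y := by
  rcases ha.eq_or_lt with rfl | ha
  · simp [segQuad, hb rfl]
  · rcases le_or_gt 1 (b / a) with h | h
    · have h0 : segFoot a b = 1 := by
        rw [segFoot, min_eq_left h, max_eq_right zero_le_one]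
      rw [show z = y by linarith]
    · have h1 : b / a ≤ z := by
        refine le_trans ?_ hz
        rw [segFoot, min_eq_right h.le]
        exact le_max_right _ _
      have h2 : b ≤ a * z := by rwa [div_le_iff₀ ha, mul_comm] at h1
      unfold segQuad
      nlinarith [mul_nonneg (sub_nonneg.2 hzy) (sub_nonneg.2 h2),
        mul_nonneg (sub_nonneg.2 hzy) (mul_nonneg ha.le (sub_nonneg.2 hzy))]

theorem segQuad_foot_le (ha : 0 ≤ a) (hb : a = 0 → b = 0) {y : ℝ} (hy : 0 ≤ y) (hy1 : y ≤ 1) :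
    segQuad a b c (segFoot a b) ≤ segQuad a b c y := by
  rcases le_total y (segFoot a b) with h | h
  · exact segQuad_anti ha hb hy h le_rfl
  · exact segQuad_mono ha hb hy1 h le_rfl

/-- The value `critSq` is attained by a pair of parameters in the right order. -/
theorem exists_critSq (a b c b' c' : ℝ) : ∃ y y', 0 ≤ y ∧ y ≤ y' ∧ y' ≤ 1 ∧
    segQuad a b c y ≤ critSq a b c b' c' ∧ segQuad a b' c' y' ≤ critSq a b c b' c' := by
  refine ⟨_, _, ?_, ?_, ?_, le_max_left _ _, le_max_right _ _⟩
  · exact le_min segFoot_mem.1 (le_max_of_le_left segFoot_mem.1)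
  · rcases le_total (segFoot a b) (segFoot a b') with h | h
    · exact (min_le_left _ _).trans (h.trans (le_max_left _ _))
    · rw [min_max_distrib_left, min_eq_right h]
  · exact max_le segFoot_mem.2 (min_le_of_left_le segFoot_mem.2)

/-- No pair of parameters in the right order does better than `critSq`. -/
theorem critSq_le_max (ha : 0 ≤ a) (hb : a = 0 → b = 0) (hb' : a = 0 → b' = 0) {y y' : ℝ}
    (hy : 0 ≤ y) (hyy : y ≤ y') (hy' : y' ≤ 1) :
    critSq a b c b' c' ≤ max (segQuad a b c y) (segQuad a b' c' y') := by
  rcases le_or_gt (segFoot a b) (segFoot a b') with h | h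
  · rw [critSq, min_eq_left (h.trans (le_max_left _ _)), max_eq_left ((min_le_left _ _).trans h)]
    exact max_le_max (segQuad_foot_le ha hb hy (hyy.trans hy'))
      (segQuad_foot_le ha hb' (hy.trans hyy) hy')
  have ha0 : 0 < a := by
    rcases ha.eq_or_lt with rfl | ha
    · simp [segFoot] at h
    · exact ha
  have hbb : b' < b := by
    by_contra! hbb
    exact h.not_ge (max_le_max le_rfl (min_le_min le_rfl (by gcongr)))
  set e := (c - c') / (2 * (b - b')) with he
  set w := min (segFoot a b) (max (segFoot a b') e) with hw
  have hw' : max (segFoot a b') (min (segFoot a b) e) = w := by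
    rw [hw, min_max_distrib_left, min_eq_right h.le]
  have hwl : segFoot a b' ≤ w := by rw [← hw']; exact le_max_left _ _
  have hwu : w ≤ segFoot a b := min_le_left _ _
  have hdiff : ∀ x, segQuad a b c x - segQuad a b' c' x = 2 * (b - b') * (e - x) := by
    intro x
    have : 2 * (b - b') * e = c - c' := by
      rw [he]; field_simp [(sub_pos.2 hbb).ne']
    unfold segQuad
    linear_combination -this
  have hpos : 0 < 2 * (b - b') := by linarith
  rw [critSq, hw', ← hw]
  have hw0 : 0 ≤ w := segFoot_mem.1.trans hwl
  have hw1 : w ≤ 1 := hwu.trans segFoot_mem.2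
  -- a parameter on the near side of `w` bounds the respective quadratic at `w`
  have h1 : y ≤ w → segQuad a b c w ≤ segQuad a b c y := fun h => segQuad_anti ha hb hy h hwu
  have h2 : w ≤ y' → segQuad a b' c' w ≤ segQuad a b' c' y' :=
    fun h => segQuad_mono ha hb' hy' h hwl
  rcases le_or_gt y w with hyw | hyw
  · rcases le_or_gt w y' with hwy | hwy
    · exact max_le_max (h1 hyw) (h2 hwy)
    · refine max_le ((h1 hyw).trans (le_max_left _ _)) ?_
      rcases le_or_gt w e with hwe | hwe
      · refine le_trans ?_ ((h1 hyw).trans (le_max_left _ _))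
        nlinarith [hdiff w, mul_nonneg hpos.le (sub_nonneg.2 hwe)]
      · have hwf : w = segFoot a b' := by
          rw [← hw']
          refine max_eq_left ?_
          by_contra! hc
          rw [← hw', max_eq_right hc.le] at hwe
          exact hwe.not_ge (min_le_right _ _)
        rw [hwf]
        exact (segQuad_foot_le ha hb' (hy.trans hyy) hy').trans (le_max_right _ _)
  · have hwy : w ≤ y' := hyw.le.trans hyy
    refine max_le ?_ ((h2 hwy).trans (le_max_right _ _))
    rcases le_or_gt e w with hwe | hwe
    · refine le_trans ?_ ((h2 hwy).trans (le_max_right _ _))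
      nlinarith [hdiff w, mul_nonneg hpos.le (sub_nonneg.2 hwe)]
    · have hwf : w = segFoot a b := by
        refine min_eq_left ?_
        by_contra! hc
        rw [hw, min_eq_right hc.le] at hwe
        exact hwe.not_ge (le_max_right _ _)
      rw [hwf]
      exact (segQuad_foot_le ha hb hy (hyy.trans hy')).trans (le_max_left _ _)

theorem critSq_le_iff (ha : 0 ≤ a) (hb : a = 0 → b = 0) (hb' : a = 0 → b' = 0) :
    critSq a b c b' c' ≤ r ↔ ∃ y y', 0 ≤ y ∧ y ≤ y' ∧ y' ≤ 1 ∧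
      segQuad a b c y ≤ r ∧ segQuad a b' c' y' ≤ r := by
  constructor
  · intro h
    obtain ⟨y, y', h1, h2, h3, h4, h5⟩ := exists_critSq a b c b' c'
    exact ⟨y, y', h1, h2, h3, h4.trans h, h5.trans h⟩
  · rintro ⟨y, y', h1, h2, h3, h4, h5⟩
    exact (critSq_le_max ha hb hb' h1 h2 h3).trans (max_le h4 h5)

theorem critSq_lt_iff (ha : 0 ≤ a) (hb : a = 0 → b = 0) (hb' : a = 0 → b' = 0) :
    critSq a b c b' c' < r ↔ ∃ y y', 0 ≤ y ∧ y ≤ y' ∧ y' ≤ 1 ∧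
      segQuad a b c y < r ∧ segQuad a b' c' y' < r := by
  constructor
  · intro h
    obtain ⟨y, y', h1, h2, h3, h4, h5⟩ := exists_critSq a b c b' c'
    exact ⟨y, y', h1, h2, h3, h4.trans_lt h, h5.trans_lt h⟩
  · rintro ⟨y, y', h1, h2, h3, h4, h5⟩
    exact (critSq_le_max ha hb hb' h1 h2 h3).trans_lt (max_lt h4 h5)

/-! ### Free intervals on a segment -/

/-- Completing the square. -/
theorem mul_segQuad (a b c r y : ℝ) :
    a * (segQuad a b c y - r) = (a * y - b) ^ 2 - (b * b - a * (c - r)) := by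
  unfold segQuad; ring

/-- If `segQuad` is `≤ r` at `y`, then `y` lies between the ends of the free interval; strictly so,
except at the ends of `[0, 1]`, if it is `< r`. -/
theorem segLow_le_of_le (ha : 0 ≤ a) {y : ℝ} (hy : 0 ≤ y) (h : segQuad a b c y ≤ r) :
    segLow a b c r ≤ y := by
  refine max_le hy ?_
  rcases ha.eq_or_lt with rfl | ha
  · simpa using hy
  rw [div_le_iff₀ ha, segRoot]
  have := mul_segQuad a b c r y
  have h3 : |a * y - b| ≤ √(b * b - a * (c - r)) := by
    apply Real.abs_le_sqrt
    nlinarith [mul_nonneg ha.le (sub_nonneg.2 h)]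
  linarith [neg_abs_le (a * y - b)]

theorem le_segHigh_of_le (ha : 0 ≤ a) {y : ℝ} (hy : y ≤ 1) (h : segQuad a b c y ≤ r) :
    y ≤ segHigh a b c r := by
  refine le_min hy ?_
  rcases ha.eq_or_lt with rfl | ha
  · simpa using hy
  rw [div_self ha.ne', sub_self, add_zero, le_div_iff₀ ha, segRoot]
  have := mul_segQuad a b c r y
  have h3 : |a * y - b| ≤ √(b * b - a * (c - r)) := by
    apply Real.abs_le_sqrt
    nlinarith [mul_nonneg ha.le (sub_nonneg.2 h)]
  linarith [le_abs_self (a * y - b)]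

theorem segLow_lt_of_lt (ha : 0 ≤ a) {y : ℝ} (hy : 0 < y) (h : segQuad a b c y < r) :
    segLow a b c r < y := by
  refine max_lt hy ?_
  rcases ha.eq_or_lt with rfl | ha
  · simpa using hy
  rw [div_lt_iff₀ ha, segRoot]
  have := mul_segQuad a b c r y
  have h3 : |a * y - b| < √(b * b - a * (c - r)) := by
    apply Real.lt_sqrt_of_sq_lt
    rw [sq_abs]
    nlinarith [mul_pos ha (sub_pos.2 h)]
  linarith [neg_abs_le (a * y - b)]

theorem lt_segHigh_of_lt (ha : 0 ≤ a) {y : ℝ} (hy : y < 1) (h : segQuad a b c y < r) :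
    y < segHigh a b c r := by
  refine lt_min hy ?_
  rcases ha.eq_or_lt with rfl | ha
  · simpa using hy
  rw [div_self ha.ne', sub_self, add_zero, lt_div_iff₀ ha, segRoot]
  have := mul_segQuad a b c r y
  have h3 : |a * y - b| < √(b * b - a * (c - r)) := by
    apply Real.lt_sqrt_of_sq_lt
    rw [sq_abs]
    nlinarith [mul_pos ha (sub_pos.2 h)]
  linarith [le_abs_self (a * y - b)]

/-- If the closest point is free, then so are all points between it and the lower end. -/
theorem segQuad_le_of_low (ha : 0 ≤ a) (hb : a = 0 → b = 0)
    (hf : segQuad a b c (segFoot a b) ≤ r) {y : ℝ} (h : segLow a b c r ≤ y)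
    (hy : y ≤ segFoot a b) : segQuad a b c y ≤ r := by
  rcases ha.eq_or_lt with rfl | ha
  · simpa [segQuad, hb rfl] using hf
  have h0 : 0 ≤ y := (le_max_left _ _).trans h
  rcases le_or_gt (b / a) 0 with hba | hba
  · have h1 : segFoot a b = 0 := by
      rw [segFoot, min_eq_right (by linarith), max_eq_left hba]
    rwa [show y = segFoot a b by linarith]
  have h1 : a * y ≤ b := by
    rw [← le_div_iff₀' ha]
    exact hy.trans (max_le hba.le (min_le_right _ _))
  have h2 : b - segRoot a b c r ≤ a * y := by
    rw [← div_le_iff₀' ha]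
    exact (le_max_right _ _).trans h
  have h3 : 0 ≤ b * b - a * (c - r) := by
    nlinarith [mul_segQuad a b c r (segFoot a b), mul_nonneg ha.le (sub_nonneg.2 hf)]
  have h4 : (a * y - b) ^ 2 ≤ segRoot a b c r ^ 2 :=
    sq_le_sq' (by linarith) (by linarith [Real.sqrt_nonneg (b * b - a * (c - r))])
  rw [segRoot, Real.sq_sqrt h3] at h4
  have h5 := mul_segQuad a b c r y
  by_contra! h6
  nlinarith [mul_pos ha (sub_pos.2 h6)]

/-- If the closest point is free, then so are all points between it and the upper end. -/
theorem segQuad_le_of_high (ha : 0 ≤ a) (hb : a = 0 → b = 0)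
    (hf : segQuad a b c (segFoot a b) ≤ r) {y : ℝ} (h : y ≤ segHigh a b c r)
    (hy : segFoot a b ≤ y) : segQuad a b c y ≤ r := by
  rcases ha.eq_or_lt with rfl | ha
  · simpa [segQuad, hb rfl] using hf
  have h0 : y ≤ 1 := h.trans (min_le_left _ _)
  rcases le_or_gt 1 (b / a) with hba | hba
  · have h1 : segFoot a b = 1 := by
      rw [segFoot, min_eq_left hba, max_eq_right zero_le_one]
    rwa [show y = segFoot a b by linarith]
  have h1 : b ≤ a * y := by
    rw [← div_le_iff₀' ha]
    refine le_trans ?_ hy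
    rw [segFoot, min_eq_right hba.le]
    exact le_max_right _ _
  have h2 : a * y ≤ b + segRoot a b c r := by
    rw [← le_div_iff₀' ha]
    have := h.trans (min_le_right _ _)
    rwa [div_self ha.ne', sub_self, add_zero] at this
  have h3 : 0 ≤ b * b - a * (c - r) := by
    nlinarith [mul_segQuad a b c r (segFoot a b), mul_nonneg ha.le (sub_nonneg.2 hf)]
  have h4 : (a * y - b) ^ 2 ≤ segRoot a b c r ^ 2 :=
    sq_le_sq' (by linarith [Real.sqrt_nonneg (b * b - a * (c - r))]) (by linarith)
  rw [segRoot, Real.sq_sqrt h3] at h4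
  have h5 := mul_segQuad a b c r y
  by_contra! h6
  nlinarith [mul_pos ha (sub_pos.2 h6)]

/-- `x ≤ y`, or `x < y` in the strict mode. -/
def CmpLE (strict : Bool) (x y : ℝ) : Prop := if strict then x < y else x ≤ y

open Classical in
/-- The lower end of the free interval of a point on a segment; `2` if this interval is empty. In
the strict mode, emptiness refers to the condition `segQuad < r`. -/
def freeLow (strict : Bool) (a b c r : ℝ) : ℝ :=
  if CmpLE strict (segQuad a b c (segFoot a b)) r then segLow a b c r else 2

open Classical in
/-- The upper end of the free interval of a point on a segment; `-1` if this interval is empty. -/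
def freeHigh (strict : Bool) (a b c r : ℝ) : ℝ :=
  if CmpLE strict (segQuad a b c (segFoot a b)) r then segHigh a b c r else -1

theorem CmpLE.le {s : Bool} {x y : ℝ} (h : CmpLE s x y) : x ≤ y := by
  cases s
  · simpa [CmpLE] using h
  · exact le_of_lt (by simpa [CmpLE] using h)

theorem CmpLE.trans_le {s : Bool} {x y z : ℝ} (h : x ≤ y) (h' : CmpLE s y z) : CmpLE s x z := by
  cases s
  · exact h.trans (by simpa [CmpLE] using h')
  · exact h.trans_lt (by simpa [CmpLE] using h')

theorem segFoot_le_critSq (ha : 0 ≤ a) (hb : a = 0 → b = 0) :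
    segQuad a b c (segFoot a b) ≤ critSq a b c b' c' := by
  obtain ⟨y, y', h1, h2, h3, h4, h5⟩ := exists_critSq a b c b' c'
  exact (segQuad_foot_le ha hb h1 (h2.trans h3)).trans h4

theorem segFoot_le_critSq' (ha : 0 ≤ a) (hb' : a = 0 → b' = 0) :
    segQuad a b' c' (segFoot a b') ≤ critSq a b c b' c' := by
  obtain ⟨y, y', h1, h2, h3, h4, h5⟩ := exists_critSq a b c b' c'
  exact (segQuad_foot_le ha hb' (h1.trans h2) h3).trans h5

/-- Between the lower end of a free interval and the closest point, all parameters are free. -/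
theorem CmpLE.segQuad_of_low {s : Bool} (ha : 0 ≤ a) (hb : a = 0 → b = 0)
    (hf : CmpLE s (segQuad a b c (segFoot a b)) r) {y : ℝ} (h : CmpLE s (segLow a b c r) y)
    (hy : y ≤ segFoot a b) : CmpLE s (segQuad a b c y) r := by
  cases s
  · exact segQuad_le_of_low ha hb (by simpa [CmpLE] using hf) (by simpa [CmpLE] using h) hy
  · simp only [CmpLE, if_true] at *
    refine (segQuad_le_of_low ha hb hf.le h.le hy).lt_of_ne fun heq => ?_
    rcases ha.eq_or_lt with rfl | ha
    · simp [segQuad, hb rfl] at hf heq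
      exact hf.ne heq
    -- a parameter where `segQuad = r` is a root of the quadratic, hence an end of the interval
    have h0 : 0 < y := (le_max_left _ _).trans_lt h
    have h1 := mul_segQuad a b c r y
    rw [heq, sub_self, mul_zero] at h1
    have h2 : segRoot a b c r = |a * y - b| := by
      rw [segRoot, ← Real.sqrt_sq_eq_abs]; congr 1; linarith
    have h3 : b < a * y := by
      have := (le_max_right _ _).trans_lt h
      rw [div_lt_iff₀ ha, h2] at this
      by_contra! h4
      rw [abs_of_nonpos (by linarith)] at this
      linarith
    have h4 : y ≤ b / a := by
      rcases le_or_gt (b / a) 0 with hba | hba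
      · rw [segFoot, min_eq_right (by linarith), max_eq_left hba] at hy
        linarith
      · exact hy.trans (max_le hba.le (min_le_right _ _))
    rw [le_div_iff₀ ha] at h4
    linarith

theorem CmpLE.segQuad_of_high {s : Bool} (ha : 0 ≤ a) (hb : a = 0 → b = 0)
    (hf : CmpLE s (segQuad a b c (segFoot a b)) r) {y : ℝ} (h : CmpLE s y (segHigh a b c r))
    (hy : segFoot a b ≤ y) : CmpLE s (segQuad a b c y) r := by
  cases s
  · exact segQuad_le_of_high ha hb (by simpa [CmpLE] using hf) (by simpa [CmpLE] using h) hy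
  · simp only [CmpLE, if_true] at *
    refine (segQuad_le_of_high ha hb hf.le h.le hy).lt_of_ne fun heq => ?_
    rcases ha.eq_or_lt with rfl | ha
    · simp [segQuad, hb rfl] at hf heq
      exact hf.ne heq
    have h0 : y < 1 := h.trans_le (min_le_left _ _)
    have h1 := mul_segQuad a b c r y
    rw [heq, sub_self, mul_zero] at h1
    have h2 : segRoot a b c r = |a * y - b| := by
      rw [segRoot, ← Real.sqrt_sq_eq_abs]; congr 1; linarith
    have h3 : a * y < b := by
      have := h.trans_le (min_le_right _ _)
      rw [div_self ha.ne', sub_self, add_zero, lt_div_iff₀ ha, h2] at this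
      by_contra! h4
      rw [abs_of_nonneg (by linarith)] at this
      linarith
    have h4 : b / a ≤ y := by
      rcases le_or_gt 1 (b / a) with hba | hba
      · rw [segFoot, min_eq_left hba, max_eq_right zero_le_one] at hy
        linarith
      · rw [segFoot, min_eq_right hba.le] at hy
        exact (le_max_right _ _).trans hy
    rw [div_le_iff₀ ha] at h4
    linarith

/-- Two points with non-empty free intervals have free parameters in the right order if and only if the
first interval does not begin after the end of the second one. -/
theorem exists_iff_segLow_segHigh {s : Bool} (ha : 0 ≤ a) (hb : a = 0 → b = 0)
    (hb' : a = 0 → b' = 0) (hf : CmpLE s (segQuad a b c (segFoot a b)) r)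
    (hf' : CmpLE s (segQuad a b' c' (segFoot a b')) r) :
    (∃ y y', 0 ≤ y ∧ y ≤ y' ∧ y' ≤ 1 ∧ CmpLE s (segQuad a b c y) r ∧
      CmpLE s (segQuad a b' c' y') r) ↔ CmpLE s (segLow a b c r) (segHigh a b' c' r) := by
  constructor
  · rintro ⟨y, y', h0, hyy, h1, h, h'⟩
    have hl := segLow_le_of_le ha h0 h.le
    have hh := le_segHigh_of_le ha h1 h'.le
    cases s
    · exact hl.trans (hyy.trans hh)
    · simp only [CmpLE, if_true] at *
      rcases h0.eq_or_lt with rfl | h0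
      · rcases h1.eq_or_lt with rfl | h1
        · linarith
        · exact (hl.trans hyy).trans_lt (lt_segHigh_of_lt ha h1 h')
      · exact (segLow_lt_of_lt ha h0 h).trans_le (hyy.trans hh)
  · intro h
    -- a common parameter `z` inside both intervals, corrected towards the closest points
    obtain ⟨z, hz, hz'⟩ : ∃ z, CmpLE s (segLow a b c r) z ∧ CmpLE s z (segHigh a b' c' r) := by
      cases s
      · exact ⟨_, le_refl (segLow a b c r), h⟩
      · simp only [CmpLE, if_true] at *
        exact exists_between h
    refine ⟨min (segFoot a b) z, max (segFoot a b') z, ?_, ?_, ?_, ?_, ?_⟩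
    · exact le_min segFoot_mem.1 ((le_max_left _ _).trans hz.le)
    · exact (min_le_right _ _).trans (le_max_right _ _)
    · exact max_le segFoot_mem.2 (hz'.le.trans (min_le_left _ _))
    · rcases le_total (segFoot a b) z with h1 | h1
      · rwa [min_eq_left h1]
      · rw [min_eq_right h1]
        exact CmpLE.segQuad_of_low ha hb hf hz h1
    · rcases le_total (segFoot a b') z with h1 | h1
      · rw [max_eq_right h1]
        exact CmpLE.segQuad_of_high ha hb' hf' hz' h1
      · rwa [max_eq_left h1]

/-- The comparison of a critical value with `r` amounts to a comparison of the ends of two free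
intervals. -/
theorem cmpLE_critSq_iff (s : Bool) (ha : 0 ≤ a) (hb : a = 0 → b = 0) (hb' : a = 0 → b' = 0) :
    CmpLE s (critSq a b c b' c') r ↔ CmpLE s (freeLow s a b c r) (freeHigh s a b' c' r) := by
  by_cases hf : CmpLE s (segQuad a b c (segFoot a b)) r
  · by_cases hf' : CmpLE s (segQuad a b' c' (segFoot a b')) r
    · rw [freeLow, freeHigh, if_pos hf, if_pos hf', ← exists_iff_segLow_segHigh ha hb hb' hf hf']
      cases s
      · exact critSq_le_iff ha hb hb'
      · exact critSq_lt_iff ha hb hb'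
    · rw [freeLow, freeHigh, if_pos hf, if_neg hf']
      refine iff_of_false (fun h => hf' (CmpLE.trans_le (segFoot_le_critSq' ha hb') h))
        fun h => ?_
      have h1 : 0 ≤ segLow a b c r := le_max_left _ _
      linarith [h.le]
  · rw [freeLow, if_neg hf]
    refine iff_of_false (fun h => hf (CmpLE.trans_le (segFoot_le_critSq ha hb) h)) fun h => ?_
    have h1 : freeHigh s a b' c' r ≤ 1 := by
      unfold freeHigh
      split_ifs
      · exact min_le_left _ _
      · norm_num
    linarith [h.le]

end Segment

/-! ### Critical values of vertices and edges -/

section Crit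

variable {E : Type*} [NormedAddCommGroup E] [InnerProductSpace ℝ E]

/-- The point with parameter `y` of the edge from `P e` to `P (e + 1)`. -/
def edgePt (P : ℕ → E) (e : ℕ) (y : ℝ) : E := AffineMap.lineMap (P e) (P (e + 1)) y

/-- The critical value (a squared distance) of the edge `e` and the vertices `q` and `k`. -/
def crit (P : ℕ → E) (e q k : ℕ) : ℝ :=
  critSq (inner ℝ (P (e + 1) - P e) (P (e + 1) - P e))
    (inner ℝ (P q - P e) (P (e + 1) - P e)) (inner ℝ (P q - P e) (P q - P e))
    (inner ℝ (P k - P e) (P (e + 1) - P e)) (inner ℝ (P k - P e) (P k - P e))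

theorem segQuad_eq_dist_sq (P : ℕ → E) (e q : ℕ) (y : ℝ) :
    segQuad (inner ℝ (P (e + 1) - P e) (P (e + 1) - P e))
      (inner ℝ (P q - P e) (P (e + 1) - P e)) (inner ℝ (P q - P e) (P q - P e)) y =
      dist (P q) (edgePt P e y) ^ 2 := by
  have h : P q - edgePt P e y = (P q - P e) - y • (P (e + 1) - P e) := by
    rw [edgePt, AffineMap.lineMap_apply, vsub_eq_sub, vadd_eq_add]; abel
  rw [dist_eq_norm, h, norm_sub_sq_real, norm_smul, mul_pow, inner_smul_right,
    real_inner_self_eq_norm_sq, real_inner_self_eq_norm_sq, segQuad, Real.norm_eq_abs, sq_abs]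
  ring

theorem crit_le_iff (P : ℕ → E) (e q k : ℕ) (r : ℝ) :
    crit P e q k ≤ r ↔ ∃ y y', 0 ≤ y ∧ y ≤ y' ∧ y' ≤ 1 ∧ dist (P q) (edgePt P e y) ^ 2 ≤ r ∧
      dist (P k) (edgePt P e y') ^ 2 ≤ r := by
  have h0 : ∀ v : E, inner ℝ (P (e + 1) - P e) (P (e + 1) - P e) = 0 →
      inner ℝ v (P (e + 1) - P e) = 0 := by
    intro v hv
    rw [inner_self_eq_zero.1 hv, inner_zero_right]
  rw [crit, critSq_le_iff real_inner_self_nonneg (h0 _) (h0 _)]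
  simp only [segQuad_eq_dist_sq]

/-- `T e k` is the smallest `s` such that the critical values of the edge `e` and the pairs `(q, k)`
of vertices with `s ≤ q ≤ k` are all `≤ r` (or all `< r`, in the strict mode). -/
def IsTable (P : ℕ → E) (K : ℕ) (strict : Bool) (r : ℝ) (T : ℕ → ℕ → ℕ) : Prop :=
  ∀ e k, e + 1 < K → k < K → ∀ s, T e k ≤ s ↔ ∀ q, s ≤ q → q ≤ k → CmpLE strict (crit P e q k) r

/-- `y` is the smallest parameter of a point of the edge `e` within the squared distance `r` of the
vertex `q`. -/
def LeastFree (P : ℕ → E) (r : ℝ) (e q : ℕ) (y : ℝ) : Prop :=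
  IsLeast {y | y ∈ Set.Icc (0 : ℝ) 1 ∧ dist (P q) (edgePt P e y) ^ 2 ≤ r} y

theorem continuous_edgePt (P : ℕ → E) (e : ℕ) : Continuous (edgePt P e) :=
  AffineMap.lineMap_continuous

theorem exists_leastFree {P : ℕ → E} {r : ℝ} {e k : ℕ} (h : crit P e k k ≤ r) :
    ∃ y, LeastFree P r e k y := by
  obtain ⟨y, y', h0, hyy, h1, h, -⟩ := (crit_le_iff P e k k r).1 h
  refine IsCompact.exists_isLeast ?_ ⟨y, ⟨h0, hyy.trans h1⟩, h⟩
  have hc : IsClosed {y | dist (P k) (edgePt P e y) ^ 2 ≤ r} :=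
    isClosed_le ((continuous_const.dist (continuous_edgePt P e)).pow 2) continuous_const
  exact isCompact_Icc.inter_right hc

/-- The parameters within a given distance of a vertex form an interval. -/
theorem dist_edgePt_sq_le {P : ℕ → E} {r : ℝ} {e q : ℕ} {x y z : ℝ}
    (hx : dist (P q) (edgePt P e x) ^ 2 ≤ r) (hz : dist (P q) (edgePt P e z) ^ 2 ≤ r)
    (hxy : x ≤ y) (hyz : y ≤ z) : dist (P q) (edgePt P e y) ^ 2 ≤ r := by
  have hr : 0 ≤ r := (sq_nonneg _).trans hx
  rw [← Real.le_sqrt dist_nonneg hr] at *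
  have hc : Convex ℝ {t : ℝ | dist (P q) (edgePt P e t) ≤ √r} := by
    have hset : {t : ℝ | dist (P q) (edgePt P e t) ≤ √r} =
        (AffineMap.lineMap (P e) (P (e + 1)) : ℝ →ᵃ[ℝ] E) ⁻¹' Metric.closedBall (P q) (√r) := by
      ext t
      simp [edgePt, dist_comm]
    rw [hset]
    exact Convex.affine_preimage _ (convex_closedBall (P q) (√r))
  exact hc.ordConnected.out hx hz ⟨hxy, hyz⟩

/-- A monotone path that has passed the vertex `q` as low as possible on the edge `e` can pass the
vertex `k` on the same edge, if the critical values of `(q, k)` and `(k, k)` permit it. -/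
theorem LeastFree.advance {P : ℕ → E} {r : ℝ} {e q k : ℕ} {y : ℝ} (hy : LeastFree P r e q y)
    (hq : crit P e q k ≤ r) (hk : crit P e k k ≤ r) :
    ∃ y', y ≤ y' ∧ y' ≤ 1 ∧ dist (P k) (edgePt P e y') ^ 2 ≤ r ∧
      (LeastFree P r e q y' ∨ LeastFree P r e k y') := by
  obtain ⟨x, hx⟩ := exists_leastFree hk
  obtain ⟨z, z', h0, hzz, h1, hz, hz'⟩ := (crit_le_iff P e q k r).1 hq
  have hyz : y ≤ z := hy.2 ⟨⟨h0, hzz.trans h1⟩, hz⟩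
  have hxz : x ≤ z' := hx.2 ⟨⟨h0.trans hzz, h1⟩, hz'⟩
  rcases le_total x y with h | h
  · exact ⟨y, le_rfl, hy.1.1.2, dist_edgePt_sq_le hx.1.2 hz' h (hyz.trans hzz), Or.inl hy⟩
  · exact ⟨x, h, hx.1.1.2, hx.1.2, Or.inr hx⟩

end Crit

/-! ### The decision procedure -/

section Decision

variable (T : ℕ → ℕ → ℕ) (p : ℕ)

/-- One row of the dynamic program: the state of the left side of the cell `(i, j)`, from the states
`h i` of the lower sides of the cells in the row `j`. The state `0` says that the side is not
reachable; otherwise the state is the number of the first vertical line crossed in the row `j` by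
some path that reaches the side. The corner `(0, 0)` has the state `1`. -/
def dpV (h : ℕ → ℕ) (j : ℕ) : ℕ → ℕ
  | 0 => 1 - j
  | i + 1 =>
    if T (p + j) (i + 1) ≤ (if h i = 0 then dpV h j i else i + 1) then
      (if h i = 0 then dpV h j i else i + 1) else 0

/-- The states of the lower sides of the cells `(i, j)`; see `dpV`. A state different from `0` is
here the number, counted from `p`, of the first horizontal line crossed in the column `i`. -/
def dpH : ℕ → ℕ → ℕ
  | 0 => fun i => 1 - i
  | j + 1 => fun i =>
    if T i (p + j + 1) ≤ (if dpV T p (dpH j) j i = 0 then dpH j i else p + j + 1) then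
      (if dpV T p (dpH j) j i = 0 then dpH j i else p + j + 1) else 0

theorem dpH_zero (i : ℕ) : dpH T p 0 i = 1 - i := rfl

theorem dpH_succ (j i : ℕ) : dpH T p (j + 1) i =
    if T i (p + j + 1) ≤ (if dpV T p (dpH T p j) j i = 0 then dpH T p j i else p + j + 1) then
      (if dpV T p (dpH T p j) j i = 0 then dpH T p j i else p + j + 1) else 0 := rfl

/-- The dynamic program finds that the cell `(i, j)` is reachable. -/
def Entered (i j : ℕ) : Prop := dpV T p (dpH T p j) j i + dpH T p j i ≠ 0

/-- If times `s i` and `u j` of passing the lines of the free space diagram are consistent with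
the table, then the dynamic program reaches the last cell. -/
theorem entered_of_times {T : ℕ → ℕ → ℕ} {p m n : ℕ} (hm : 1 ≤ m) (hn : 1 ≤ n) {s u : ℕ → ℝ}
    (hs0 : s 0 = 0) (hu0 : u 0 = 0) (hsm : s m = u n)
    (hs : ∀ i i', i < i' → i' ≤ m → s i < s i') (hu : ∀ j j', j < j' → j' ≤ n → u j < u j')
    (hV : ∀ j k w, j < n → k ≤ m → w ≤ k → u j ≤ s w → s k ≤ u (j + 1) → T (p + j) k ≤ w)
    (hH : ∀ i k w, i < m → k ≤ n → w ≤ k → s i ≤ u w → u k ≤ s (i + 1) → T i (p + k) ≤ p + w) :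
    Entered T p (m - 1) (n - 1) := by
  have main : ∀ d i j, i + j = d →
      (i ≤ m → j < n → 1 ≤ i → u j ≤ s i → s i ≤ u (j + 1) →
        dpV T p (dpH T p j) j i ≠ 0 ∧ dpV T p (dpH T p j) j i ≤ i ∧
          u j ≤ s (dpV T p (dpH T p j) j i)) ∧
      (i < m → j ≤ n → 1 ≤ j → s i ≤ u j → u j ≤ s (i + 1) →
        ∃ c, dpH T p j i = p + c ∧ 1 ≤ c ∧ c ≤ j ∧ s i ≤ u c) := by
    intro d
    induction d with
    | zero =>
      intro i j hij
      refine ⟨fun _ _ _ _ _ => by omega, fun _ _ _ _ _ => by omega⟩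
    | succ d ih =>
      intro i j hij
      constructor
      · intro him hjn hi h1 h2
        obtain ⟨i, rfl⟩ : ∃ i', i = i' + 1 := ⟨i - 1, by omega⟩
        have hw : ∃ w, (if dpH T p j i = 0 then dpV T p (dpH T p j) j i else i + 1) = w ∧
            w ≠ 0 ∧ w ≤ i + 1 ∧ u j ≤ s w := by
          refine ⟨_, rfl, ?_⟩
          split_ifs with hh
          · rcases le_or_gt (u j) (s i) with h3 | h3
            · rcases Nat.eq_zero_or_pos i with rfl | hi'
              · exfalso
                rcases Nat.eq_zero_or_pos j with rfl | hj
                · simp [dpH] at hh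
                · linarith [hu 0 j hj hjn.le]
              · obtain ⟨h4, h5, h6⟩ := (ih i j (by omega)).1 (by omega) hjn hi' h3
                  ((hs i (i + 1) (by omega) him).le.trans h2)
                exact ⟨h4, by omega, h6⟩
            · exfalso
              have hj : 1 ≤ j := by
                by_contra! hj
                obtain rfl : j = 0 := by omega
                rcases Nat.eq_zero_or_pos i with rfl | hi'
                · linarith
                · linarith [hs 0 i hi' (by omega)]
              obtain ⟨c, h4, h5, -⟩ := (ih i j (by omega)).2 (by omega) hjn.le hj h3.le h1
              omega
          · exact ⟨by omega, le_rfl, h1⟩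
        obtain ⟨w, hw, hw0, hwi, hws⟩ := hw
        rw [dpV, hw, if_pos (hV j (i + 1) w hjn him hwi hws h2)]
        exact ⟨hw0, hwi, hws⟩
      · intro him hjn hj h1 h2
        obtain ⟨j, rfl⟩ : ∃ j', j = j' + 1 := ⟨j - 1, by omega⟩
        have hw : ∃ c, (if dpV T p (dpH T p j) j i = 0 then dpH T p j i else p + j + 1) = p + c ∧
            1 ≤ c ∧ c ≤ j + 1 ∧ s i ≤ u c := by
          split_ifs with hh
          · rcases le_or_gt (s i) (u j) with h3 | h3
            · rcases Nat.eq_zero_or_pos j with rfl | hj'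
              · exfalso
                rcases Nat.eq_zero_or_pos i with rfl | hi
                · simp [dpV] at hh
                · linarith [hs 0 i hi him.le]
              · obtain ⟨c, h4, h5, h6, h7⟩ := (ih i j (by omega)).2 him (by omega) hj' h3
                  ((hu j (j + 1) (by omega) hjn).le.trans h2)
                exact ⟨c, h4, h5, by omega, h7⟩
            · exfalso
              have hi : 1 ≤ i := by
                by_contra! hi
                obtain rfl : i = 0 := by omega
                rcases Nat.eq_zero_or_pos j with rfl | hj'
                · linarith
                · linarith [hu 0 j hj' (by omega)]
              exact ((ih i j (by omega)).1 him.le (by omega) hi h3.le h1).1 hh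
          · exact ⟨j + 1, by omega, by omega, le_rfl, h1⟩
        obtain ⟨c, hw, hc1, hcj, hcs⟩ := hw
        refine ⟨c, ?_, hc1, hcj, hcs⟩
        rw [dpH]
        simp only [hw]
        rw [if_pos]
        exact hH i (j + 1) c him hjn hcj hcs h2
  unfold Entered
  obtain ⟨m, rfl⟩ : ∃ m', m = m' + 1 := ⟨m - 1, by omega⟩
  obtain ⟨n, rfl⟩ : ∃ n', n = n' + 1 := ⟨n - 1, by omega⟩
  simp only [Nat.add_sub_cancel]
  rcases Nat.eq_zero_or_pos m with rfl | hm'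
  · rcases Nat.eq_zero_or_pos n with rfl | hn'
    · simp [dpV]
    · obtain ⟨c, h, h1, -⟩ := (main _ 0 n rfl).2 (by omega) (by omega) hn'
        (by rw [hs0, ← hu0]; exact (hu 0 n hn' (by omega)).le)
        (by rw [hsm]; exact (hu _ _ (by omega) le_rfl).le)
      omega
  · rcases le_total (u n) (s m) with h | h
    · have := ((main _ m n rfl).1 (by omega) (by omega) hm' h
        (by rw [← hsm]; exact (hs _ _ (by omega) le_rfl).le)).1
      omega
    · have hn' : 1 ≤ n := by
        by_contra! hn'
        obtain rfl : n = 0 := by omega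
        linarith [hs 0 m hm' (by omega)]
      obtain ⟨c, h, h1, -⟩ := (main _ m n rfl).2 (by omega) (by omega) hn' h
        (by rw [hsm]; exact (hu _ _ (by omega) le_rfl).le)
      omega

end Decision

theorem dpV_le (T : ℕ → ℕ → ℕ) (p : ℕ) (h : ℕ → ℕ) (j i : ℕ) : dpV T p h j i ≤ i + 1 := by
  induction i with
  | zero => rw [dpV]; omega
  | succ i ih => rw [dpV]; split_ifs <;> omega

theorem dpH_le (T : ℕ → ℕ → ℕ) (p j i : ℕ) : dpH T p j i ≤ p + j + 1 := by
  induction j with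
  | zero => rw [dpH_zero]; omega
  | succ j ih => rw [dpH_succ]; split_ifs <;> omega

/-! ### Paths in the free space diagram -/

section Paths

variable {l m n : ℕ}

/-- The polygonal curve with its `i`-th edge traversed during the interval `[i, i + 1]`. -/
def arc (P : Fin (m + 1) → EuclideanSpace ℝ (Fin l)) (x : ℝ) : EuclideanSpace ℝ (Fin l) :=
  P 0 + ∑ i : Fin m, (max 0 (min 1 (x - (i : ℝ)))) • (P i.succ - P i.castSucc)

theorem polyline_eq_arc (P : Fin (m + 1) → EuclideanSpace ℝ (Fin l)) (t : I) :
    polyline P t = arc P (m * t) := rfl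

theorem arc_edge (P : Fin (m + 1) → EuclideanSpace ℝ (Fin l)) (i : Fin m) {s : ℝ} (hs : s ∈ I) :
    arc P (i + s) = AffineMap.lineMap (P i.castSucc) (P i.succ) s := by
  have hm : (0 : ℝ) < m := by exact_mod_cast i.pos
  have hi : ((i : ℕ) : ℝ) + 1 ≤ m := by exact_mod_cast i.isLt
  have ht : ((i : ℝ) + s) / m ∈ I :=
    ⟨div_nonneg (add_nonneg (Nat.cast_nonneg _) hs.1) hm.le,
      (div_le_one hm).2 (by linarith [hs.2])⟩
  rw [← polyline_apply_edge P i s hs ⟨_, ht⟩ rfl, polyline_eq_arc]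
  congr 1
  simp only
  field_simp

variable (A : Fin (m + 1) → EuclideanSpace ℝ (Fin l)) (B : Fin (n + 1) → EuclideanSpace ℝ (Fin l))

/-- The vertices of both curves in a single sequence, those of the first curve being first. -/
def vertex (v : ℕ) : EuclideanSpace ℝ (Fin l) :=
  if h : v < m + 1 then A ⟨v, h⟩ else if h : v - (m + 1) < n + 1 then B ⟨v - (m + 1), h⟩ else 0

theorem vertex_left {i : ℕ} (hi : i < m + 1) : vertex A B i = A ⟨i, hi⟩ := dif_pos hi

theorem vertex_right {j : ℕ} (hj : j < n + 1) : vertex A B (m + 1 + j) = B ⟨j, hj⟩ := by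
  rw [vertex, dif_neg (by omega), dif_pos (by omega)]
  congr 2
  omega

theorem arc_left {i : ℕ} (hi : i < m) {s : ℝ} (h0 : 0 ≤ s) (h1 : s ≤ 1) :
    arc A (i + s) = edgePt (vertex A B) i s := by
  rw [edgePt, vertex_left A B (show i < m + 1 by omega),
    vertex_left A B (show i + 1 < m + 1 by omega)]
  exact arc_edge A ⟨i, hi⟩ ⟨h0, h1⟩

theorem arc_right {j : ℕ} (hj : j < n) {s : ℝ} (h0 : 0 ≤ s) (h1 : s ≤ 1) :
    arc B (j + s) = edgePt (vertex A B) (m + 1 + j) s := by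
  rw [edgePt, vertex_right A B (show j < n + 1 by omega),
    add_assoc, vertex_right A B (show j + 1 < n + 1 by omega)]
  exact arc_edge B ⟨j, hj⟩ ⟨h0, h1⟩

theorem arc_left_nat (hm : 1 ≤ m) {i : ℕ} (hi : i ≤ m) : arc A i = vertex A B i := by
  rcases hi.eq_or_lt with rfl | hi
  · have := arc_left A B (show i - 1 < i by omega) zero_le_one le_rfl
    rw [Nat.cast_sub hm, Nat.cast_one, sub_add_cancel] at this
    rw [this, edgePt, AffineMap.lineMap_apply_one, Nat.sub_add_cancel hm]
  · have := arc_left A B hi le_rfl zero_le_one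
    rwa [add_zero, edgePt, AffineMap.lineMap_apply_zero] at this

theorem arc_right_nat (hn : 1 ≤ n) {j : ℕ} (hj : j ≤ n) :
    arc B j = vertex A B (m + 1 + j) := by
  rcases hj.eq_or_lt with rfl | hj
  · have := arc_right A B (show j - 1 < j by omega) zero_le_one le_rfl
    rw [Nat.cast_sub hn, Nat.cast_one, sub_add_cancel] at this
    rw [this, edgePt, AffineMap.lineMap_apply_one, add_assoc, Nat.sub_add_cancel hn]
  · have := arc_right A B hj le_rfl zero_le_one
    rwa [add_zero, edgePt, AffineMap.lineMap_apply_zero] at this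

/-- Some pair of reparametrizations keeps all squared distances of matched points at most `r`. -/
def FrechetLE (r : ℝ) : Prop :=
  ∃ f ∈ reparametrizations, ∃ g ∈ reparametrizations,
    ∀ t : I, dist (polyline A (f t)) (polyline B (g t)) ^ 2 ≤ r

theorem FrechetLE.mono {A : Fin (m + 1) → EuclideanSpace ℝ (Fin l)}
    {B : Fin (n + 1) → EuclideanSpace ℝ (Fin l)} {r r' : ℝ} (h : FrechetLE A B r) (hr : r ≤ r') :
    FrechetLE A B r' := by
  obtain ⟨f, hf, g, hg, h⟩ := h
  exact ⟨f, hf, g, hg, fun t => (h t).trans hr⟩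

/-- Times at which a reparametrization passes the vertices, from `0` to `1` in increasing order. -/
theorem exists_passing_times (hm : 1 ≤ m) {f : C(I, I)} (hf : f ∈ reparametrizations) :
    ∃ s : ℕ → I, s 0 = 0 ∧ s m = 1 ∧ (∀ i ≤ m, (m : ℝ) * f (s i) = i) ∧
      ∀ i i', i < i' → i' ≤ m → s i < s i' := by
  have hm0 : (0 : ℝ) < m := by exact_mod_cast hm
  have key : ∀ i : ℕ, ∃ t : I, (i = 0 → t = 0) ∧ (i = m → t = 1) ∧ (i ≤ m → (m : ℝ) * f t = i) := by
    intro i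
    by_cases h0 : i = 0
    · subst h0
      exact ⟨0, fun _ => rfl, fun h => by omega, fun _ => by simp [hf.2.1]⟩
    by_cases h1 : i = m
    · subst h1
      exact ⟨1, fun h => by omega, fun _ => rfl, fun _ => by simp [hf.2.2]⟩
    by_cases h2 : i ≤ m
    · have h3 : (i : ℝ) / m ∈ I :=
        ⟨by positivity, (div_le_one hm0).2 (by exact_mod_cast h2)⟩
      obtain ⟨t, -, ht⟩ := intermediate_value_Icc (zero_le_one : (0 : I) ≤ 1)
        f.continuous.continuousOn (show (⟨_, h3⟩ : I) ∈ Set.Icc (f 0) (f 1) by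
          rw [hf.2.1, hf.2.2]; exact ⟨h3.1, h3.2⟩)
      refine ⟨t, fun h => absurd h h0, fun h => absurd h h1, fun _ => ?_⟩
      rw [ht]
      field_simp
    · exact ⟨0, fun _ => rfl, fun h => absurd h h1, fun h => absurd h h2⟩
  choose s hs0 hs1 hs using key
  refine ⟨s, hs0 0 rfl, hs1 m rfl, hs, fun i i' hi hi' => ?_⟩
  by_contra! h
  have h1 : (f (s i') : ℝ) ≤ f (s i) := hf.1 h
  have h2 : (i' : ℝ) ≤ i := by
    rw [← hs i' hi', ← hs i (by omega)]
    gcongr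
  have : i' ≤ i := by exact_mod_cast h2
  omega

/-- A pair of reparametrizations gives a way through the free space diagram to the dynamic
program. -/
theorem entered_of_frechetLE (hm : 1 ≤ m) (hn : 1 ≤ n) {r : ℝ} {T : ℕ → ℕ → ℕ}
    (hT : IsTable (vertex A B) (m + 1 + (n + 1)) false r T) (h : FrechetLE A B r) :
    Entered T (m + 1) (m - 1) (n - 1) := by
  obtain ⟨f, hf, g, hg, h⟩ := h
  obtain ⟨s, hs0, hsm, hs, hs'⟩ := exists_passing_times hm hf
  obtain ⟨u, hu0, hun, hu, hu'⟩ := exists_passing_times hn hg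
  have hsle : ∀ i i', i ≤ i' → i' ≤ m → s i ≤ s i' := fun i i' h h' =>
    h.eq_or_lt.elim (fun h => by rw [h]) fun h => (hs' i i' h h').le
  have hule : ∀ i i', i ≤ i' → i' ≤ n → u i ≤ u i' := fun i i' h h' =>
    h.eq_or_lt.elim (fun h => by rw [h]) fun h => (hu' i i' h h').le
  have hn0 : (0 : ℝ) < n := by exact_mod_cast hn
  have hm0 : (0 : ℝ) < m := by exact_mod_cast hm
  refine entered_of_times (s := fun i => (s i : ℝ)) (u := fun i => (u i : ℝ)) hm hn
    (by simp [hs0]) (by simp [hu0]) (by simp [hsm, hun]) hs' hu' ?_ ?_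
  · intro j k w hj hk hw h1 h2
    rw [hT _ _ (by omega) (by omega)]
    intro q hq hqk
    have hpos : ∀ i ≤ m, u j ≤ s i → s i ≤ u (j + 1) →
        dist (vertex A B i) (edgePt (vertex A B) (m + 1 + j) (n * g (s i) - j)) ^ 2 ≤ r ∧
          0 ≤ n * (g (s i) : ℝ) - j ∧ n * (g (s i) : ℝ) - j ≤ 1 := by
      intro i hi h1 h2
      have h3 : (g (u j) : ℝ) ≤ g (s i) := hg.1 h1
      have h4 : (g (s i) : ℝ) ≤ g (u (j + 1)) := hg.1 h2
      have h5 : (0 : ℝ) ≤ n * g (s i) - j := by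
        rw [← hu j hj.le, ← mul_sub]
        exact mul_nonneg hn0.le (by linarith)
      have h6 : n * (g (s i) : ℝ) - j ≤ 1 := by
        have := hu (j + 1) hj
        push_cast at this
        nlinarith
      refine ⟨?_, h5, h6⟩
      have := h (s i)
      rw [polyline_eq_arc, polyline_eq_arc, hs i hi, arc_left_nat A B hm hi] at this
      rwa [← arc_right A B hj h5 h6, add_sub_cancel]
    have hwm : w ≤ m := by omega
    obtain ⟨a1, a2, a3⟩ := hpos q (by omega) (le_trans h1 (hsle w q hq (by omega)))
      ((hsle q k hqk hk).trans h2)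
    obtain ⟨b1, b2, b3⟩ := hpos k hk (le_trans h1 (hsle w k (by omega) hk)) h2
    refine (crit_le_iff _ _ _ _ _).2 ⟨_, _, a2, ?_, b3, a1, b1⟩
    have : (g (s q) : ℝ) ≤ g (s k) := hg.1 (hsle q k hqk hk)
    nlinarith
  · intro i k w hi hk hw h1 h2
    rw [hT _ _ (by omega) (by omega)]
    intro q hq hqk
    obtain ⟨q, rfl⟩ : ∃ q', q = m + 1 + q' := ⟨q - (m + 1), by omega⟩
    replace hq : w ≤ q := by omega
    replace hqk : q ≤ k := by omega
    have hpos : ∀ j ≤ n, s i ≤ u j → u j ≤ s (i + 1) →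
        dist (vertex A B (m + 1 + j)) (edgePt (vertex A B) i (m * f (u j) - i)) ^ 2 ≤ r ∧
          0 ≤ m * (f (u j) : ℝ) - i ∧ m * (f (u j) : ℝ) - i ≤ 1 := by
      intro j hj h1 h2
      have h3 : (f (s i) : ℝ) ≤ f (u j) := hf.1 h1
      have h4 : (f (u j) : ℝ) ≤ f (s (i + 1)) := hf.1 h2
      have h5 : (0 : ℝ) ≤ m * f (u j) - i := by
        rw [← hs i hi.le, ← mul_sub]
        exact mul_nonneg hm0.le (by linarith)
      have h6 : m * (f (u j) : ℝ) - i ≤ 1 := by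
        have := hs (i + 1) hi
        push_cast at this
        nlinarith
      refine ⟨?_, h5, h6⟩
      have := h (u j)
      rw [polyline_eq_arc, polyline_eq_arc, hu j hj, arc_right_nat A B hn hj, dist_comm] at this
      rwa [← arc_left A B hi h5 h6, add_sub_cancel]
    obtain ⟨a1, a2, a3⟩ := hpos q (by omega) (le_trans h1 (hule w q hq (by omega)))
      ((hule q k hqk hk).trans h2)
    obtain ⟨b1, b2, b3⟩ := hpos k hk (le_trans h1 (hule w k (by omega) hk)) h2
    refine (crit_le_iff _ _ _ _ _).2 ⟨_, _, a2, ?_, b3, a1, b1⟩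
    have : (f (u q) : ℝ) ≤ f (u k) := hf.1 (hule q k hqk hk)
    nlinarith

/-- The point `(x, y)` of the free space diagram is the end of a monotone path through the free
space (at the squared distance `r`) that begins at `(0, 0)`. -/
def Reach (r x y : ℝ) : Prop :=
  ∃ γ : Path ((0 : ℝ), (0 : ℝ)) (x, y), Monotone γ ∧ ∀ t, dist (arc A (γ t).1) (arc B (γ t).2) ^ 2 ≤ r

variable {A B}

theorem Reach.free {r x y : ℝ} (h : Reach A B r x y) : dist (arc A x) (arc B y) ^ 2 ≤ r := by
  obtain ⟨γ, -, h⟩ := h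
  simpa using h 1

theorem Path.monotone_trans {X : Type*} [TopologicalSpace X] [Preorder X] {x y z : X}
    {γ : Path x y} {γ' : Path y z} (h : Monotone γ) (h' : Monotone γ') :
    Monotone (γ.trans γ') := by
  intro t t' ht
  have ht' : (t : ℝ) ≤ t' := ht
  rw [Path.trans_apply, Path.trans_apply]
  split_ifs with h1 h2 h2
  · exact h (by rw [Subtype.mk_le_mk]; linarith)
  · have e1 := h (le_top (a := (⟨2 * (t : ℝ), (unitInterval.mul_pos_mem_iff zero_lt_two).2
      ⟨t.2.1, h1⟩⟩ : I)))
    have e2 := h' (bot_le (a := (⟨2 * (t' : ℝ) - 1, unitInterval.two_mul_sub_one_mem_iff.2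
      ⟨(not_le.1 h2).le, t'.2.2⟩⟩ : I)))
    have e3 : γ ⊤ = y := γ.target
    have e4 : γ' ⊥ = y := γ'.source
    exact e1.trans (e3.le.trans (e4.ge.trans e2))
  · linarith
  · exact h' (by rw [Subtype.mk_le_mk]; linarith)

/-- A cell of the free space diagram is convex, so that its free points are joined by segments. -/
theorem Reach.extend {r x y x' y' : ℝ} (h : Reach A B r x y) {i j : ℕ} (hi : i < m) (hj : j < n)
    (hx : (i : ℝ) ≤ x) (hx' : x' ≤ i + 1) (hxx : x ≤ x') (hy : (j : ℝ) ≤ y) (hy' : y' ≤ j + 1)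
    (hyy : y ≤ y') (hf : dist (arc A x') (arc B y') ^ 2 ≤ r) : Reach A B r x' y' := by
  have hfree := h.free
  obtain ⟨γ, hγ, hγf⟩ := h
  let seg : Path (x, y) (x', y') :=
    { toFun := fun t => (x + t * (x' - x), y + t * (y' - y))
      continuous_toFun := by fun_prop
      source' := by simp
      target' := by simp }
  have hseg : ∀ t, seg t = (x + t * (x' - x), y + t * (y' - y)) := fun t => rfl
  refine ⟨γ.trans seg, Path.monotone_trans hγ ?_, ?_⟩
  · intro t t' ht
    have ht' : (t : ℝ) ≤ t' := ht
    rw [hseg, hseg]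
    exact ⟨by simp only; nlinarith, by simp only; nlinarith⟩
  · have hseg : ∀ t, dist (arc A (seg t).1) (arc B (seg t).2) ^ 2 ≤ r := by
      intro t
      have hr : 0 ≤ r := (sq_nonneg _).trans hf
      have ht0 : (0 : ℝ) ≤ t := t.2.1
      have ht1 : (t : ℝ) ≤ 1 := t.2.2
      rw [← Real.le_sqrt dist_nonneg hr, dist_eq_norm] at *
      have eA : ∀ z, (i : ℝ) ≤ z → z ≤ i + 1 →
          arc A z = A (Fin.castSucc ⟨i, hi⟩) + (z - i) • (A (Fin.succ ⟨i, hi⟩) - A (Fin.castSucc ⟨i, hi⟩)) := by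
        intro z h1 h2
        have := arc_edge A ⟨i, hi⟩ (s := z - i) ⟨by linarith, by linarith⟩
        simp only [add_sub_cancel] at this
        rw [this, AffineMap.lineMap_apply, vsub_eq_sub, vadd_eq_add, add_comm]
      have eB : ∀ z, (j : ℝ) ≤ z → z ≤ j + 1 →
          arc B z = B (Fin.castSucc ⟨j, hj⟩) + (z - j) • (B (Fin.succ ⟨j, hj⟩) - B (Fin.castSucc ⟨j, hj⟩)) := by
        intro z h1 h2
        have := arc_edge B ⟨j, hj⟩ (s := z - j) ⟨by linarith, by linarith⟩
        simp only [add_sub_cancel] at this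
        rw [this, AffineMap.lineMap_apply, vsub_eq_sub, vadd_eq_add, add_comm]
      have key : arc A (seg t).1 - arc B (seg t).2 =
          (1 - (t : ℝ)) • (arc A x - arc B y) + (t : ℝ) • (arc A x' - arc B y') := by
        rw [hseg, eA x hx (by linarith), eA x' (by linarith) hx', eB y hy (by linarith),
          eB y' (by linarith) hy', eA _ (by nlinarith) (by nlinarith),
          eB _ (by nlinarith) (by nlinarith)]
        module
      rw [key]
      refine (norm_add_le _ _).trans ?_
      rw [norm_smul, norm_smul, Real.norm_of_nonneg ht0, Real.norm_of_nonneg (by linarith)]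
      nlinarith
    intro t
    rw [Path.trans_apply]
    split_ifs
    · exact hγf _
    · exact hseg _

/-- The dynamic program only finds what a monotone path through the free space reaches. -/
theorem frechetLE_of_entered (hm : 1 ≤ m) (hn : 1 ≤ n) {r : ℝ} {T : ℕ → ℕ → ℕ}
    (hT : IsTable (vertex A B) (m + 1 + (n + 1)) false r T)
    (h0 : dist (arc A 0) (arc B 0) ^ 2 ≤ r) (h1 : dist (arc A m) (arc B n) ^ 2 ≤ r)
    (h : Entered T (m + 1) (m - 1) (n - 1)) : FrechetLE A B r := by
  set P := vertex A B with hP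
  have hstart : Reach A B r 0 0 := by
    refine ⟨Path.refl _, fun _ _ _ => le_rfl, fun t => ?_⟩
    simpa using h0
  have main : ∀ d i j, i + j = d →
      (i ≤ m → j < n → dpV T (m + 1) (dpH T (m + 1) j) j i ≠ 0 →
        ∃ y, 0 ≤ y ∧ y ≤ 1 ∧ Reach A B r i (j + y) ∧ (1 ≤ i →
          ∃ q, dpV T (m + 1) (dpH T (m + 1) j) j i ≤ q ∧ q ≤ i ∧
            LeastFree P r (m + 1 + j) q y)) ∧
      (i < m → j ≤ n → dpH T (m + 1) j i ≠ 0 →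
        ∃ x, 0 ≤ x ∧ x ≤ 1 ∧ Reach A B r (i + x) j ∧ (1 ≤ j →
          ∃ q, dpH T (m + 1) j i ≤ q ∧ q ≤ m + 1 + j ∧ LeastFree P r i q x)) := by
    intro d
    induction d with
    | zero =>
      intro i j hij
      obtain ⟨rfl, rfl⟩ : i = 0 ∧ j = 0 := by omega
      exact ⟨fun _ _ _ => ⟨0, le_rfl, zero_le_one, by simpa using hstart, fun h => by omega⟩,
        fun _ _ _ => ⟨0, le_rfl, zero_le_one, by simpa using hstart, fun h => by omega⟩⟩
    | succ d ih =>
      intro i j hij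
      constructor
      · intro him hjn hne
        rcases Nat.eq_zero_or_pos i with rfl | hi
        · rw [dpV] at hne
          omega
        obtain ⟨i, rfl⟩ : ∃ i', i = i' + 1 := ⟨i - 1, by omega⟩
        rw [dpV] at hne ⊢
        split_ifs at hne ⊢ with hh hT' hT'
        · obtain ⟨y, hy0, hy1, hreach, hq⟩ := (ih i j (by omega)).1 (by omega) hjn hne
          have hi' : 1 ≤ i := by
            by_contra! hi'
            obtain rfl : i = 0 := by omega
            cases j with
            | zero => simp [dpH] at hh
            | succ j => simp [dpV] at hne
          obtain ⟨q, hq1, hq2, hq3⟩ := hq hi'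
          rw [hT _ _ (by omega) (by omega)] at hT'
          obtain ⟨y', hyy, hy1', hfree, hor⟩ := hq3.advance (hT' q hq1 (by omega))
            (hT' (i + 1) (by omega) le_rfl)
          refine ⟨y', hy0.trans hyy, hy1', ?_, fun _ => ?_⟩
          · refine hreach.extend (show i < m by omega) hjn le_rfl (by push_cast; rfl)
              (by push_cast; linarith) (by linarith) (by linarith) (by linarith) ?_
            rwa [arc_right A B hjn (hy0.trans hyy) hy1', arc_left_nat A B hm him]
          · rcases hor with hor | hor
            · exact ⟨q, hq1, by omega, hor⟩
            · exact ⟨i + 1, by omega, le_rfl, hor⟩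
        · exact absurd rfl hne
        · obtain ⟨x, hx0, hx1, hreach, -⟩ := (ih i j (by omega)).2 (by omega) hjn.le hh
          rw [hT _ _ (by omega) (by omega)] at hT'
          obtain ⟨y', hy'⟩ := exists_leastFree (hT' (i + 1) le_rfl le_rfl)
          refine ⟨y', hy'.1.1.1, hy'.1.1.2, ?_, fun _ => ⟨i + 1, le_rfl, le_rfl, hy'⟩⟩
          refine hreach.extend (show i < m by omega) hjn (by linarith) (by push_cast; rfl)
              (by push_cast; linarith) le_rfl (by linarith [hy'.1.1.2])
              (by linarith [hy'.1.1.1]) ?_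
          rw [arc_right A B hjn hy'.1.1.1 hy'.1.1.2, arc_left_nat A B hm him]
          exact hy'.1.2
        · exact absurd rfl hne
      · intro him hjn hne
        rcases Nat.eq_zero_or_pos j with rfl | hj
        · rw [dpH_zero] at hne
          omega
        obtain ⟨j, rfl⟩ : ∃ j', j = j' + 1 := ⟨j - 1, by omega⟩
        rw [dpH_succ] at hne ⊢
        split_ifs at hne ⊢ with hh hT' hT'
        · obtain ⟨x, hx0, hx1, hreach, hq⟩ := (ih i j (by omega)).2 him (by omega) hne
          have hj' : 1 ≤ j := by
            by_contra! hj'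
            obtain rfl : j = 0 := by omega
            cases i with
            | zero => simp [dpV] at hh
            | succ i => simp [dpH] at hne
          obtain ⟨q, hq1, hq2, hq3⟩ := hq hj'
          rw [hT _ _ (by omega) (by omega)] at hT'
          obtain ⟨x', hxx, hx1', hfree, hor⟩ := hq3.advance (hT' q hq1 (by omega))
            (hT' (m + 1 + j + 1) (by omega) le_rfl)
          refine ⟨x', hx0.trans hxx, hx1', ?_, fun _ => ?_⟩
          · refine hreach.extend him (show j < n by omega) (by linarith) (by linarith)
              (by linarith) le_rfl (by push_cast; rfl) (by push_cast; linarith) ?_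
            rwa [arc_left A B him (hx0.trans hxx) hx1', arc_right_nat A B hn hjn, dist_comm]
          · rcases hor with hor | hor
            · exact ⟨q, hq1, by omega, hor⟩
            · exact ⟨m + 1 + j + 1, by omega, by omega, hor⟩
        · exact absurd rfl hne
        · obtain ⟨y, hy0, hy1, hreach, -⟩ := (ih i j (by omega)).1 him.le (by omega) hh
          rw [hT _ _ (by omega) (by omega)] at hT'
          obtain ⟨x', hx'⟩ := exists_leastFree (hT' (m + 1 + j + 1) le_rfl le_rfl)
          refine ⟨x', hx'.1.1.1, hx'.1.1.2, ?_, fun _ => ⟨m + 1 + j + 1, le_rfl, by omega, hx'⟩⟩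
          refine hreach.extend him (show j < n by omega) le_rfl (by linarith [hx'.1.1.2])
            (by linarith [hx'.1.1.1]) (by linarith) (by push_cast; rfl) (by push_cast; linarith) ?_
          rw [arc_left A B him hx'.1.1.1 hx'.1.1.2, arc_right_nat A B hn hjn, dist_comm]
          exact hx'.1.2
        · exact absurd rfl hne
  have hend : Reach A B r m n := by
    have hm' : ((m - 1 : ℕ) : ℝ) = m - 1 := by push_cast [Nat.cast_sub hm]; ring
    have hn' : ((n - 1 : ℕ) : ℝ) = n - 1 := by push_cast [Nat.cast_sub hn]; ring
    by_cases hv : dpV T (m + 1) (dpH T (m + 1) (n - 1)) (n - 1) (m - 1) = 0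
    · have hh : dpH T (m + 1) (n - 1) (m - 1) ≠ 0 := fun h' => h (by rw [hv, h'])
      obtain ⟨x, hx0, hx1, hreach, -⟩ := (main _ (m - 1) (n - 1) rfl).2 (by omega) (by omega) hh
      exact hreach.extend (show m - 1 < m by omega) (show n - 1 < n by omega) (by linarith)
        (by linarith) (by linarith) (by linarith) (by linarith) (by linarith) h1
    · obtain ⟨x, hx0, hx1, hreach, -⟩ := (main _ (m - 1) (n - 1) rfl).1 (by omega) (by omega) hv
      exact hreach.extend (show m - 1 < m by omega) (show n - 1 < n by omega) (by linarith)
        (by linarith) (by linarith) (by linarith) (by linarith) (by linarith) h1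
  obtain ⟨γ, hγ, hfree⟩ := hend
  have hm0 : (0 : ℝ) < m := by exact_mod_cast hm
  have hn0 : (0 : ℝ) < n := by exact_mod_cast hn
  have hlo : ∀ t, ((0 : ℝ), (0 : ℝ)) ≤ γ t := fun t => by
    simpa using hγ (show (0 : I) ≤ t from bot_le)
  have hhi : ∀ t, γ t ≤ ((m : ℝ), (n : ℝ)) := fun t => by
    simpa using hγ (show t ≤ (1 : I) from le_top)
  refine ⟨⟨fun t => ⟨(γ t).1 / m, div_nonneg (hlo t).1 hm0.le, (div_le_one hm0).2 (hhi t).1⟩,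
    by fun_prop⟩, ⟨fun t t' ht => ?_, ?_, ?_⟩,
    ⟨fun t => ⟨(γ t).2 / n, div_nonneg (hlo t).2 hn0.le, (div_le_one hn0).2 (hhi t).2⟩,
    by fun_prop⟩, ⟨fun t t' ht => ?_, ?_, ?_⟩, fun t => ?_⟩
  · exact div_le_div_of_nonneg_right (hγ ht).1 hm0.le
  · ext; simp
  · ext; simp [hm0.ne']
  · exact div_le_div_of_nonneg_right (hγ ht).2 hn0.le
  · ext; simp
  · ext; simp [hn0.ne']
  · rw [polyline_eq_arc, polyline_eq_arc]
    simp only [ContinuousMap.coe_mk]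
    rw [mul_div_cancel₀ _ hm0.ne', mul_div_cancel₀ _ hn0.ne']
    exact hfree t

end Paths

/-! ### Random selection of a candidate -/

section Selection

open Classical in
/-- If all elements of `S` are ranked by `v`, then the numbers of elements above are at most
`0, 1, …, #S - 1`. -/
theorem sum_card_above_le {ι : Type*} (v : ι → ℝ) {F : ℕ → ℝ} (hF : Monotone F) (S : Finset ι) :
    ∑ c ∈ S, F (S.filter fun c' => v c < v c').card ≤ ∑ i ∈ Finset.range S.card, F i := by
  induction h : S.card generalizing S with
  | zero => simp [Finset.card_eq_zero.1 h]
  | succ n ih =>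
    obtain ⟨c₀, hc₀, hmin⟩ := Finset.exists_min_image S v
      (Finset.card_pos.1 (by omega))
    have hcard : (S.erase c₀).card = n := by rw [Finset.card_erase_of_mem hc₀, h]; rfl
    rw [← Finset.add_sum_erase _ _ hc₀, Finset.sum_range_succ, add_comm]
    refine add_le_add ?_ (hF ?_)
    · refine le_trans (Finset.sum_le_sum fun c hc => hF ?_) (ih _ hcard)
      refine Finset.card_le_card fun c' hc' => ?_
      rw [Finset.mem_filter] at hc' ⊢
      refine ⟨Finset.mem_erase.2 ⟨?_, hc'.1⟩, hc'.2⟩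
      rintro rfl
      exact (hmin c (Finset.mem_of_mem_erase hc)).not_gt hc'.2
    · rw [← hcard]
      refine Finset.card_le_card fun c' hc' => ?_
      rw [Finset.mem_filter] at hc'
      refine Finset.mem_erase.2 ⟨?_, hc'.1⟩
      rintro rfl
      exact lt_irrefl _ hc'.2

theorem harmonic_mono : Monotone fun n => (harmonic n : ℝ) := by
  refine monotone_nat_of_le_succ fun n => ?_
  simp only [harmonic_succ, Rat.cast_add]
  have : (0 : ℝ) ≤ (((n + 1 : ℕ) : ℚ)⁻¹ : ℚ) := by positivity
  linarith

theorem sum_range_harmonic (n : ℕ) :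
    ∑ i ∈ Finset.range n, (harmonic i : ℝ) = n * harmonic n - n := by
  induction n with
  | zero => simp
  | succ n ih =>
    rw [Finset.sum_range_succ, ih, harmonic_succ]
    have : (n : ℝ) + 1 ≠ 0 := by positivity
    push_cast
    field_simp
    ring

/-- The case of harmonic numbers, whose partial sums are `∑ i < n, H i = n * H n - n`. -/
theorem sum_harmonic_above_le {ι : Type*} (v : ι → ℝ) (S : Finset ι) :
    ∑ c ∈ S, (harmonic (S.filter fun c' => v c < v c').card : ℝ) ≤
      S.card * harmonic S.card - S.card := by
  rw [← sum_range_harmonic]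
  convert sum_card_above_le v harmonic_mono S using 5

open Classical in
/-- The expected number of rounds of a random search for the smallest value with the property `G`
among the values `v c` of the candidates `c ∈ S`. -/
def searchPotential {ι : Type*} (G : ι → Prop) (S : Finset ι) : ℝ :=
  harmonic (S.filter fun c => ¬ G c).card + harmonic (S.filter G).card

open Classical in
/-- The candidates that remain after the candidate `c` has been tested. -/
def remaining {ι : Type*} (v : ι → ℝ) (G : ι → Prop) (S : Finset ι) (c : ι) : Finset ι :=
  if G c then S.filter fun c' => v c' < v c else S.filter fun c' => v c < v c'

theorem searchPotential_nonneg {ι : Type*} (G : ι → Prop) (S : Finset ι) :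
    0 ≤ searchPotential G S := by
  have h : ∀ n, (0 : ℝ) ≤ harmonic n := fun n => by
    simpa using harmonic_mono (Nat.zero_le n)
  exact add_nonneg (h _) (h _)

open Classical in
/-- One round of the random search decreases the potential by at least one on average. -/
theorem sum_searchPotential_remaining_le {ι : Type*} (v : ι → ℝ) (G : ι → Prop) (S : Finset ι) :
    ∑ c ∈ S, searchPotential G (remaining v G S c) ≤ S.card * (searchPotential G S - 1) := by
  set L := S.filter fun c => ¬ G c with hL
  set U := S.filter G with hU
  have hcard : (S.card : ℝ) = L.card + U.card := by
    rw [add_comm]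
    exact_mod_cast (Finset.card_filter_add_card_filter_not G (s := S)).symm
  have hsum : ∑ c ∈ S, searchPotential G (remaining v G S c) =
      ∑ c ∈ U, searchPotential G (remaining v G S c) +
        ∑ c ∈ L, searchPotential G (remaining v G S c) :=
    (Finset.sum_filter_add_sum_filter_not S G _).symm
  have h1 : ∑ c ∈ U, searchPotential G (remaining v G S c) ≤
      U.card * harmonic L.card + (U.card * harmonic U.card - U.card) := by
    have := sum_harmonic_above_le (fun c => - v c) U
    refine le_trans (Finset.sum_le_sum (g := fun c => (harmonic L.card : ℝ) +
      harmonic (U.filter fun c' => - v c < - v c').card) fun c hc => ?_) ?_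
    · have hG : G c := (Finset.mem_filter.1 hc).2
      rw [searchPotential, remaining, if_pos hG]
      refine add_le_add (harmonic_mono (Finset.card_le_card ?_))
        (harmonic_mono (Finset.card_le_card ?_))
      · intro c'; simp only [Finset.mem_filter, hL]; tauto
      · intro c'; simp only [Finset.mem_filter, hU, neg_lt_neg_iff]; tauto
    · rw [Finset.sum_add_distrib, Finset.sum_const, nsmul_eq_mul]
      exact add_le_add le_rfl (by convert this using 6)
  have h2 : ∑ c ∈ L, searchPotential G (remaining v G S c) ≤
      (L.card * harmonic L.card - L.card) + L.card * harmonic U.card := by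
    have := sum_harmonic_above_le v L
    refine le_trans (Finset.sum_le_sum (g := fun c =>
      (harmonic (L.filter fun c' => v c < v c').card : ℝ) + harmonic U.card) fun c hc => ?_) ?_
    · have hG : ¬ G c := (Finset.mem_filter.1 hc).2
      rw [searchPotential, remaining, if_neg hG]
      refine add_le_add (harmonic_mono (Finset.card_le_card ?_))
        (harmonic_mono (Finset.card_le_card ?_))
      · intro c'; simp only [Finset.mem_filter, hL]; tauto
      · intro c'; simp only [Finset.mem_filter, hU]; tauto
    · rw [Finset.sum_add_distrib, Finset.sum_const, nsmul_eq_mul]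
      exact add_le_add (by convert this using 6) le_rfl
  rw [hsum, hcard, searchPotential, ← hL, ← hU]
  linarith

theorem card_remaining_lt {ι : Type*} {v : ι → ℝ} {G : ι → Prop} {S : Finset ι} {c : ι}
    (hc : c ∈ S) : (remaining v G S c).card < S.card := by
  classical
  refine Finset.card_lt_card ⟨?_, fun h => ?_⟩
  · unfold remaining; split_ifs <;> exact Finset.filter_subset _ _
  · have := h hc
    unfold remaining at this
    split_ifs at this <;> exact lt_irrefl _ (Finset.mem_filter.1 this).2

theorem searchPotential_le {ι : Type*} (G : ι → Prop) (S : Finset ι) {n : ℕ} (hn : S.card ≤ n) :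
    searchPotential G S ≤ 2 * (1 + Real.log n) := by
  classical
  have h : ∀ k ≤ n, (harmonic k : ℝ) ≤ 1 + Real.log n := fun k hk =>
    (harmonic_mono hk).trans (harmonic_le_one_add_log n)
  have h1 := h _ ((Finset.card_filter_le S G).trans hn)
  have h2 := h _ ((Finset.card_filter_le S fun c => ¬ G c).trans hn)
  rw [searchPotential]
  linarith

/-- The candidates that lie between two tables `b ≤ a` with `n` entries: pairs of a place `x` and
a number in `[b x, a x)`. -/
def candidates (a b : ℕ → ℕ) (n : ℕ) : Finset (Σ _ : ℕ, ℕ) :=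
  (Finset.range n).sigma fun x => Finset.Ico (b x) (a x)

theorem mem_candidates {a b : ℕ → ℕ} {n : ℕ} {c : Σ _ : ℕ, ℕ} :
    c ∈ candidates a b n ↔ c.1 < n ∧ b c.1 ≤ c.2 ∧ c.2 < a c.1 := by
  simp [candidates]

theorem candidates_congr {a b a' b' : ℕ → ℕ} {n : ℕ} (ha : ∀ x < n, a' x = a x)
    (hb : ∀ x < n, b' x = b x) : candidates a' b' n = candidates a b n := by
  ext c
  simp only [mem_candidates]
  refine and_congr_right fun hc => ?_
  rw [ha _ hc, hb _ hc]

theorem card_candidates (a b : ℕ → ℕ) (n : ℕ) :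
    (candidates a b n).card = ∑ x ∈ Finset.range n, (a x - b x) := by
  simp [candidates]

/-- The candidate with the number `z`, when the candidates are numbered place by place. -/
def pick (a b : ℕ → ℕ) : ℕ → ℕ → Σ _ : ℕ, ℕ
  | 0, z => ⟨0, z⟩
  | n + 1, z =>
    if z < ∑ x ∈ Finset.range n, (a x - b x) then pick a b n z
    else ⟨n, b n + (z - ∑ x ∈ Finset.range n, (a x - b x))⟩

theorem pick_eq {a b : ℕ → ℕ} {n x z : ℕ} (hx : x < n) (hz : z < a x - b x) :
    pick a b n (∑ y ∈ Finset.range x, (a y - b y) + z) = ⟨x, b x + z⟩ := by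
  induction n with
  | zero => omega
  | succ n ih =>
    rw [pick]
    rcases Nat.lt_succ_iff_lt_or_eq.1 hx with h | rfl
    · rw [if_pos, ih h]
      have h1 : ∑ y ∈ Finset.range (x + 1), (a y - b y) ≤ ∑ y ∈ Finset.range n, (a y - b y) :=
        Finset.sum_le_sum_of_subset (Finset.range_mono h)
      rw [Finset.sum_range_succ] at h1
      omega
    · rw [if_neg (by omega), Nat.add_sub_cancel_left]

theorem exists_pick {a b : ℕ → ℕ} {n z : ℕ} (hz : z < ∑ x ∈ Finset.range n, (a x - b x)) :
    ∃ x < n, ∃ w < a x - b x, z = ∑ y ∈ Finset.range x, (a y - b y) + w := by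
  induction n with
  | zero => simp at hz
  | succ n ih =>
    by_cases h : z < ∑ x ∈ Finset.range n, (a x - b x)
    · obtain ⟨x, hx, h⟩ := ih h
      exact ⟨x, by omega, h⟩
    · rw [Finset.sum_range_succ] at hz
      exact ⟨n, by omega, z - ∑ x ∈ Finset.range n, (a x - b x), by omega, by omega⟩

/-- A uniformly random number picks a uniformly random candidate. -/
theorem sum_pick {R : Type*} [AddCommMonoid R] (a b : ℕ → ℕ) (n : ℕ) (f : (Σ _ : ℕ, ℕ) → R) :
    ∑ z ∈ Finset.range (∑ x ∈ Finset.range n, (a x - b x)), f (pick a b n z) =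
      ∑ c ∈ candidates a b n, f c := by
  rw [candidates, Finset.sum_sigma]
  induction n with
  | zero => simp
  | succ n ih =>
    rw [Finset.sum_range_succ _ n, Finset.sum_range_succ _ n, ← ih, Finset.sum_range_add]
    congr 1
    · refine Finset.sum_congr rfl fun z hz => ?_
      rw [pick, if_pos (Finset.mem_range.1 hz)]
    · rw [Finset.sum_Ico_eq_sum_range]
      refine Finset.sum_congr rfl fun z hz => ?_
      rw [pick, if_neg (by omega), Nat.add_sub_cancel_left]

end Selection

/-! ### Candidates for the Fréchet distance -/

section Candidates

variable {E : Type*} [NormedAddCommGroup E] [InnerProductSpace ℝ E]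

/-- The largest critical value of the edge `e` and the pairs `(q, k)` with `s ≤ q ≤ k`. -/
def critMax (P : ℕ → E) (e k s : ℕ) : ℝ :=
  (insert k (Finset.Icc s k)).sup' (Finset.insert_nonempty _ _) fun q => crit P e q k

theorem cmpLE_critMax_iff {P : ℕ → E} {e k s : ℕ} {strict : Bool} {r : ℝ} (hs : s ≤ k) :
    CmpLE strict (critMax P e k s) r ↔ ∀ q, s ≤ q → q ≤ k → CmpLE strict (crit P e q k) r := by
  have h : insert k (Finset.Icc s k) = Finset.Icc s k :=
    Finset.insert_eq_of_mem (Finset.right_mem_Icc.2 hs)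
  cases strict
  · simp only [CmpLE, critMax, Finset.sup'_le_iff, h, Finset.mem_Icc, and_imp]; rfl
  · simp only [CmpLE, critMax, Finset.sup'_lt_iff, h, Finset.mem_Icc, and_imp, if_true]

theorem IsTable.le_iff {P : ℕ → E} {K : ℕ} {strict : Bool} {r : ℝ} {T : ℕ → ℕ → ℕ}
    (hT : IsTable P K strict r T) {e k s : ℕ} (he : e + 1 < K) (hk : k < K) (hs : s ≤ k) :
    T e k ≤ s ↔ CmpLE strict (critMax P e k s) r := by
  rw [hT e k he hk, cmpLE_critMax_iff hs]

theorem IsTable.le_succ {P : ℕ → E} {K : ℕ} {strict : Bool} {r : ℝ} {T : ℕ → ℕ → ℕ}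
    (hT : IsTable P K strict r T) {e k : ℕ} (he : e + 1 < K) (hk : k < K) : T e k ≤ k + 1 := by
  rw [hT e k he hk]
  intro q h1 h2
  omega

end Candidates

/-! ### Bracketing the Fréchet distance between two tables -/

section Bracket

variable {m n l : ℕ} {A : Fin (m + 1) → EuclideanSpace ℝ (Fin l)}
  {B : Fin (n + 1) → EuclideanSpace ℝ (Fin l)}

theorem frechetDist_bddBelow (A : Fin (m + 1) → EuclideanSpace ℝ (Fin l))
    (B : Fin (n + 1) → EuclideanSpace ℝ (Fin l)) :
    BddBelow (Set.range fun fg : reparametrizations × reparametrizations =>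
      ⨆ t : I, dist (polyline A (fg.1.1 t)) (polyline B (fg.2.1 t))) :=
  ⟨0, by rintro _ ⟨fg, rfl⟩; exact Real.iSup_nonneg fun t => dist_nonneg⟩

theorem FrechetLE.frechetDist_le {r : ℝ} (h : FrechetLE A B r) :
    frechetDist (polyline A) (polyline B) ≤ √r := by
  obtain ⟨f, hf, g, hg, h⟩ := h
  exact (ciInf_le (frechetDist_bddBelow A B) (⟨f, hf⟩, ⟨g, hg⟩)).trans
    (ciSup_le fun t => Real.le_sqrt_of_sq_le (h t))

theorem id_mem_reparametrizations : ContinuousMap.id I ∈ reparametrizations :=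
  ⟨monotone_id, rfl, rfl⟩

theorem bddAbove_dist (A : Fin (m + 1) → EuclideanSpace ℝ (Fin l))
    (B : Fin (n + 1) → EuclideanSpace ℝ (Fin l)) (f g : C(I, I)) :
    BddAbove (Set.range fun t : I => dist (polyline A (f t)) (polyline B (g t))) :=
  (isCompact_range (by fun_prop)).bddAbove

/-- The Fréchet distance is the infimum of the numbers `√r` with `FrechetLE A B r`. -/
theorem le_frechetDist {x : ℝ} (h : ∀ r, FrechetLE A B r → x ≤ √r) :
    x ≤ frechetDist (polyline A) (polyline B) := by
  have : Nonempty (reparametrizations × reparametrizations) :=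
    ⟨⟨_, id_mem_reparametrizations⟩, ⟨_, id_mem_reparametrizations⟩⟩
  refine le_ciInf fun fg => ?_
  rw [← Real.sqrt_sq (Real.iSup_nonneg fun t => dist_nonneg)]
  refine h _ ⟨_, fg.1.2, _, fg.2.2, fun t => ?_⟩
  gcongr
  exact le_ciSup (bddAbove_dist A B fg.1.1 fg.2.1) t

theorem exists_frechetLE (A : Fin (m + 1) → EuclideanSpace ℝ (Fin l))
    (B : Fin (n + 1) → EuclideanSpace ℝ (Fin l)) : ∃ r, FrechetLE A B r := by
  obtain ⟨r, hr⟩ := bddAbove_dist A B (.id I) (.id I)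
  refine ⟨r ^ 2, _, id_mem_reparametrizations, _, id_mem_reparametrizations, fun t => ?_⟩
  gcongr
  exact hr ⟨t, rfl⟩

theorem FrechetLE.endpoints {r : ℝ} (h : FrechetLE A B r) :
    dist (arc A 0) (arc B 0) ^ 2 ≤ r ∧ dist (arc A m) (arc B n) ^ 2 ≤ r := by
  obtain ⟨f, hf, g, hg, h⟩ := h
  have h0 := h 0
  have h1 := h 1
  simp only [hf.2.1, hg.2.1, hf.2.2, hg.2.2, polyline_eq_arc] at h0 h1
  simpa using And.intro h0 h1

variable (A B) in
/-- The square of the larger one of the distances of the two starting points and of the two end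
points. -/
def endpointSq : ℝ :=
  max (dist (arc A 0) (arc B 0) ^ 2) (dist (arc A m) (arc B n) ^ 2)

theorem frechetDist_eq_of_endpointSq (h : FrechetLE A B (endpointSq A B)) :
    frechetDist (polyline A) (polyline B) = √(endpointSq A B) :=
  le_antisymm h.frechetDist_le
    (le_frechetDist fun _ hr => Real.sqrt_le_sqrt (max_le hr.endpoints.1 hr.endpoints.2))

/-- The value of a candidate `⟨x, s⟩`: the largest critical value of the edge `x / K` and the pairs
`(q, x % K)` with `s ≤ q`. -/
def candidateValue {E : Type*} [NormedAddCommGroup E] [InnerProductSpace ℝ E] (P : ℕ → E) (K : ℕ)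
    (c : Σ _ : ℕ, ℕ) : ℝ := critMax P (c.1 / K) (c.1 % K) c.2

variable (A B) in
/-- The threshold `α` is too small, but not smaller than the endpoint distances, and `β` is large
enough; `a` is the table of `α`, and `b` the table of `β` in the strict mode, row by row. -/
structure FrechetBracket (K : ℕ) (α β : ℝ) (a b : ℕ → ℕ) : Prop where
  hm : 1 ≤ m
  hn : 1 ≤ n
  hK : m + 1 + (n + 1) = K
  lower : ¬ FrechetLE A B α
  upper : FrechetLE A B β
  endpoints : endpointSq A B ≤ α
  tableLower : IsTable (vertex A B) K false α fun e k => a (e * K + k)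
  tableUpper : IsTable (vertex A B) K true β fun e k => b (e * K + k)

variable {K : ℕ} {α β : ℝ} {a b : ℕ → ℕ}

/-- The decision procedure: from the endpoint distances on, a threshold is large enough if and only if
the dynamic program on its table reaches the last cell. -/
theorem frechetLE_iff_entered (hm : 1 ≤ m) (hn : 1 ≤ n) (hK : m + 1 + (n + 1) = K) {r : ℝ}
    (hr : endpointSq A B ≤ r) {T : ℕ → ℕ → ℕ} (hT : IsTable (vertex A B) K false r T) :
    FrechetLE A B r ↔ Entered T (m + 1) (m - 1) (n - 1) := by
  obtain rfl := hK
  obtain ⟨h0, h1⟩ := max_le_iff.1 hr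
  exact ⟨entered_of_frechetLE A B hm hn hT, frechetLE_of_entered hm hn hT h0 h1⟩

theorem FrechetBracket.frechetLE_iff (h : FrechetBracket A B K α β a b) {r : ℝ} (hr : α ≤ r)
    {T : ℕ → ℕ → ℕ} (hT : IsTable (vertex A B) K false r T) :
    FrechetLE A B r ↔ Entered T (m + 1) (m - 1) (n - 1) :=
  frechetLE_iff_entered h.hm h.hn h.hK (h.endpoints.trans hr) hT

theorem place_lt {e k : ℕ} (he : e + 1 < K) (hk : k < K) : e * K + k < (K - 1) * K := by
  have : (e + 1) * K ≤ (K - 1) * K := Nat.mul_le_mul_right _ (by omega)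
  rw [add_mul, one_mul] at this
  omega

theorem IsTable.congr {E : Type*} [NormedAddCommGroup E] [InnerProductSpace ℝ E] {P : ℕ → E}
    {strict : Bool} {r : ℝ} {a' : ℕ → ℕ} (h : IsTable P K strict r fun e k => a (e * K + k))
    (ha : ∀ x < (K - 1) * K, a' x = a x) : IsTable P K strict r fun e k => a' (e * K + k) := by
  intro e k he hk s
  beta_reduce
  rw [ha _ (place_lt he hk)]
  exact h e k he hk s

theorem FrechetBracket.congr (h : FrechetBracket A B K α β a b) {a' b' : ℕ → ℕ}
    (ha : ∀ x < (K - 1) * K, a' x = a x) (hb : ∀ x < (K - 1) * K, b' x = b x) :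
    FrechetBracket A B K α β a' b' :=
  { h with tableLower := h.tableLower.congr ha, tableUpper := h.tableUpper.congr hb }

/-- If no candidate is left, then all thresholds in `[α, β)` have the same table as `α`, so the
decision procedure cannot tell them from `α`. -/
theorem FrechetBracket.le_of_frechetLE (h : FrechetBracket A B K α β a b)
    (hab : ∀ x < (K - 1) * K, a x ≤ b x) {r : ℝ} (hr : FrechetLE A B r) : β ≤ r := by
  by_contra! hrβ
  have hαr : α ≤ r := le_of_not_ge fun hle => h.lower (hr.mono hle)
  have hT : IsTable (vertex A B) K false r fun e k => a (e * K + k) := by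
    intro e k he hk s
    refine ⟨fun hs q h1 h2 => ?_, fun hs => ?_⟩
    · exact le_trans ((h.tableLower e k he hk s).1 hs q h1 h2) hαr
    · exact (hab _ (place_lt he hk)).trans
        ((h.tableUpper e k he hk s).2 fun q h1 h2 => lt_of_le_of_lt (hs q h1 h2) hrβ)
  exact h.lower ((h.frechetLE_iff le_rfl h.tableLower).2 ((h.frechetLE_iff hαr hT).1 hr))

theorem FrechetBracket.frechetDist_eq (h : FrechetBracket A B K α β a b)
    (hab : ∀ x < (K - 1) * K, a x ≤ b x) : frechetDist (polyline A) (polyline B) = √β :=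
  le_antisymm h.upper.frechetDist_le
    (le_frechetDist fun _ hr => Real.sqrt_le_sqrt (h.le_of_frechetLE hab hr))

/-- As long as the upper table is `0`, some candidate is left. -/
theorem FrechetBracket.exists_lt (h : FrechetBracket A B K α β a b) (hb : ∀ x < (K - 1) * K, b x = 0) :
    ∃ x < (K - 1) * K, b x < a x := by
  by_contra! hab
  have hαβ : α ≤ β := le_of_not_ge fun hle => h.lower (h.upper.mono hle)
  have hT : IsTable (vertex A B) K false β fun e k => a (e * K + k) := by
    intro e k he hk s
    have hx := place_lt he hk
    refine ⟨fun hs q h1 h2 => le_of_lt ?_, fun _ => ?_⟩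
    · exact (h.tableUpper e k he hk s).1 ((hb _ hx).le.trans (Nat.zero_le _)) q h1 h2
    · exact (hab _ hx).trans ((hb _ hx).le.trans (Nat.zero_le _))
  exact h.lower ((h.frechetLE_iff le_rfl h.tableLower).2
    ((h.frechetLE_iff hαβ hT).1 h.upper))

theorem place_split {x : ℕ} (hx : x < (K - 1) * K) :
    x / K + 1 < K ∧ x % K < K ∧ x / K * K + x % K = x := by
  have h0 : 0 < K := Nat.pos_of_ne_zero fun h0 => by simp [h0] at hx
  have := Nat.div_lt_of_lt_mul (by rwa [mul_comm] at hx)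
  exact ⟨by omega, Nat.mod_lt _ h0, Nat.div_add_mod' x K⟩

/-- The value of a candidate lies strictly between the thresholds. -/
theorem FrechetBracket.candidate (h : FrechetBracket A B K α β a b) {c : Σ _ : ℕ, ℕ}
    (hc : c ∈ candidates a b ((K - 1) * K)) :
    c.2 ≤ c.1 % K ∧ α < candidateValue (vertex A B) K c ∧ candidateValue (vertex A B) K c < β := by
  obtain ⟨hx, hb, ha⟩ := mem_candidates.1 hc
  obtain ⟨he, hk, hx'⟩ := place_split hx
  have h1 := h.tableLower.le_succ he hk
  rw [hx'] at h1
  have hs : c.2 ≤ c.1 % K := by omega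
  have h2 := h.tableLower.le_iff he hk hs
  have h3 := h.tableUpper.le_iff he hk hs
  rw [hx'] at h2 h3
  refine ⟨hs, lt_of_not_ge fun hle => ?_, h3.1 hb⟩
  exact absurd (h2.2 hle) (by omega)

/-- A candidate whose value is large enough replaces the upper threshold. -/
theorem FrechetBracket.set_upper (h : FrechetBracket A B K α β a b) {c : Σ _ : ℕ, ℕ}
    (hc : c ∈ candidates a b ((K - 1) * K))
    (hG : FrechetLE A B (candidateValue (vertex A B) K c)) {b' : ℕ → ℕ}
    (hb' : IsTable (vertex A B) K true (candidateValue (vertex A B) K c)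
      fun e k => b' (e * K + k)) :
    FrechetBracket A B K α (candidateValue (vertex A B) K c) a b' ∧
      candidates a b' ((K - 1) * K) = remaining (candidateValue (vertex A B) K)
        (fun c => FrechetLE A B (candidateValue (vertex A B) K c))
        (candidates a b ((K - 1) * K)) c := by
  obtain ⟨-, -, hvβ⟩ := h.candidate hc
  have h' : FrechetBracket A B K α (candidateValue (vertex A B) K c) a b' :=
    { h with upper := hG, tableUpper := hb' }
  refine ⟨h', Finset.ext fun d => ?_⟩
  rw [remaining, if_pos hG, Finset.mem_filter]
  constructor
  · intro hd
    obtain ⟨h1, -, h3⟩ := h'.candidate hd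
    obtain ⟨hx, -, ha⟩ := mem_candidates.1 hd
    obtain ⟨he, hk, hx'⟩ := place_split hx
    have := (h.tableUpper.le_iff he hk h1).2 (h3.trans hvβ)
    rw [hx'] at this
    exact ⟨mem_candidates.2 ⟨hx, this, ha⟩, h3⟩
  · rintro ⟨hd, hv⟩
    obtain ⟨h1, -, -⟩ := h.candidate hd
    obtain ⟨hx, -, ha⟩ := mem_candidates.1 hd
    obtain ⟨he, hk, hx'⟩ := place_split hx
    have := (hb'.le_iff he hk h1).2 hv
    rw [hx'] at this
    exact mem_candidates.2 ⟨hx, this, ha⟩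

/-- A candidate whose value is too small replaces the lower threshold. -/
theorem FrechetBracket.set_lower (h : FrechetBracket A B K α β a b) {c : Σ _ : ℕ, ℕ}
    (hc : c ∈ candidates a b ((K - 1) * K))
    (hG : ¬ FrechetLE A B (candidateValue (vertex A B) K c)) {a' : ℕ → ℕ}
    (ha' : IsTable (vertex A B) K false (candidateValue (vertex A B) K c)
      fun e k => a' (e * K + k)) :
    FrechetBracket A B K (candidateValue (vertex A B) K c) β a' b ∧
      candidates a' b ((K - 1) * K) = remaining (candidateValue (vertex A B) K)
        (fun c => FrechetLE A B (candidateValue (vertex A B) K c))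
        (candidates a b ((K - 1) * K)) c := by
  obtain ⟨-, hαv, -⟩ := h.candidate hc
  have h' : FrechetBracket A B K (candidateValue (vertex A B) K c) β a' b :=
    { h with lower := hG, tableLower := ha', endpoints := h.endpoints.trans hαv.le }
  refine ⟨h', Finset.ext fun d => ?_⟩
  rw [remaining, if_neg hG, Finset.mem_filter]
  constructor
  · intro hd
    obtain ⟨h1, h2, -⟩ := h'.candidate hd
    obtain ⟨hx, hb, -⟩ := mem_candidates.1 hd
    obtain ⟨he, hk, hx'⟩ := place_split hx
    have := fun hle => (hαv.trans h2).not_ge ((h.tableLower.le_iff he hk h1).1 hle)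
    rw [hx', imp_false, not_le] at this
    exact ⟨mem_candidates.2 ⟨hx, hb, this⟩, h2⟩
  · rintro ⟨hd, hv⟩
    obtain ⟨h1, -, -⟩ := h.candidate hd
    obtain ⟨hx, hb, -⟩ := mem_candidates.1 hd
    obtain ⟨he, hk, hx'⟩ := place_split hx
    have := fun hle => hv.not_ge ((ha'.le_iff he hk h1).1 hle)
    rw [hx', imp_false, not_le] at this
    exact mem_candidates.2 ⟨hx, hb, this⟩

/-- The upper table may be `0` in the beginning: it belongs to a threshold above all critical
values. -/
theorem exists_bracket (hm : 1 ≤ m) (hn : 1 ≤ n) (hK : m + 1 + (n + 1) = K)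
    (hα : ¬ FrechetLE A B (endpointSq A B))
    (ha : IsTable (vertex A B) K false (endpointSq A B) fun e k => a (e * K + k))
    (hb : ∀ x < (K - 1) * K, b x = 0) : ∃ β, FrechetBracket A B K (endpointSq A B) β a b := by
  obtain ⟨r, hr⟩ := exists_frechetLE A B
  obtain ⟨r', hr'⟩ := (((Finset.range K ×ˢ Finset.range K ×ˢ Finset.range K).image
    fun x => crit (vertex A B) x.1 x.2.1 x.2.2) : Finset ℝ).bddAbove
  refine ⟨max r (r' + 1), hm, hn, hK, hα, hr.mono (le_max_left _ _), le_rfl, ha, ?_⟩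
  intro e k he hk s
  refine ⟨fun _ q _ hq => ?_, fun _ => (hb _ (place_lt he hk)).le.trans (Nat.zero_le _)⟩
  refine lt_of_le_of_lt (hr' ?_) (lt_max_of_lt_right (lt_add_one r'))
  refine Finset.mem_coe.2 (Finset.mem_image.2 ⟨(e, q, k), ?_, rfl⟩)
  simp only [Finset.mem_product, Finset.mem_range]
  omega

end Bracket

namespace RealRAM

/-! ### Executions from an arbitrary configuration -/

/-- The distribution of the configuration `t` units of time after the configuration `c`. -/
def runFrom (c : Config) (t : ℕ) : PMF Config := (fun μ : PMF Config => μ.bind step)^[t] (PMF.pure c)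

theorem run_eq_runFrom (prog : Cmd) (M : Mem) (t : ℕ) :
    run prog M t = runFrom ⟨[prog], M⟩ t := by
  induction t with
  | zero => rfl
  | succ t ih => rw [run, ih, runFrom, runFrom, Function.iterate_succ_apply']

theorem iterate_bind_step (μ : PMF Config) (t : ℕ) :
    (fun μ : PMF Config => μ.bind step)^[t] μ = μ.bind fun c => runFrom c t := by
  induction t with
  | zero => simp [runFrom]
  | succ t ih =>
    rw [Function.iterate_succ_apply', ih, PMF.bind_bind]
    congr 1
    funext c
    rw [runFrom, runFrom, Function.iterate_succ_apply']

theorem runFrom_succ (c : Config) (t : ℕ) :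
    runFrom c (t + 1) = (step c).bind fun c' => runFrom c' t := by
  rw [runFrom, Function.iterate_succ_apply, PMF.pure_bind, iterate_bind_step]

/-- The expected time that remains until the machine halts, from the configuration `c`. -/
def remainingTime (c : Config) : ℝ≥0∞ :=
  ∑' t : ℕ, (runFrom c t).toOuterMeasure {c | ¬ c.Halted}

theorem remainingTime_of_not_halted (c : Config) :
    remainingTime c ≤ 1 + ∑' c', step c c' * remainingTime c' := by
  rw [remainingTime, tsum_eq_zero_add' ENNReal.summable]
  gcongr
  · exact (MeasureTheory.measure_mono (Set.subset_univ _)).trans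
      (((PMF.toOuterMeasure_apply_eq_one_iff (runFrom c 0) _).2 (Set.subset_univ _)).le)
  · simp only [runFrom_succ, PMF.toOuterMeasure_bind_apply, remainingTime]
    rw [ENNReal.tsum_comm]
    simp only [ENNReal.tsum_mul_left]
    exact le_rfl

theorem remainingTime_of_halted (M : Mem) : remainingTime ⟨[], M⟩ = 0 := by
  have h : ∀ t, runFrom ⟨[], M⟩ t = PMF.pure ⟨[], M⟩ := by
    intro t
    induction t with
    | zero => rfl
    | succ t ih => rw [runFrom_succ, step, PMF.pure_bind, ih]
  simp [remainingTime, h, Config.Halted, PMF.toOuterMeasure_pure_apply]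

/-- The memory `M` respects the bound `S` on the addresses in use and the bound `W` on the size of
words. -/
def Fits (S W : ℕ) (M : Mem) : Prop :=
  (∀ a : ℕ, S ≤ a → M.word a = 0 ∧ M.real a = 0) ∧ ∀ a : ℕ, M.word a ≤ W

/-- From the configuration `c`, the machine stays within the bounds `S` and `W`, has the output `r`
whenever it halts, and needs the expected time `T` at most. -/
def Good (S W : ℕ) (r : ℝ) (c : Config) (T : ℝ≥0∞) : Prop :=
  (∀ t : ℕ, ∀ c' ∈ (runFrom c t).support, Fits S W c'.mem ∧ (c'.Halted → c'.mem.real 0 = r)) ∧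
    remainingTime c ≤ T

variable {S W : ℕ} {r : ℝ}

theorem Good.mono {c : Config} {T T' : ℝ≥0∞} (h : Good S W r c T) (hT : T ≤ T') :
    Good S W r c T' := ⟨h.1, h.2.trans hT⟩

theorem Good.halted {M : Mem} (hM : Fits S W M) (hr : M.real 0 = r) :
    Good S W r ⟨[], M⟩ 0 := by
  refine ⟨fun t c' hc' => ?_, (remainingTime_of_halted M).le⟩
  have h : runFrom ⟨[], M⟩ t = PMF.pure ⟨[], M⟩ := by
    clear hc'
    induction t with
    | zero => rfl
    | succ t ih => rw [runFrom_succ, step, PMF.pure_bind, ih]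
  rw [h, PMF.support_pure, Set.mem_singleton_iff] at hc'
  subst hc'
  exact ⟨hM, fun _ => hr⟩

theorem Good.of_step {c : Config} (hc : Fits S W c.mem) (hh : ¬ c.Halted) {F : Config → ℝ≥0∞}
    (h : ∀ c' ∈ (step c).support, Good S W r c' (F c')) :
    Good S W r c (1 + ∑' c', step c c' * F c') := by
  constructor
  · intro t c' hc'
    cases t with
    | zero =>
      rw [runFrom, Function.iterate_zero, id, PMF.support_pure, Set.mem_singleton_iff] at hc'
      subst hc'
      exact ⟨hc, fun h => absurd h hh⟩
    | succ t =>
      rw [runFrom_succ, PMF.mem_support_bind_iff] at hc'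
      obtain ⟨c₁, h₁, h₂⟩ := hc'
      exact (h c₁ h₁).1 t c' h₂
  · refine (remainingTime_of_not_halted c).trans ?_
    refine add_le_add_right (ENNReal.tsum_le_tsum fun c' => ?_) _
    by_cases h' : c' ∈ (step c).support
    · gcongr
      exact (h c' h').2
    · rw [PMF.mem_support_iff, not_not] at h'
      simp [h']

theorem Good.of_step_pure {c c₁ : Config} {T : ℝ≥0∞} (hc : Fits S W c.mem) (hh : ¬ c.Halted)
    (hs : step c = PMF.pure c₁) (h : Good S W r c₁ T) : Good S W r c (1 + T) := by
  refine (Good.of_step hc hh (F := fun _ => T) ?_).mono ?_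
  · intro c' hc'
    rw [hs, PMF.support_pure, Set.mem_singleton_iff] at hc'
    rwa [hc']
  · rw [ENNReal.tsum_mul_right, PMF.tsum_coe, one_mul]

theorem step_rand (a n : WExp) (k : List Cmd) (M : Mem) :
    step ⟨Cmd.rand a n :: k, M⟩ = (PMF.uniformOfFintype (Fin (n.eval M + 1))).bind fun z =>
      PMF.pure ⟨k, { M with word := Function.update M.word (a.eval M) (z : ℕ) }⟩ := by
  rw [step]
  exact (PMF.map_bind _ _ _).trans (congrArg _ (funext fun z => PMF.pure_map _ _))

open Classical in
/-- A random choice adds one unit of time, and the mean of the expected times of its outcomes. -/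
theorem Good.rand {a n : WExp} {k : List Cmd} {M : Mem} (hM : Fits S W M) {F : ℕ → ℝ≥0∞}
    (h : ∀ z ≤ n.eval M, Good S W r
      ⟨k, { M with word := Function.update M.word (a.eval M) z }⟩ (F z)) :
    Good S W r ⟨Cmd.rand a n :: k, M⟩
      (1 + (∑ z ∈ Finset.range (n.eval M + 1), F z) / (n.eval M + 1 : ℕ)) := by
  let g : ℕ → Config := fun z => ⟨k, { M with word := Function.update M.word (a.eval M) z }⟩
  have hg : Function.Injective g := by
    intro x y hxy
    have h1 : (g x).mem.word (a.eval M) = (g y).mem.word (a.eval M) := by rw [hxy]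
    simpa [g] using h1
  refine (Good.of_step hM (by simp [Config.Halted]) (F := fun c => F (c.mem.word (a.eval M))) ?_).mono ?_
  · intro c' hc'
    rw [step_rand, PMF.mem_support_bind_iff] at hc'
    obtain ⟨z, -, hz⟩ := hc'
    rw [PMF.support_pure, Set.mem_singleton_iff] at hz
    subst hz
    simpa using h z (Nat.lt_succ_iff.1 z.isLt)
  · gcongr
    have h2 : ∀ c', step ⟨Cmd.rand a n :: k, M⟩ c' * F (c'.mem.word (a.eval M)) =
        ∑' z : Fin (n.eval M + 1), if c' = g z then
          ((n.eval M + 1 : ℕ) : ℝ≥0∞)⁻¹ * F z else 0 := by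
      intro c'
      rw [step_rand, PMF.bind_apply, ← ENNReal.tsum_mul_right]
      refine tsum_congr fun z => ?_
      by_cases hz : c' = g z
      · rw [if_pos hz, hz]
        simp [g]
      · rw [if_neg hz, PMF.pure_apply, if_neg hz, mul_zero, zero_mul]
    simp only [h2]
    rw [ENNReal.tsum_comm, tsum_fintype]
    simp only [tsum_ite_eq]
    rw [← Finset.mul_sum, Fin.sum_univ_eq_sum_range (fun z => F z), mul_comm, div_eq_mul_inv]

/-! ### Executions of deterministic commands -/

/-- The command `c` turns the memory `M` into the memory `M'` in `t` units of time, without random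
choices; it only writes to cells with addresses `< S`, and only words `≤ W`. -/
inductive Exec (S W : ℕ) : Cmd → Mem → Mem → ℕ → Prop
  | skip (M : Mem) : Exec S W Cmd.skip M M 1
  | setWord (M : Mem) (a e : WExp) (ha : a.eval M < S) (he : e.eval M ≤ W) :
      Exec S W (Cmd.setWord a e) M
        { M with word := Function.update M.word (a.eval M) (e.eval M) } 1
  | setReal (M : Mem) (a : WExp) (e : RExp) (ha : a.eval M < S) :
      Exec S W (Cmd.setReal a e) M
        { M with real := Function.update M.real (a.eval M) (e.eval M) } 1
  | seq {c d : Cmd} {M M₁ M₂ : Mem} {t₁ t₂ : ℕ} (hc : Exec S W c M M₁ t₁)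
      (hd : Exec S W d M₁ M₂ t₂) : Exec S W (Cmd.seq c d) M M₂ (t₁ + t₂ + 1)
  | ite_true {b : Test} {c d : Cmd} {M M₁ : Mem} {t : ℕ} (hb : b.Holds M)
      (hc : Exec S W c M M₁ t) : Exec S W (Cmd.ite b c d) M M₁ (t + 1)
  | ite_false {b : Test} {c d : Cmd} {M M₁ : Mem} {t : ℕ} (hb : ¬ b.Holds M)
      (hd : Exec S W d M M₁ t) : Exec S W (Cmd.ite b c d) M M₁ (t + 1)
  | loop_false {b : Test} {c : Cmd} {M : Mem} (hb : ¬ b.Holds M) :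
      Exec S W (Cmd.loop b c) M M 1
  | loop_true {b : Test} {c : Cmd} {M M₁ M₂ : Mem} {t₁ t₂ : ℕ} (hb : b.Holds M)
      (hc : Exec S W c M M₁ t₁) (hl : Exec S W (Cmd.loop b c) M₁ M₂ t₂) :
      Exec S W (Cmd.loop b c) M M₂ (t₁ + t₂ + 1)

theorem Fits.update_word {M : Mem} (h : Fits S W M) {a v : ℕ} (ha : a < S) (hv : v ≤ W) :
    Fits S W { M with word := Function.update M.word a v } := by
  refine ⟨fun b hb => ⟨?_, (h.1 b hb).2⟩, fun b => ?_⟩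
  · simp only [Function.update_of_ne (show b ≠ a by omega), (h.1 b hb).1]
  · by_cases hb : b = a
    · subst hb; simpa using hv
    · simpa only [Function.update_of_ne hb] using h.2 b

theorem Fits.update_real {M : Mem} (h : Fits S W M) {a : ℕ} {v : ℝ} (ha : a < S) :
    Fits S W { M with real := Function.update M.real a v } := by
  refine ⟨fun b hb => ⟨(h.1 b hb).1, ?_⟩, h.2⟩
  simp only [Function.update_of_ne (show b ≠ a by omega), (h.1 b hb).2]

theorem Exec.fits {c : Cmd} {M M' : Mem} {t : ℕ} (h : Exec S W c M M' t) (hM : Fits S W M) :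
    Fits S W M' := by
  induction h with
  | skip M => exact hM
  | setWord M a e ha he => exact hM.update_word ha he
  | setReal M a e ha => exact hM.update_real ha
  | seq _ _ ih₁ ih₂ => exact ih₂ (ih₁ hM)
  | ite_true _ _ ih => exact ih hM
  | ite_false _ _ ih => exact ih hM
  | loop_false _ => exact hM
  | loop_true _ _ _ ih₁ ih₂ => exact ih₂ (ih₁ hM)

/-- A deterministic command adds its running time to the expected time of the rest. -/
theorem Exec.good {c : Cmd} {M M' : Mem} {t : ℕ} (h : Exec S W c M M' t) (hM : Fits S W M)
    {k : List Cmd} {T : ℝ≥0∞} (hk : Good S W r ⟨k, M'⟩ T) : Good S W r ⟨c :: k, M⟩ (t + T) := by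
  have nh : ∀ {c : Cmd} {k : List Cmd} {M : Mem}, ¬ (Config.mk (c :: k) M).Halted := by
    simp [Config.Halted]
  induction h generalizing k T with
  | skip M => simpa using Good.of_step_pure hM nh rfl hk
  | setWord M a e ha he => simpa using Good.of_step_pure hM nh rfl hk
  | setReal M a e ha => simpa using Good.of_step_pure hM nh rfl hk
  | seq hc hd ih₁ ih₂ =>
    refine (Good.of_step_pure hM nh rfl (ih₁ hM (ih₂ (hc.fits hM) hk))).mono ?_
    push_cast
    exact le_of_eq (by ring)
  | ite_true hb hc ih =>
    refine (Good.of_step_pure hM nh (by rw [step, if_pos hb]) (ih hM hk)).mono ?_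
    push_cast
    exact le_of_eq (by ring)
  | ite_false hb hc ih =>
    refine (Good.of_step_pure hM nh (by rw [step, if_neg hb]) (ih hM hk)).mono ?_
    push_cast
    exact le_of_eq (by ring)
  | loop_false hb =>
    simpa using Good.of_step_pure hM nh (by rw [step, if_neg hb]) hk
  | loop_true hb hc hl ih₁ ih₂ =>
    refine (Good.of_step_pure hM nh (by rw [step, if_pos hb])
      (ih₁ hM (ih₂ (hc.fits hM) hk))).mono ?_
    push_cast
    exact le_of_eq (by ring)

/-- Total correctness with a time bound: started on `M`, the command `c` ends after at most `T` units
of time, within the bounds `S` and `W`, and in a memory with the property `Q`. -/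
def Ends (S W : ℕ) (c : Cmd) (M : Mem) (T : ℕ) (Q : Mem → Prop) : Prop :=
  ∃ M' t, Exec S W c M M' t ∧ t ≤ T ∧ Q M'

theorem Ends.good {c : Cmd} {M : Mem} {T : ℕ} {Q : Mem → Prop} (h : Ends S W c M T Q)
    (hM : Fits S W M) {k : List Cmd} {T' : ℝ≥0∞}
    (hk : ∀ M', Q M' → Fits S W M' → Good S W r ⟨k, M'⟩ T') :
    Good S W r ⟨c :: k, M⟩ (T + T') := by
  obtain ⟨M', t, h, ht, hQ⟩ := h
  refine (h.good hM (hk M' hQ (h.fits hM))).mono ?_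
  gcongr

theorem Ends.imp {c : Cmd} {M : Mem} {T T' : ℕ} {Q Q' : Mem → Prop} (h : Ends S W c M T Q)
    (hT : T ≤ T') (hQ : ∀ M', Q M' → Q' M') : Ends S W c M T' Q' := by
  obtain ⟨M', t, h, ht, hQ'⟩ := h
  exact ⟨M', t, h, ht.trans hT, hQ _ hQ'⟩

theorem Ends.setWord {a e : WExp} {M : Mem} {T : ℕ} {Q : Mem → Prop} (hT : 1 ≤ T)
    (ha : a.eval M < S) (he : e.eval M ≤ W)
    (hQ : Q { M with word := Function.update M.word (a.eval M) (e.eval M) }) :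
    Ends S W (Cmd.setWord a e) M T Q := ⟨_, 1, .setWord M a e ha he, hT, hQ⟩

theorem Ends.setReal {a : WExp} {e : RExp} {M : Mem} {T : ℕ} {Q : Mem → Prop} (hT : 1 ≤ T)
    (ha : a.eval M < S) (hQ : Q { M with real := Function.update M.real (a.eval M) (e.eval M) }) :
    Ends S W (Cmd.setReal a e) M T Q := ⟨_, 1, .setReal M a e ha, hT, hQ⟩

theorem Ends.seq {c d : Cmd} {M : Mem} {T₁ T₂ T : ℕ} {Q : Mem → Prop}
    (h : Ends S W c M T₁ fun M' => Ends S W d M' T₂ Q) (hT : T₁ + T₂ + 1 ≤ T) :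
    Ends S W (Cmd.seq c d) M T Q := by
  obtain ⟨M₁, t₁, h₁, ht₁, M₂, t₂, h₂, ht₂, hQ⟩ := h
  exact ⟨M₂, _, .seq h₁ h₂, by omega, hQ⟩

theorem Ends.setWord_seq {a e : WExp} {d : Cmd} {M : Mem} {T : ℕ} {Q : Mem → Prop}
    (ha : a.eval M < S) (he : e.eval M ≤ W)
    (hd : Ends S W d { M with word := Function.update M.word (a.eval M) (e.eval M) } T Q) :
    Ends S W (Cmd.seq (Cmd.setWord a e) d) M (T + 2) Q :=
  Ends.seq (T₁ := 1) (Ends.setWord le_rfl ha he hd) (by omega)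

theorem Ends.setReal_seq {a : WExp} {e : RExp} {d : Cmd} {M : Mem} {T : ℕ} {Q : Mem → Prop}
    (ha : a.eval M < S)
    (hd : Ends S W d { M with real := Function.update M.real (a.eval M) (e.eval M) } T Q) :
    Ends S W (Cmd.seq (Cmd.setReal a e) d) M (T + 2) Q :=
  Ends.seq (T₁ := 1) (Ends.setReal le_rfl ha hd) (by omega)

theorem Ends.ite {b : Test} {c d : Cmd} {M : Mem} {T : ℕ} {Q : Mem → Prop}
    (hc : b.Holds M → Ends S W c M T Q) (hd : ¬ b.Holds M → Ends S W d M T Q) :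
    Ends S W (Cmd.ite b c d) M (T + 1) Q := by
  by_cases hb : b.Holds M
  · obtain ⟨M', t, h, ht, hQ⟩ := hc hb
    exact ⟨M', _, .ite_true hb h, by omega, hQ⟩
  · obtain ⟨M', t, h, ht, hQ⟩ := hd hb
    exact ⟨M', _, .ite_false hb h, by omega, hQ⟩

/-- A loop that runs through exactly `n` rounds, with the invariant `Inv i` after `i` rounds. -/
theorem Ends.loop {b : Test} {c : Cmd} {M : Mem} (Inv : ℕ → Mem → Prop) (n τ : ℕ) {T : ℕ}
    {Q : Mem → Prop} (h0 : Inv 0 M)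
    (hstep : ∀ i M, i < n → Inv i M → b.Holds M ∧ Ends S W c M τ (Inv (i + 1)))
    (hend : ∀ M, Inv n M → ¬ b.Holds M ∧ Q M) (hT : n * (τ + 1) + 1 ≤ T) :
    Ends S W (Cmd.loop b c) M T Q := by
  have key : ∀ d i M, i + d = n → Inv i M → Ends S W (Cmd.loop b c) M (d * (τ + 1) + 1) Q := by
    intro d
    induction d with
    | zero =>
      intro i M hi hM
      obtain rfl : i = n := by omega
      obtain ⟨hb, hQ⟩ := hend M hM
      exact ⟨M, 1, .loop_false hb, by omega, hQ⟩
    | succ d ih =>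
      intro i M hi hM
      obtain ⟨hb, M₁, t₁, h₁, ht₁, hI⟩ := hstep i M (by omega) hM
      obtain ⟨M₂, t₂, h₂, ht₂, hQ⟩ := ih (i + 1) M₁ (by omega) hI
      refine ⟨M₂, _, .loop_true hb h₁ h₂, ?_, hQ⟩
      rw [add_mul]
      omega
  exact (key n 0 M (by omega) h0).imp hT fun _ h => h

theorem outputs_of_good {prog : Cmd} {M : Mem} {T : ℝ≥0∞}
    (h : Good S W r ⟨[prog], M⟩ T) : Outputs prog M r ∧ expectedTime prog M ≤ T ∧
      RunsInSpace prog M S W := by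
  refine ⟨fun t c hc hh => ?_, ?_, fun t c hc => ?_⟩
  · rw [run_eq_runFrom] at hc
    exact (h.1 t c hc).2 hh
  · have : expectedTime prog M = remainingTime ⟨[prog], M⟩ := by
      simp only [expectedTime, remainingTime, run_eq_runFrom]
    rw [this]
    exact h.2
  · rw [run_eq_runFrom] at hc
    exact (h.1 t c hc).1

/-! ### Expressions -/

instance (n : ℕ) : OfNat WExp n := ⟨.const n⟩
instance : Add WExp := ⟨.add⟩
instance : Sub WExp := ⟨.sub⟩
instance : Mul WExp := ⟨.mul⟩
instance : Div WExp := ⟨.div⟩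
instance (n : ℕ) : OfNat RExp n := ⟨.ofWord (.const n)⟩
instance : Add RExp := ⟨.add⟩
instance : Sub RExp := ⟨.sub⟩
instance : Mul RExp := ⟨.mul⟩
instance : Div RExp := ⟨.div⟩

/-- The contents of the word cell `i`. -/
def wv (i : ℕ) : WExp := .load (.const i)

/-- The contents of the real cell at the distance `i` from the address in the word cell `4`. -/
def rv (i : ℕ) : RExp := .load (wv 4 + .const i)

section Eval

variable (M : Mem)

@[simp] theorem eval_const (n : ℕ) : (WExp.const n).eval M = n := rfl
@[simp] theorem eval_ofNat (n : ℕ) : (ofNat(n) : WExp).eval M = OfNat.ofNat n := rfl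
@[simp] theorem eval_add (a b : WExp) : (a + b).eval M = a.eval M + b.eval M := rfl
@[simp] theorem eval_sub (a b : WExp) : (a - b).eval M = a.eval M - b.eval M := rfl
@[simp] theorem eval_mul (a b : WExp) : (a * b).eval M = a.eval M * b.eval M := rfl
@[simp] theorem eval_div (a b : WExp) : (a / b).eval M = a.eval M / b.eval M := rfl
@[simp] theorem eval_load (a : WExp) : (WExp.load a).eval M = M.word (a.eval M) := rfl
@[simp] theorem eval_wv (i : ℕ) : (wv i).eval M = M.word i := rfl
@[simp] theorem reval_ofNat (n : ℕ) : (ofNat(n) : RExp).eval M = (OfNat.ofNat n : ℕ) := rfl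
@[simp] theorem reval_add (x y : RExp) : (x + y).eval M = x.eval M + y.eval M := rfl
@[simp] theorem reval_sub (x y : RExp) : (x - y).eval M = x.eval M - y.eval M := rfl
@[simp] theorem reval_mul (x y : RExp) : (x * y).eval M = x.eval M * y.eval M := rfl
@[simp] theorem reval_div (x y : RExp) : (x / y).eval M = x.eval M / y.eval M := rfl
@[simp] theorem reval_sqrt (x : RExp) : (RExp.sqrt x).eval M = √(x.eval M) := rfl
@[simp] theorem reval_load (a : WExp) : (RExp.load a).eval M = M.real (a.eval M) := rfl
@[simp] theorem reval_rv (i : ℕ) : (rv i).eval M = M.real (M.word 4 + i) := rfl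
@[simp] theorem holds_wordLT (a b : WExp) : (Test.wordLT a b).Holds M ↔ a.eval M < b.eval M :=
  Iff.rfl
@[simp] theorem holds_realLT (x y : RExp) : (Test.realLT x y).Holds M ↔ x.eval M < y.eval M :=
  Iff.rfl
@[simp] theorem holds_not (b : Test) : (Test.not b).Holds M ↔ ¬ b.Holds M := Iff.rfl
@[simp] theorem holds_and (b c : Test) : (Test.and b c).Holds M ↔ b.Holds M ∧ c.Holds M := Iff.rfl

/-- `a` if `c` is zero, and `b` otherwise. -/
def WExp.ifz (c a b : WExp) : WExp := (1 - c) * a + (1 - (1 - c)) * b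

@[simp] theorem eval_ifz (c a b : WExp) :
    (WExp.ifz c a b).eval M = if c.eval M = 0 then a.eval M else b.eval M := by
  simp only [WExp.ifz, eval_add, eval_mul, eval_sub, eval_ofNat]
  split_ifs with h
  · simp [h]
  · rw [show 1 - c.eval M = 0 by omega]; simp

/-- The larger one of two real numbers. -/
def RExp.max (x y : RExp) : RExp := (x + y + .sqrt ((x - y) * (x - y))) / 2

/-- The smaller one of two real numbers. -/
def RExp.min (x y : RExp) : RExp := (x + y - .sqrt ((x - y) * (x - y))) / 2

@[simp] theorem reval_max (x y : RExp) : (RExp.max x y).eval M = Max.max (x.eval M) (y.eval M) := by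
  simp only [RExp.max, reval_div, reval_add, reval_sqrt, reval_mul, reval_sub, reval_ofNat]
  rw [Real.sqrt_mul_self_eq_abs]
  rcases le_total (x.eval M) (y.eval M) with h | h
  · rw [max_eq_right h, abs_of_nonpos (by linarith)]; push_cast; ring
  · rw [max_eq_left h, abs_of_nonneg (by linarith)]; push_cast; ring

@[simp] theorem reval_min (x y : RExp) : (RExp.min x y).eval M = Min.min (x.eval M) (y.eval M) := by
  simp only [RExp.min, reval_div, reval_add, reval_sqrt, reval_mul, reval_sub, reval_ofNat]
  rw [Real.sqrt_mul_self_eq_abs]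
  rcases le_total (x.eval M) (y.eval M) with h | h
  · rw [min_eq_left h, abs_of_nonpos (by linarith)]; push_cast; ring
  · rw [min_eq_right h, abs_of_nonneg (by linarith)]; push_cast; ring

/-- The sum `x 0 + … + x (n - 1)`. -/
def RExp.sum (x : ℕ → RExp) : ℕ → RExp
  | 0 => 0
  | n + 1 => RExp.sum x n + x n

@[simp] theorem reval_sum (x : ℕ → RExp) (n : ℕ) :
    (RExp.sum x n).eval M = ∑ i ∈ Finset.range n, (x i).eval M := by
  induction n with
  | zero => simp [RExp.sum]
  | succ n ih => rw [RExp.sum, reval_add, ih, Finset.sum_range_succ]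

/-- Comparison in the mode that is given by the word cell `6` (`1` for the strict mode). -/
def cmpTest (x y : RExp) : Test :=
  .and (.not (.realLT y x)) (.not (.and (.wordLT 0 (wv 6)) (.not (.realLT x y))))

theorem holds_cmpTest {strict : Bool} (h : M.word 6 = strict.toNat) (x y : RExp) :
    (cmpTest x y).Holds M ↔ CmpLE strict (x.eval M) (y.eval M) := by
  cases strict
  · simp [cmpTest, h, CmpLE]
  · simpa [cmpTest, h, CmpLE] using le_of_lt

end Eval

/-! ### Memory updates -/

/-- The memory with the word `v` in the word cell `a`. -/
def Mem.setW (M : Mem) (a v : ℕ) : Mem := { M with word := Function.update M.word a v }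

/-- The memory with the number `v` in the real cell `a`. -/
def Mem.setR (M : Mem) (a : ℕ) (v : ℝ) : Mem := { M with real := Function.update M.real a v }

section Update

variable (M : Mem) (a v : ℕ) (x : ℝ)

@[simp] theorem setW_real : (M.setW a v).real = M.real := rfl
@[simp] theorem setR_word : (M.setR a x).word = M.word := rfl
@[simp] theorem setW_word_self : (M.setW a v).word a = v := Function.update_self ..
@[simp] theorem setR_real_self : (M.setR a x).real a = x := Function.update_self ..

variable {M a v x}

theorem setW_word_ne {b : ℕ} (h : b ≠ a) : (M.setW a v).word b = M.word b :=
  Function.update_of_ne h ..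
theorem setR_real_ne {b : ℕ} (h : b ≠ a) : (M.setR a x).real b = M.real b :=
  Function.update_of_ne h ..

variable {S W : ℕ} {Q : Mem → Prop} {T : ℕ}

theorem Ends.setW {a e : WExp} (hT : 1 ≤ T) (ha : a.eval M < S) (he : e.eval M ≤ W)
    (hQ : Q (M.setW (a.eval M) (e.eval M))) : Ends S W (Cmd.setWord a e) M T Q :=
  Ends.setWord hT ha he hQ

theorem Ends.setR {a : WExp} {e : RExp} (hT : 1 ≤ T) (ha : a.eval M < S)
    (hQ : Q (M.setR (a.eval M) (e.eval M))) : Ends S W (Cmd.setReal a e) M T Q :=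
  Ends.setReal hT ha hQ

theorem Ends.setW_seq {a e : WExp} {d : Cmd} (ha : a.eval M < S) (he : e.eval M ≤ W)
    (hd : Ends S W d (M.setW (a.eval M) (e.eval M)) T Q) :
    Ends S W (Cmd.seq (Cmd.setWord a e) d) M (T + 2) Q := Ends.setWord_seq ha he hd

theorem Ends.setR_seq {a : WExp} {e : RExp} {d : Cmd} (ha : a.eval M < S)
    (hd : Ends S W d (M.setR (a.eval M) (e.eval M)) T Q) :
    Ends S W (Cmd.seq (Cmd.setReal a e) d) M (T + 2) Q := Ends.setReal_seq ha hd

end Update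

local infixr:60 " ;; " => Cmd.seq

/-! ### Geometric expressions -/

section Geometry

/-- The coordinate `d` of the vertex `v`, in dimension `l`. -/
def coordE (l : ℕ) (v : WExp) (d : ℕ) : RExp := .load (v * .const l + .const d)

/-- The inner product of `u - e` and `w - e`, for vertices `u`, `w` and `e`. -/
def dotE (l : ℕ) (u w e : WExp) : RExp :=
  .sum (fun d => (coordE l u d - coordE l e d) * (coordE l w d - coordE l e d)) l

/-- The expression for `segQuad`. -/
def quadE (a b c y : RExp) : RExp := a * y * y - 2 * b * y + c

/-- The expression for `segFoot`. -/
def footE (a b : RExp) : RExp := .max 0 (.min 1 (b / a))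

/-- The expression for `segRoot`. -/
def rootE (a b c r : RExp) : RExp := .sqrt (b * b - a * (c - r))

/-- The expression for `segLow`. -/
def lowE (a b c r : RExp) : RExp := .max 0 ((b - rootE a b c r) / a)

/-- The expression for `segHigh`. -/
def highE (a b c r : RExp) : RExp := .min 1 ((b + rootE a b c r) / a + (1 - a / a))

/-- The expression for `critSq`. -/
def critSqE (a b c b' c' : RExp) : RExp :=
  .max (quadE a b c (.min (footE a b) (.max (footE a b') ((c - c') / (2 * (b - b'))))))
    (quadE a b' c' (.max (footE a b') (.min (footE a b) ((c - c') / (2 * (b - b'))))))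

/-- The critical value of the edge `e` and the vertices `q` and `k`. -/
def critE (l : ℕ) (e q k : WExp) : RExp :=
  critSqE (dotE l (e + 1) (e + 1) e) (dotE l q (e + 1) e) (dotE l q q e)
    (dotE l k (e + 1) e) (dotE l k k e)

variable (M : Mem)

@[simp] theorem reval_quadE (a b c y : RExp) : (quadE a b c y).eval M =
    segQuad (a.eval M) (b.eval M) (c.eval M) (y.eval M) := by simp [quadE, segQuad]

@[simp] theorem reval_footE (a b : RExp) :
    (footE a b).eval M = segFoot (a.eval M) (b.eval M) := by simp [footE, segFoot]

@[simp] theorem reval_rootE (a b c r : RExp) : (rootE a b c r).eval M =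
    segRoot (a.eval M) (b.eval M) (c.eval M) (r.eval M) := by simp [rootE, segRoot]

@[simp] theorem reval_lowE (a b c r : RExp) : (lowE a b c r).eval M =
    segLow (a.eval M) (b.eval M) (c.eval M) (r.eval M) := by simp [lowE, segLow]

@[simp] theorem reval_highE (a b c r : RExp) : (highE a b c r).eval M =
    segHigh (a.eval M) (b.eval M) (c.eval M) (r.eval M) := by simp [highE, segHigh]

@[simp] theorem reval_critSqE (a b c b' c' : RExp) : (critSqE a b c b' c').eval M =
    critSq (a.eval M) (b.eval M) (c.eval M) (b'.eval M) (c'.eval M) := by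
  simp [critSqE, critSq]

end Geometry

/-- The data of a run that never change: the numbers `p` and `K - p` of the vertices of the two
curves, `K`, `K - 1`, the length `R` of the list of all coordinates, and this list. -/
structure Env {l : ℕ} (p K R : ℕ) (P : ℕ → EuclideanSpace ℝ (Fin l)) (M : Mem) : Prop where
  w0 : M.word 0 = p
  w1 : M.word 1 = K - p
  w2 : M.word 2 = K
  w3 : M.word 3 = K - 1
  w4 : M.word 4 = R
  coord : ∀ v < K, ∀ d : Fin l, M.real (v * l + d) = P v d
  length : K * l = R

/-- The bounds `S` and `W` leave room for the data of the program. The word cells below `64` hold its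
variables: the address of a table in `5`, the mode of comparisons in `6`, the number of candidates in
`7`, a randomly chosen number in `8`, the result of the dynamic program in `9`. From the address `64` on
there are the lower table, the upper one, the one of the threshold that is being tested, and a row of
the dynamic program. The real cells from `R` on hold the threshold that is being tested and the upper
threshold; those from `R + 32` on hold free intervals and range maxima. -/
structure Room (K R S W : ℕ) : Prop where
  four_le : 4 ≤ K
  space : 64 + R + 8 * (K * K) ≤ S
  words : 64 + R + 8 * (K * K) + K * K * K ≤ W

theorem Env.congr {l p K R : ℕ} {P : ℕ → EuclideanSpace ℝ (Fin l)} {M M' : Mem}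
    (h : Env p K R P M) (hw : ∀ a < 5, M'.word a = M.word a)
    (hr : ∀ a < R, M'.real a = M.real a) : Env p K R P M' := by
  refine ⟨by rw [hw 0 (by omega), h.w0], by rw [hw 1 (by omega), h.w1],
    by rw [hw 2 (by omega), h.w2], by rw [hw 3 (by omega), h.w3], by rw [hw 4 (by omega), h.w4],
    fun v hv d => ?_, h.length⟩
  rw [hr, h.coord v hv d]
  have := d.isLt
  calc v * l + d < v * l + l := by omega
    _ = (v + 1) * l := by ring
    _ ≤ K * l := Nat.mul_le_mul_right _ hv
    _ = R := h.length

section Spec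

variable {l p K R : ℕ} {P : ℕ → EuclideanSpace ℝ (Fin l)} {M : Mem}

theorem Env.dotE (h : Env p K R P M) {u w e : WExp} (hu : u.eval M < K) (hw : w.eval M < K)
    (he : e.eval M < K) : (dotE l u w e).eval M =
      inner ℝ (P (u.eval M) - P (e.eval M)) (P (w.eval M) - P (e.eval M)) := by
  rw [RealRAM.dotE, reval_sum, ← Fin.sum_univ_eq_sum_range
    (fun d => ((coordE l u d - coordE l e d) * (coordE l w d - coordE l e d)).eval M),
    PiLp.inner_apply]
  refine Finset.sum_congr rfl fun d _ => ?_
  simp only [coordE, reval_mul, reval_sub, reval_load, eval_add, eval_mul, eval_const,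
    h.coord _ hu, h.coord _ hw, h.coord _ he, PiLp.sub_apply, RCLike.inner_apply, conj_trivial]
  ring

theorem Env.critE (h : Env p K R P M) {e q' k : WExp} (he : e.eval M + 1 < K)
    (hq : q'.eval M < K) (hk : k.eval M < K) : (critE l e q' k).eval M =
      crit P (e.eval M) (q'.eval M) (k.eval M) := by
  have he' : (e + 1).eval M < K := by simpa using he
  have he'' : e.eval M < K := by omega
  simp only [RealRAM.critE, reval_critSqE, h.dotE hq he' he'', h.dotE hk he' he'', h.dotE he' he' he'',
    h.dotE hq hq he'', h.dotE hk hk he'']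
  rfl

/-- The lower end of the free interval of the vertex `k` on the edge `e`. -/
def vertexLow (P : ℕ → EuclideanSpace ℝ (Fin l)) (strict : Bool) (r : ℝ) (e k : ℕ) : ℝ :=
  freeLow strict (inner ℝ (P (e + 1) - P e) (P (e + 1) - P e))
    (inner ℝ (P k - P e) (P (e + 1) - P e)) (inner ℝ (P k - P e) (P k - P e)) r

/-- The upper end of the free interval of the vertex `k` on the edge `e`. -/
def vertexHigh (P : ℕ → EuclideanSpace ℝ (Fin l)) (strict : Bool) (r : ℝ) (e k : ℕ) : ℝ :=
  freeHigh strict (inner ℝ (P (e + 1) - P e) (P (e + 1) - P e))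
    (inner ℝ (P k - P e) (P (e + 1) - P e)) (inner ℝ (P k - P e) (P k - P e)) r

theorem cmpLE_crit_iff (P : ℕ → EuclideanSpace ℝ (Fin l)) (strict : Bool) (r : ℝ) (e q k : ℕ) :
    CmpLE strict (crit P e q k) r ↔
      CmpLE strict (vertexLow P strict r e q) (vertexHigh P strict r e k) := by
  have h0 : ∀ v, inner ℝ (P (e + 1) - P e) (P (e + 1) - P e) = 0 →
      inner ℝ v (P (e + 1) - P e) = 0 := by
    intro v hv
    rw [inner_self_eq_zero.1 hv, inner_zero_right]
  exact cmpLE_critSq_iff strict real_inner_self_nonneg (h0 _) (h0 _)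

/-! ### The table of a threshold -/

/-- The real cells from `R + 32` on, for `R` in the word cell `4`, get the upper ends, and those from
`R + 32 + K` on the lower ends of the free intervals of all `K` vertices on the edge in the word
cell `10`. The threshold is in the real cell `R`. -/
def intervalsC (l : ℕ) : Cmd :=
  .setWord 12 0 ;;
  .loop (.wordLT (wv 12) (wv 2))
    (.ite (cmpTest (quadE (dotE l (wv 10 + 1) (wv 10 + 1) (wv 10))
          (dotE l (wv 12) (wv 10 + 1) (wv 10)) (dotE l (wv 12) (wv 12) (wv 10))
          (footE (dotE l (wv 10 + 1) (wv 10 + 1) (wv 10)) (dotE l (wv 12) (wv 10 + 1) (wv 10))))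
        (rv 0))
      (.setReal (wv 4 + 32 + wv 12) (highE (dotE l (wv 10 + 1) (wv 10 + 1) (wv 10))
          (dotE l (wv 12) (wv 10 + 1) (wv 10)) (dotE l (wv 12) (wv 12) (wv 10)) (rv 0)) ;;
        .setReal (wv 4 + 32 + wv 2 + wv 12) (lowE (dotE l (wv 10 + 1) (wv 10 + 1) (wv 10))
          (dotE l (wv 12) (wv 10 + 1) (wv 10)) (dotE l (wv 12) (wv 12) (wv 10)) (rv 0)))
      (.setReal (wv 4 + 32 + wv 12) (0 - 1) ;; .setReal (wv 4 + 32 + wv 2 + wv 12) 2) ;;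
    .setWord 12 (wv 12 + 1))

variable {S W : ℕ}

theorem ends_intervalsC (h : Env p K R P M) {strict : Bool} {r : ℝ} {e : ℕ}
    (hroom : Room K R S W) (h6 : M.word 6 = strict.toNat) (hr : M.real (R) = r)
    (he : M.word 10 = e) (he' : e + 1 < K) :
    Ends S W (intervalsC l) M (9 * K + 4) fun M' =>
      (∀ a, a ≠ 12 → M'.word a = M.word a) ∧
      (∀ a < R + 32, M'.real a = M.real a) ∧
      ∀ k < K, M'.real (R + 32 + k) = vertexHigh P strict r e k ∧
        M'.real (R + 32 + K + k) = vertexLow P strict r e k := by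
  obtain ⟨hK, hS, hW⟩ := hroom
  have hKK : K * 4 ≤ K * K := Nat.mul_le_mul_left _ hK
  refine Ends.setW_seq (by simp; omega) (by simp) (Ends.loop
    (fun k M' => M'.word 12 = k ∧ (∀ a, a ≠ 12 → M'.word a = M.word a) ∧
      (∀ a < R + 32, M'.real a = M.real a) ∧
      ∀ k' < k, M'.real (R + 32 + k') = vertexHigh P strict r e k' ∧
        M'.real (R + 32 + K + k') = vertexLow P strict r e k') K 8 ?_ ?_ ?_ (T := 9 * K + 2)
        (by omega))
  · refine ⟨by simp, fun a ha => ?_, fun a ha => rfl, fun k hk => by omega⟩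
    simp only [eval_ofNat]
    rw [setW_word_ne ha]
  · rintro k M' hk ⟨h12, hw, hreal, hdone⟩
    have hE : Env p K R P M' := h.congr (fun a ha => hw a (by omega)) (fun a ha => hreal a (by omega))
    have h10 : M'.word 10 = e := by rw [hw 10 (by omega), he]
    have d1 := hE.dotE (u := wv 10 + 1) (w := wv 10 + 1) (e := wv 10) (by simp [h10]; omega)
      (by simp [h10]; omega) (by simp [h10]; omega)
    have d2 := hE.dotE (u := wv 12) (w := wv 10 + 1) (e := wv 10) (by simp [h12]; omega)
      (by simp [h10]; omega) (by simp [h10]; omega)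
    have d3 := hE.dotE (u := wv 12) (w := wv 12) (e := wv 10) (by simp [h12]; omega)
      (by simp [h12]; omega) (by simp [h10]; omega)
    simp only [eval_wv, eval_add, eval_ofNat, h10, h12] at d1 d2 d3
    have hr' : M'.real (R) = r := by rw [hreal _ (by omega), hr]
    refine ⟨by simp [h12, hE.w2]; omega, ?_⟩
    -- the two values written by either branch
    have fin : ∀ x y, x = vertexHigh P strict r e k → y = vertexLow P strict r e k →
        Ends S W (.setWord 12 (wv 12 + 1)) ((M'.setR (R + 32 + k) x).setR (R + 32 + K + k) y)
          1 fun M'' => M''.word 12 = k + 1 ∧ (∀ a, a ≠ 12 → M''.word a = M.word a) ∧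
            (∀ a < R + 32, M''.real a = M.real a) ∧
            ∀ k' < k + 1, M''.real (R + 32 + k') = vertexHigh P strict r e k' ∧
              M''.real (R + 32 + K + k') = vertexLow P strict r e k' := by
      intro x y hx hy
      refine Ends.setW le_rfl (by simp; omega) (by simp [h12]; omega) ⟨by simp [h12],
        fun a ha => ?_, fun a ha => ?_, fun k' hk' => ?_⟩
      · simp only [eval_ofNat]
        rw [setW_word_ne ha, setR_word, setR_word, hw a ha]
      · rw [setW_real, setR_real_ne (by omega), setR_real_ne (by omega), hreal a ha]
      · rw [setW_real]
        rcases Nat.lt_succ_iff_lt_or_eq.1 hk' with hlt | rfl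
        · rw [setR_real_ne (by omega), setR_real_ne (by omega), setR_real_ne (by omega),
            setR_real_ne (by omega)]
          exact hdone k' hlt
        · rw [setR_real_ne (by omega), setR_real_self, setR_real_self]
          exact ⟨hx, hy⟩
    refine Ends.seq (T₁ := 5) (T₂ := 1) (Ends.ite (T := 4) (fun hb => ?_) fun hb => ?_) (by omega)
    · rw [holds_cmpTest M' (strict := strict) (by rw [hw 6 (by omega), h6])] at hb
      simp only [reval_quadE, reval_footE, reval_rv, d1, d2, d3, hE.w4, add_zero, hr'] at hb
      refine (Ends.setR_seq (by simp [hE.w4, h12]; omega) (Ends.setR le_rfl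
        (by simp [hE.w2, hE.w4, h12]; omega) ?_)).imp (by omega) fun _ h => h
      simp only [eval_add, eval_wv, eval_ofNat, setR_word, hE.w4, hE.w2, h12]
      refine fin _ _ ?_ ?_
      · simp only [reval_highE, d1, d2, d3, reval_rv, hE.w4, add_zero, hr']
        rw [vertexHigh, freeHigh, if_pos hb]
      · have hE' := hE.congr (M' := M'.setR (R + 32 + k) ((highE
          (RealRAM.dotE l (wv 10 + 1) (wv 10 + 1) (wv 10))
          (RealRAM.dotE l (wv 12) (wv 10 + 1) (wv 10)) (RealRAM.dotE l (wv 12) (wv 12) (wv 10))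
          (rv 0)).eval M'))
          (fun a ha => rfl) (fun a ha => setR_real_ne (by omega))
        have d1 := hE'.dotE (u := wv 10 + 1) (w := wv 10 + 1) (e := wv 10) (by simp [h10]; omega)
          (by simp [h10]; omega) (by simp [h10]; omega)
        have d2 := hE'.dotE (u := wv 12) (w := wv 10 + 1) (e := wv 10) (by simp [h12]; omega)
          (by simp [h10]; omega) (by simp [h10]; omega)
        have d3 := hE'.dotE (u := wv 12) (w := wv 12) (e := wv 10) (by simp [h12]; omega)
          (by simp [h12]; omega) (by simp [h10]; omega)
        simp only [eval_wv, eval_add, eval_ofNat, setR_word, h10, h12] at d1 d2 d3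
        simp only [reval_lowE, d1, d2, d3, reval_rv, setR_word, hE.w4, add_zero]
        rw [setR_real_ne (by omega), hr', vertexLow, freeLow, if_pos hb]
    · rw [holds_cmpTest M' (strict := strict) (by rw [hw 6 (by omega), h6])] at hb
      simp only [reval_quadE, reval_footE, reval_rv, d1, d2, d3, hE.w4, add_zero, hr'] at hb
      refine (Ends.setR_seq (by simp [hE.w4, h12]; omega) (Ends.setR le_rfl
        (by simp [hE.w2, hE.w4, h12]; omega) ?_)).imp (by omega) fun _ h => h
      simp only [eval_add, eval_wv, eval_ofNat, setR_word, hE.w4, hE.w2, h12]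
      refine fin _ _ ?_ ?_
      · rw [vertexHigh, freeHigh, if_neg hb]; simp
      · rw [vertexLow, freeLow, if_neg hb]; simp
  · rintro M' ⟨h12, hw, hreal, hdone⟩
    refine ⟨?_, hw, hreal, hdone⟩
    simp only [holds_wordLT, eval_wv, h12]
    rw [hw 2 (by omega), h.w2]
    omega

/-- `f j` is the maximum of the last `w` of the numbers `x 0, …, x j`, or of all of them if there are
fewer. This is stated by comparisons, so that it covers both modes. -/
def IsLevel (K : ℕ) (x : ℕ → ℝ) (w : ℕ) (f : ℕ → ℝ) : Prop :=
  ∀ j < K, ∀ s c, CmpLE s (f j) c ↔ ∀ q ≤ j, j < q + w → CmpLE s (x q) c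

theorem cmpLE_max {s : Bool} {x y c : ℝ} :
    CmpLE s (max x y) c ↔ CmpLE s x c ∧ CmpLE s y c := by
  cases s <;> simp [CmpLE]

/-- Two adjacent windows make one of twice the length. A window that sticks out to the left is cut off
by the truncated subtraction. -/
theorem IsLevel.double {K w : ℕ} {x f : ℕ → ℝ} (h : IsLevel K x w f) (hw : 0 < w) :
    IsLevel K x (w * 2) fun j => max (f j) (f (j - w)) := by
  intro j hj s c
  rw [cmpLE_max, h j hj, h (j - w) (by omega)]
  constructor
  · rintro ⟨h1, h2⟩ q hq hjq
    by_cases h3 : j < q + w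
    · exact h1 q hq h3
    · exact h2 q (by omega) (by omega)
  · exact fun h => ⟨fun q hq hjq => h q hq (by omega),
      fun q hq hjq => h q (by omega) (by omega)⟩

/-- From the numbers in the real cells from `R + 32 + K` on, computes the maxima over windows of the
lengths `1, 2, 4, …`, one length after the other, up to the first length that is at least `K`. This
length is left in the word cell `13`, and the address of its maxima in the word cell `14`. -/
def levelsC : Cmd :=
  .setWord 13 1 ;; .setWord 14 (wv 4 + 32 + wv 2) ;;
  .loop (.wordLT (wv 13) (wv 2))
    (.setWord 18 0 ;;
      .loop (.wordLT (wv 18) (wv 2))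
        (.setReal (wv 14 + wv 2 + wv 18)
          (.max (.load (wv 14 + wv 18)) (.load (wv 14 + (wv 18 - wv 13)))) ;;
        .setWord 18 (wv 18 + 1)) ;;
      .setWord 13 (wv 13 * 2) ;; .setWord 14 (wv 14 + wv 2))

theorem ends_levelsC (h2 : M.word 2 = K) (h4 : M.word 4 = R) (hroom : Room K R S W)
    {x : ℕ → ℝ} (hx : ∀ k < K, M.real (R + 32 + K + k) = x k) :
    Ends S W levelsC M (Nat.clog 2 K * (4 * K + 10) + 5) fun M' =>
      (∀ a, a ≠ 13 → a ≠ 14 → a ≠ 18 → M'.word a = M.word a) ∧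
      (∀ a < R + 32 + K, M'.real a = M.real a) ∧
      M'.word 13 = 2 ^ Nat.clog 2 K ∧ M'.word 14 = R + 32 + K + Nat.clog 2 K * K ∧
      ∀ t ≤ Nat.clog 2 K, IsLevel K x (2 ^ t) fun j => M'.real (R + 32 + K + t * K + j) := by
  obtain ⟨hK, hS, hW⟩ := hroom
  set τ := Nat.clog 2 K with hτ
  have hτK : ∀ t, t < τ → 2 ^ t < K := fun t ht => (Nat.lt_clog_iff_pow_lt (by norm_num)).1 ht
  have hlt : ∀ t, t < 2 ^ t := fun t => Nat.lt_two_pow_self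
  have hKK : K * 4 ≤ K * K := Nat.mul_le_mul_left _ hK
  refine Ends.setW_seq (by simp; omega) (by simp; omega) <| Ends.setW_seq (by simp; omega)
    (by simp (disch := omega) only [eval_ofNat, eval_add, eval_wv, setW_word_ne, h2, h4]; omega) <|
    Ends.loop (fun t M' => (∀ a, a ≠ 13 → a ≠ 14 → a ≠ 18 → M'.word a = M.word a) ∧
      (∀ a < R + 32 + K, M'.real a = M.real a) ∧
      M'.word 13 = 2 ^ t ∧ M'.word 14 = R + 32 + K + t * K ∧
      ∀ t' ≤ t, IsLevel K x (2 ^ t') fun j => M'.real (R + 32 + K + t' * K + j)) τ (4 * K + 9)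
      ?_ ?_ ?_ le_rfl
  · refine ⟨fun a h1 h2 h3 => ?_, fun a ha => rfl, ?_, ?_, fun t ht => ?_⟩
    · simp (disch := omega) only [eval_ofNat, setW_word_ne]
    · simp (disch := omega) only [eval_ofNat, setW_word_ne, setW_word_self, pow_zero]
    · simp (disch := omega) only [eval_ofNat, eval_add, eval_wv, setW_word_ne, setW_word_self]
      omega
    · obtain rfl : t = 0 := by omega
      intro j hj s c
      simp only [setW_real, zero_mul, add_zero, hx j hj]
      refine ⟨fun h q h1 h2 => ?_, fun h => h j le_rfl (by omega)⟩
      obtain rfl : q = j := by omega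
      exact h
  · rintro t M' ht ⟨hw, hr, h13, h14, hlev⟩
    have h2' : M'.word 2 = K := by rw [hw 2 (by omega) (by omega) (by omega), h2]
    have hpow := hτK t ht
    have htt := hlt t
    have htK : (t + 1 + 1) * K ≤ K * K := Nat.mul_le_mul_right _ (by omega)
    rw [add_mul, add_mul, one_mul] at htK
    refine ⟨by simp only [holds_wordLT, eval_wv, h13, h2']; exact hpow, ?_⟩
    refine Ends.imp (T := 4 * K + 3 + (1 + 1 + 1) + 1 + 2) ?_ (by omega) (fun _ h => h)
    refine Ends.setW_seq (by simp; omega) (by simp) <| Ends.seq (T₁ := 4 * K + 3) (T₂ := 1 + 1 + 1)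
      (Ends.loop (fun j M'' => M''.word 18 = j ∧ (∀ a, a ≠ 18 → M''.word a = M'.word a) ∧
        (∀ a < R + 32 + K + (t + 1) * K, M''.real a = M'.real a) ∧
        ∀ j' < j, M''.real (R + 32 + K + (t + 1) * K + j') =
          max (M'.real (R + 32 + K + t * K + j')) (M'.real (R + 32 + K + t * K + (j' - 2 ^ t))))
        K 3 ?_ ?_ ?_ (by omega)) (by omega)
    · refine ⟨by simp, fun a ha => ?_, fun a ha => rfl, fun j hj => by omega⟩
      simp only [eval_ofNat]
      rw [setW_word_ne ha]
    · rintro j M'' hj ⟨h18, hw', hr', hdone⟩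
      have e2 : M''.word 2 = K := by rw [hw' 2 (by omega), h2']
      have e13 : M''.word 13 = 2 ^ t := by rw [hw' 13 (by omega), h13]
      have e14 : M''.word 14 = R + 32 + K + t * K := by rw [hw' 14 (by omega), h14]
      refine ⟨by simp [h18, e2]; omega, ?_⟩
      refine Ends.setR_seq (by simp only [eval_add, eval_wv, e2, e14, h18]; omega) <|
        Ends.setW le_rfl (by simp; omega) (by simp [h18]; omega) ⟨by simp [h18], fun a ha => ?_,
          fun a ha => ?_, fun j' hj' => ?_⟩
      · simp only [eval_ofNat]
        rw [setW_word_ne ha, setR_word, hw' a ha]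
      · rw [add_mul, one_mul] at ha
        rw [setW_real, setR_real_ne, hr' a (by rw [add_mul, one_mul]; omega)]
        simp only [eval_add, eval_wv, e2, e14, h18]; omega
      · rw [setW_real]
        have haddr : (wv 14 + wv 2 + wv 18 : WExp).eval M'' = R + 32 + K + (t + 1) * K + j := by
          simp only [eval_add, eval_wv, e2, e14, h18, add_mul, one_mul]; omega
        rw [haddr]
        rcases Nat.lt_succ_iff_lt_or_eq.1 hj' with hlt | rfl
        · rw [setR_real_ne (by omega), hdone j' hlt]
        · rw [setR_real_self]
          simp only [reval_max, reval_load, eval_add, eval_sub, eval_wv, e14, e13, h18]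
          rw [hr' _ (by rw [add_mul, one_mul]; omega), hr' _ (by rw [add_mul, one_mul]; omega)]
    · rintro M'' ⟨h18, hw', hr', hdone⟩
      have e2 : M''.word 2 = K := by rw [hw' 2 (by omega), h2']
      have e13 : M''.word 13 = 2 ^ t := by rw [hw' 13 (by omega), h13]
      have e14 : M''.word 14 = R + 32 + K + t * K := by rw [hw' 14 (by omega), h14]
      refine ⟨by simp [h18, e2], ?_⟩
      refine (Ends.setW_seq (by simp; omega) (by simp [e13]; omega) <|
        Ends.setW le_rfl (by simp; omega) ?_ ⟨fun a a1 a2 a3 => ?_, fun a ha => ?_, ?_, ?_, ?_⟩).imp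
        (by omega) fun _ h => h
      · simp (disch := omega) only [eval_add, eval_wv, eval_ofNat, setW_word_ne, e2, e14]
        omega
      · simp (disch := omega) only [eval_ofNat, setW_word_ne]
        rw [hw' a a3, hw a a1 a2 a3]
      · simp only [setW_real]
        rw [hr' a (by omega), hr a ha]
      · simp (disch := omega) only [eval_ofNat, setW_word_ne, setW_word_self, eval_mul, eval_wv, e13]
        rw [pow_succ]
      · simp (disch := omega) only [eval_ofNat, setW_word_ne, setW_word_self, eval_add, eval_wv, e14,
          e2, add_mul, one_mul]
        omega
      · intro t' ht'
        simp only [setW_real]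
        rcases Nat.lt_succ_iff_lt_or_eq.1 (Nat.lt_succ_of_le ht') with hlt | rfl
        · intro j hj s c
          have : (t' + 1) * K ≤ (t + 1) * K := Nat.mul_le_mul_right _ (by omega)
          rw [add_mul, one_mul] at this
          change CmpLE s (M''.real (R + 32 + K + t' * K + j)) c ↔ _
          rw [hr' _ (by omega)]
          exact hlev t' (by omega) j hj s c
        · intro j hj s c
          change CmpLE s (M''.real (R + 32 + K + (t + 1) * K + j)) c ↔ _
          rw [hdone j hj, pow_succ]
          exact (hlev t le_rfl).double (by positivity) j hj s c
  · rintro M' ⟨hw, hr, h13, h14, hlev⟩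
    refine ⟨?_, hw, hr, h13, h14, hlev⟩
    have : K ≤ 2 ^ τ := Nat.le_pow_clog (by norm_num) K
    simp only [holds_wordLT, eval_wv, h13]
    rw [hw 2 (by omega) (by omega) (by omega), h2]
    omega

/-- Finds, for the vertex `k` in the word cell `12`, the beginning of the longest run `[pos, k]` of
numbers that compare with the upper end of the free interval of `k`; `pos` is in the word cell `17`.
The run is extended by windows of decreasing lengths. -/
def descentC : Cmd :=
  .setWord 17 (wv 12 + 1) ;; .setWord 15 (wv 13) ;; .setWord 16 (wv 14) ;;
  .loop (.wordLT 0 (wv 15))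
    (.ite (cmpTest (.load (wv 16 + (wv 17 - 1))) (.load (wv 4 + 32 + wv 12)))
        (.setWord 17 (wv 17 - wv 15)) .skip ;;
      .setWord 15 (wv 15 / 2) ;; .setWord 16 (wv 16 - wv 2))

theorem ends_descentC (h2 : M.word 2 = K) (h4 : M.word 4 = R) (hroom : Room K R S W)
    {strict : Bool} (h6 : M.word 6 = strict.toNat) {x : ℕ → ℝ} {k τ : ℕ} {y : ℝ} (hk : k < K)
    (h12 : M.word 12 = k) (hy : M.real (R + 32 + k) = y) (hτ : K ≤ 2 ^ τ) (hτ' : 2 ^ τ ≤ K * 2)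
    (hτK : τ < K) (h13 : M.word 13 = 2 ^ τ) (h14 : M.word 14 = R + 32 + K + τ * K)
    (hlev : ∀ t ≤ τ, IsLevel K x (2 ^ t) fun j => M.real (R + 32 + K + t * K + j)) :
    Ends S W descentC M ((τ + 1) * 8 + 7) fun M' =>
      (∀ a, a ≠ 15 → a ≠ 16 → a ≠ 17 → M'.word a = M.word a) ∧ M'.real = M.real ∧
      M'.word 17 ≤ K ∧
      ∀ s, M'.word 17 ≤ s ↔ ∀ q, s ≤ q → q ≤ k → CmpLE strict (x q) y := by
  classical
  obtain ⟨hK, hS, hW⟩ := hroom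
  have hKK : K * 4 ≤ K * K := Nat.mul_le_mul_left _ hK
  have hτKK : (τ + 1) * K ≤ K * K := Nat.mul_le_mul_right _ hτK
  rw [add_mul, one_mul] at hτKK
  -- the position to be found
  have hex : ∃ s, ∀ q, s ≤ q → q ≤ k → CmpLE strict (x q) y := ⟨k + 1, fun q h1 h2 => by omega⟩
  obtain ⟨π, hπ⟩ : ∃ π, ∀ s, π ≤ s ↔ ∀ q, s ≤ q → q ≤ k → CmpLE strict (x q) y := by
    refine ⟨Nat.find hex, fun s => ?_⟩
    rw [Nat.find_le_iff]
    exact ⟨fun ⟨t, ht, h'⟩ q hq => h' q (ht.trans hq), fun h' => ⟨s, le_rfl, h'⟩⟩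
  have hπk : π ≤ k + 1 := (hπ _).2 fun q h1 h2 => by omega
  refine Ends.imp (T := (τ + 1) * (7 + 1) + 1 + 2 + 2 + 2) ?_ (by omega) fun _ h => h
  refine Ends.setW_seq (by simp; omega) (by simp [h12]; omega) <|
    Ends.setW_seq (by simp; omega)
      (by simp (disch := omega) only [eval_ofNat, eval_wv, setW_word_ne, h13]; omega) <|
    Ends.setW_seq (by simp; omega)
      (by simp (disch := omega) only [eval_ofNat, eval_wv, setW_word_ne, h14]; omega) <|
    -- after `i` rounds, the current position exceeds `π` by less than the last length that was tried
    -- (at the start, by less than twice the first one)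
    Ends.loop (fun i M' => (∀ a, a ≠ 15 → a ≠ 16 → a ≠ 17 → M'.word a = M.word a) ∧
      M'.real = M.real ∧ (i ≤ τ → M'.word 15 = 2 ^ (τ - i) ∧
        M'.word 16 = R + 32 + K + (τ - i) * K) ∧ (τ < i → M'.word 15 = 0) ∧
      π ≤ M'.word 17 ∧ M'.word 17 ≤ k + 1 ∧ M'.word 17 < π + 2 ^ (τ + 1 - i)) (τ + 1) 7
      ?_ ?_ ?_ (by omega)
  · refine ⟨fun a h1 h2 h3 => ?_, rfl, fun _ => ⟨?_, ?_⟩, fun h => by omega, ?_, ?_, ?_⟩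
    · simp (disch := omega) only [eval_ofNat, setW_word_ne]
    · simp (disch := omega) only [eval_ofNat, eval_wv, setW_word_ne, setW_word_self, h13,
        Nat.sub_zero]
    · simp (disch := omega) only [eval_ofNat, eval_wv, setW_word_ne, setW_word_self, h14,
        Nat.sub_zero]
    · simp (disch := omega) only [eval_ofNat, eval_wv, eval_add, setW_word_ne, setW_word_self, h12]
      omega
    · simp (disch := omega) only [eval_ofNat, eval_wv, eval_add, setW_word_ne, setW_word_self, h12]
      omega
    · simp (disch := omega) only [eval_ofNat, eval_wv, eval_add, setW_word_ne, setW_word_self, h12]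
      rw [Nat.sub_zero, pow_succ]
      omega
  · rintro i M' hi ⟨hw, hr, h15, -, hπ1, hπ2, hπ3⟩
    obtain ⟨h15, h16⟩ := h15 (by omega)
    have hpos : 0 < 2 ^ (τ - i) := by positivity
    refine ⟨by simp [h15], ?_⟩
    have e2 : M'.word 2 = K := by rw [hw 2 (by omega) (by omega) (by omega), h2]
    have e4 : M'.word 4 = R := by rw [hw 4 (by omega) (by omega) (by omega), h4]
    have e6 : M'.word 6 = strict.toNat := by rw [hw 6 (by omega) (by omega) (by omega), h6]
    have e12 : M'.word 12 = k := by rw [hw 12 (by omega) (by omega) (by omega), h12]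
    have hiK : (τ - i) * K ≤ τ * K := Nat.mul_le_mul_right _ (by omega)
    have hple : 2 ^ (τ - i) ≤ 2 ^ τ := Nat.pow_le_pow_right (by norm_num) (by omega)
    have htest := holds_cmpTest M' e6 (.load (wv 16 + (wv 17 - 1))) (.load (wv 4 + 32 + wv 12))
    simp only [reval_load, eval_add, eval_sub, eval_wv, eval_ofNat, h16, e4, e12, hr, hy] at htest
    rw [hlev (τ - i) (by omega) _ (by omega)] at htest
    -- after the test and the possible move, whatever the outcome
    have fin : ∀ M'' : Mem, (∀ a, a ≠ 17 → M''.word a = M'.word a) → M''.real = M'.real →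
        π ≤ M''.word 17 → M''.word 17 ≤ k + 1 → M''.word 17 < π + 2 ^ (τ - i) →
        Ends S W (.setWord 15 (wv 15 / 2) ;; .setWord 16 (wv 16 - wv 2)) M'' (1 + 2)
          fun M' => (∀ a, a ≠ 15 → a ≠ 16 → a ≠ 17 → M'.word a = M.word a) ∧
            M'.real = M.real ∧ (i + 1 ≤ τ → M'.word 15 = 2 ^ (τ - (i + 1)) ∧
              M'.word 16 = R + 32 + K + (τ - (i + 1)) * K) ∧ (τ < i + 1 → M'.word 15 = 0) ∧
            π ≤ M'.word 17 ∧ M'.word 17 ≤ k + 1 ∧ M'.word 17 < π + 2 ^ (τ + 1 - (i + 1)) := by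
      intro M'' hw' hr' a1 a2 a3
      have f15 : M''.word 15 = 2 ^ (τ - i) := by rw [hw' 15 (by omega), h15]
      have f16 : M''.word 16 = R + 32 + K + (τ - i) * K := by rw [hw' 16 (by omega), h16]
      have f2 : M''.word 2 = K := by rw [hw' 2 (by omega), e2]
      refine Ends.setW_seq (by simp; omega) ?_ <| Ends.setW le_rfl (by simp; omega) ?_
        ⟨fun a b1 b2 b3 => ?_, ?_, fun hi' => ⟨?_, ?_⟩, fun hi' => ?_, ?_, ?_, ?_⟩
      · simp only [eval_div, eval_wv, eval_ofNat, f15]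
        have := Nat.div_le_self (2 ^ (τ - i)) 2
        omega
      · simp (disch := omega) only [eval_sub, eval_wv, eval_ofNat, setW_word_ne, f16, f2]
        omega
      · simp (disch := omega) only [eval_ofNat, setW_word_ne]
        rw [hw' a b3, hw a b1 b2 b3]
      · simp only [setW_real, hr', hr]
      · simp (disch := omega) only [eval_ofNat, setW_word_ne, setW_word_self, eval_div, eval_wv, f15]
        rw [show τ - i = τ - (i + 1) + 1 by omega, pow_succ]
        omega
      · simp (disch := omega) only [eval_ofNat, setW_word_ne, setW_word_self, eval_sub, eval_wv, f16,
          f2]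
        rw [show τ - i = τ - (i + 1) + 1 by omega, add_mul]
        omega
      · simp (disch := omega) only [eval_ofNat, setW_word_ne, setW_word_self, eval_div, eval_wv, f15]
        rw [show τ - i = 0 by omega]
        norm_num
      · simp (disch := omega) only [eval_ofNat, setW_word_ne]
        exact a1
      · simp (disch := omega) only [eval_ofNat, setW_word_ne]
        exact a2
      · simp (disch := omega) only [eval_ofNat, setW_word_ne]
        rwa [show τ + 1 - (i + 1) = τ - i by omega]
    have hpow : 2 ^ (τ + 1 - i) = 2 ^ (τ - i) * 2 := by
      rw [show τ + 1 - i = τ - i + 1 by omega, pow_succ]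
    refine Ends.seq (T₁ := 2) (T₂ := 1 + 2) (Ends.ite (T := 1) (fun hb => ?_) fun hb => ?_)
      (by omega)
    · rw [htest] at hb
      refine Ends.setW le_rfl (by simp; omega) (by simp [h15]; omega) (fin _ ?_ rfl ?_ ?_ ?_)
      · intro a ha
        simp only [eval_ofNat]
        rw [setW_word_ne ha]
      all_goals simp only [eval_ofNat, setW_word_self, eval_sub, eval_wv, h15]
      · rw [hπ]
        intro q hq hqk
        by_cases hq' : M'.word 17 ≤ q
        · exact (hπ _).1 hπ1 q hq' hqk
        · exact hb q (by omega) (by omega)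
      · omega
      · omega
    · rw [htest] at hb
      refine ⟨M', 1, .skip M', le_rfl, fin M' (fun _ _ => rfl) rfl hπ1 hπ2 ?_⟩
      by_contra! hc
      refine hb fun q hq hqk => (hπ π).1 le_rfl q (by omega) (by omega)
  · rintro M' ⟨hw, hr, -, h15, hπ1, hπ2, hπ3⟩
    have h17 : M'.word 17 = π := by
      rw [Nat.sub_self, pow_zero] at hπ3
      omega
    refine ⟨by simp [h15 (by omega)], hw, hr, by omega, ?_⟩
    rw [h17]
    exact hπ

/-- One row of the table, which is stored from the address in the word cell `11` on. -/
def queryC : Cmd :=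
  .setWord 12 0 ;;
  .loop (.wordLT (wv 12) (wv 2))
    (descentC ;; .setWord (wv 11 + wv 12) (wv 17) ;; .setWord 12 (wv 12 + 1))

theorem ends_queryC (h2 : M.word 2 = K) (h4 : M.word 4 = R) (hroom : Room K R S W)
    {strict : Bool} (h6 : M.word 6 = strict.toNat) {x y : ℕ → ℝ} {τ b : ℕ}
    (hb : 64 ≤ b) (hbS : b + K ≤ 64 + 8 * (K * K)) (h11 : M.word 11 = b)
    (hy : ∀ k < K, M.real (R + 32 + k) = y k) (hτ : K ≤ 2 ^ τ) (hτ' : 2 ^ τ ≤ K * 2)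
    (hτK : τ < K) (h13 : M.word 13 = 2 ^ τ) (h14 : M.word 14 = R + 32 + K + τ * K)
    (hlev : ∀ t ≤ τ, IsLevel K x (2 ^ t) fun j => M.real (R + 32 + K + t * K + j)) :
    Ends S W queryC M (K * ((τ + 1) * 8 + 12) + 3) fun M' =>
      (∀ a, a ≠ 12 → a ≠ 15 → a ≠ 16 → a ≠ 17 → (a < b ∨ b + K ≤ a) → M'.word a = M.word a) ∧
      M'.real = M.real ∧
      ∀ k < K, ∀ s, M'.word (b + k) ≤ s ↔ ∀ q, s ≤ q → q ≤ k → CmpLE strict (x q) (y k) := by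
  have hroom' := hroom
  obtain ⟨hK, hS, hW⟩ := hroom
  have hKK : K * 4 ≤ K * K := Nat.mul_le_mul_left _ hK
  refine Ends.setW_seq (by simp; omega) (by simp) <| Ends.loop
    (fun k M' => M'.word 12 = k ∧
      (∀ a, a ≠ 12 → a ≠ 15 → a ≠ 16 → a ≠ 17 → (a < b ∨ b + K ≤ a) → M'.word a = M.word a) ∧
      M'.real = M.real ∧
      ∀ k' < k, ∀ s, M'.word (b + k') ≤ s ↔ ∀ q, s ≤ q → q ≤ k' → CmpLE strict (x q) (y k'))
    K ((τ + 1) * 8 + 11) ?_ ?_ ?_ le_rfl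
  · refine ⟨by simp, fun a h1 h2 h3 h4 h5 => ?_, rfl, fun k hk => by omega⟩
    simp only [eval_ofNat]
    rw [setW_word_ne h1]
  · rintro k M' hk ⟨h12, hw, hr, hdone⟩
    have hw' : ∀ a < 15, a ≠ 12 → M'.word a = M.word a := fun a h1 h2 =>
      hw a h2 (by omega) (by omega) (by omega) (by omega)
    refine ⟨by simp only [holds_wordLT, eval_wv, h12, hw' 2 (by omega) (by omega), h2]; exact hk, ?_⟩
    refine Ends.seq (T₁ := (τ + 1) * 8 + 7) (T₂ := 1 + 2) ?_ (by omega)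
    refine (ends_descentC (M := M') (x := x) (y := y k) (k := k) (τ := τ)
      (by rw [hw' 2 (by omega) (by omega), h2])
      (by rw [hw' 4 (by omega) (by omega), h4]) hroom'
      (by rw [hw' 6 (by omega) (by omega), h6]) hk h12 (by rw [hr, hy k hk]) hτ hτ' hτK
      (by rw [hw' 13 (by omega) (by omega), h13]) (by rw [hw' 14 (by omega) (by omega), h14])
      (by rw [hr]; exact hlev)).imp le_rfl ?_
    rintro M'' ⟨hw'', hr'', h17, hπ⟩
    have e11 : M''.word 11 = b := by
      rw [hw'' 11 (by omega) (by omega) (by omega), hw' 11 (by omega) (by omega), h11]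
    have e12 : M''.word 12 = k := by rw [hw'' 12 (by omega) (by omega) (by omega), h12]
    refine Ends.setW_seq (by simp [e11, e12]; omega) (by simp; omega) <|
      Ends.setW le_rfl (by simp; omega) ?_ ⟨?_, fun a h1 h2 h3 h4 h5 => ?_, ?_, fun k' hk' s => ?_⟩
    all_goals simp only [eval_ofNat, eval_add, eval_wv, e11, e12, setW_real]
    · rw [setW_word_ne (by omega), e12]; omega
    · rw [setW_word_self, setW_word_ne (by omega), e12]
    · rw [setW_word_ne h1, setW_word_ne (by omega), hw'' a h2 h3 h4, hw a h1 h2 h3 h4 h5]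
    · rw [hr'', hr]
    · rw [setW_word_ne (by omega)]
      rcases Nat.lt_succ_iff_lt_or_eq.1 hk' with hlt | rfl
      · rw [setW_word_ne (by omega), hw'' _ (by omega) (by omega) (by omega)]
        exact hdone k' hlt s
      · rw [setW_word_self]
        exact hπ s
  · rintro M' ⟨h12, hw, hr, hdone⟩
    refine ⟨?_, hw, hr, hdone⟩
    simp only [holds_wordLT, eval_wv, h12]
    rw [hw 2 (by omega) (by omega) (by omega) (by omega) (by omega), h2]
    omega

/-- Computes the table for the threshold in the real cell `R`, where `R` is in the word cell `4`, in
the mode given by the word cell `6`. The table is stored from the address in the word cell `5` on,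
row by row. -/
def tableC (l : ℕ) : Cmd :=
  .setWord 10 0 ;; .setWord 11 (wv 5) ;;
  .loop (.wordLT (wv 10) (wv 3))
    (intervalsC l ;; levelsC ;; queryC ;; .setWord 10 (wv 10 + 1) ;; .setWord 11 (wv 11 + wv 2))

theorem ends_tableC (h : Env p K R P M) (hroom : Room K R S W) {strict : Bool} {r : ℝ} {b : ℕ}
    (h5 : M.word 5 = b) (hb : 64 ≤ b) (hbS : b + K * K ≤ 64 + 4 * (K * K))
    (h6 : M.word 6 = strict.toNat) (hr : M.real R = r) :
    Ends S W (tableC l) M (50 * (K * (K * (Nat.clog 2 K + 1)))) fun M' =>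
      (∀ a, (a < 10 ∨ 18 < a) → (a < b ∨ b + K * K ≤ a) → M'.word a = M.word a) ∧
      (∀ a < R + 32, M'.real a = M.real a) ∧
      IsTable P K strict r fun e k => M'.word (b + e * K + k) := by
  have hroom' := hroom
  obtain ⟨hK, hS, hW⟩ := hroom
  have hKK : K * 4 ≤ K * K := Nat.mul_le_mul_left _ hK
  set τ := Nat.clog 2 K with hτdef
  have hτ : K ≤ 2 ^ τ := Nat.le_pow_clog (by norm_num) K
  have hτ1 : 1 ≤ τ := Nat.clog_pos (by norm_num) (by omega)
  have hτlt : 2 ^ (τ - 1) < K := (Nat.lt_clog_iff_pow_lt (by norm_num)).1 (by omega)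
  have hτ' : 2 ^ τ ≤ K * 2 := by
    rw [show τ = τ - 1 + 1 by omega, pow_succ]; omega
  have hτK : τ < K := by
    have : τ - 1 < 2 ^ (τ - 1) := Nat.lt_two_pow_self
    omega
  have hKτ : 4 * τ ≤ K * τ := Nat.mul_le_mul_right _ hK
  have hKτ' : K * 1 ≤ K * τ := Nat.mul_le_mul_left _ hτ1
  have hKτ'' : K * (τ + 1) = K * τ + K := by ring
  refine Ends.imp (T := (K - 1) * (45 * (K * (τ + 1)) + 1) + 1 + 2 + 2) ?_ ?_ fun _ h => h
  swap
  · obtain ⟨K, rfl⟩ : ∃ K', K = K' + 1 := ⟨K - 1, by omega⟩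
    rw [Nat.add_sub_cancel]
    nlinarith [hKτ, hKτ', hKτ'', Nat.zero_le K, Nat.zero_le (K * ((K + 1) * τ + (K + 1)))]
  refine Ends.setW_seq (by simp; omega) (by simp) <| Ends.setW_seq (by simp; omega)
    (by simp (disch := omega) only [eval_wv, eval_ofNat, setW_word_ne, h5]; omega) <| Ends.loop
    (fun e M' => M'.word 10 = e ∧ M'.word 11 = b + e * K ∧
      (∀ a, (a < 10 ∨ 18 < a) → (a < b ∨ b + K * K ≤ a) → M'.word a = M.word a) ∧
      (∀ a < R + 32, M'.real a = M.real a) ∧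
      ∀ e' < e, ∀ k < K, ∀ s, M'.word (b + e' * K + k) ≤ s ↔
        ∀ q, s ≤ q → q ≤ k → CmpLE strict (crit P e' q k) r)
    (K - 1) (45 * (K * (τ + 1))) ?_ ?_ ?_ le_rfl
  · refine ⟨?_, ?_, fun a h1 h2 => ?_, fun a ha => rfl, fun e he => by omega⟩
    all_goals simp (disch := omega) only [eval_ofNat, eval_wv, setW_word_ne, setW_word_self, h5]
    omega
  · rintro e M' he ⟨h10, h11, hw, hreal, hdone⟩
    have hE : Env p K R P M' := h.congr (fun a ha => hw a (by omega) (by omega))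
      (fun a ha => hreal a (by omega))
    have heK : (e + 1) * K ≤ K * K := Nat.mul_le_mul_right _ (by omega)
    rw [add_mul, one_mul] at heK
    refine ⟨by simp only [holds_wordLT, eval_wv, h10, hE.w3]; exact he, ?_⟩
    have time : 9 * K + 4 + ((τ * (4 * K + 10) + 5) + ((K * ((τ + 1) * 8 + 12) + 3) + (1 + 2) + 1)
        + 1) + 1 ≤ 45 * (K * (τ + 1)) := by
      have e1 : τ * (4 * K + 10) = 4 * (K * τ) + 10 * τ := by ring
      have e2 : K * ((τ + 1) * 8 + 12) = 8 * (K * τ) + 20 * K := by ring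
      omega
    refine Ends.seq (((ends_intervalsC hE hroom' (strict := strict) (r := r) (e := e)
      (by rw [hw 6 (by omega) (by omega), h6]) (by rw [hreal _ (by omega), hr]) h10
      (by omega))).imp le_rfl ?_) time
    rintro M₁ ⟨hw₁, hr₁, hiv⟩
    have f2 : M₁.word 2 = K := by rw [hw₁ 2 (by omega), hE.w2]
    have f4 : M₁.word 4 = R := by rw [hw₁ 4 (by omega), hE.w4]
    refine Ends.seq ((ends_levelsC f2 f4 hroom' (x := vertexLow P strict r e)
      fun k hk => (hiv k hk).2).imp le_rfl ?_) le_rfl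
    rintro M₂ ⟨hw₂, hr₂, h13, h14, hlev⟩
    refine Ends.seq (T₂ := 1 + 2) ((ends_queryC (M := M₂) (x := vertexLow P strict r e)
      (y := vertexHigh P strict r e) (τ := τ) (b := b + e * K) (strict := strict)
      (by rw [hw₂ 2 (by omega) (by omega) (by omega), f2])
      (by rw [hw₂ 4 (by omega) (by omega) (by omega), f4]) hroom' ?_ (by omega) (by omega)
      ?_ (fun k hk => ?_) hτ hτ' hτK h13 h14 hlev).imp le_rfl ?_) le_rfl
    · rw [hw₂ 6 (by omega) (by omega) (by omega), hw₁ 6 (by omega), hw 6 (by omega) (by omega), h6]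
    · rw [hw₂ 11 (by omega) (by omega) (by omega), hw₁ 11 (by omega), h11]
    · rw [hr₂ _ (by omega), (hiv k hk).1]
    rintro M₃ ⟨hw₃, hr₃, hrow⟩
    have hw₄ : ∀ a, a ≠ 12 → a ≠ 13 → a ≠ 14 → a ≠ 15 → a ≠ 16 → a ≠ 17 → a ≠ 18 →
        (a < b + e * K ∨ b + e * K + K ≤ a) → M₃.word a = M'.word a := by
      intro a _ _ _ _ _ _ _ _
      rw [hw₃ a (by assumption) (by assumption) (by assumption) (by assumption) (by assumption),
        hw₂ a (by assumption) (by assumption) (by assumption), hw₁ a (by assumption)]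
    have g10 : M₃.word 10 = e := by
      rw [hw₄ 10 (by omega) (by omega) (by omega) (by omega) (by omega) (by omega) (by omega)
        (by omega), h10]
    have g11 : M₃.word 11 = b + e * K := by
      rw [hw₄ 11 (by omega) (by omega) (by omega) (by omega) (by omega) (by omega) (by omega)
        (by omega), h11]
    have g2 : M₃.word 2 = K := by
      rw [hw₄ 2 (by omega) (by omega) (by omega) (by omega) (by omega) (by omega) (by omega)
        (by omega), hE.w2]
    refine Ends.setW_seq (by simp; omega) (by simp [g10]; omega) <| Ends.setW le_rfl (by simp; omega)
      ?_ ⟨?_, ?_, fun a h1 h2 => ?_, fun a ha => ?_, fun e' he' k hk s => ?_⟩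
    all_goals simp (disch := omega) only [eval_ofNat, eval_wv, eval_add, setW_word_ne,
      setW_word_self, setW_real, g10, g11, g2]
    · omega
    · rw [add_mul, one_mul, add_assoc]
    · rw [hw₄ a (by omega) (by omega) (by omega) (by omega) (by omega) (by omega) (by omega)
        (by omega), hw a h1 h2]
    · rw [hr₃, hr₂ a (by omega), hr₁ a ha, hreal a ha]
    · rcases Nat.lt_succ_iff_lt_or_eq.1 he' with hlt | rfl
      · have : (e' + 1) * K ≤ e * K := Nat.mul_le_mul_right _ hlt
        rw [add_mul, one_mul] at this
        rw [hw₄ (b + e' * K + k) (by omega) (by omega) (by omega) (by omega) (by omega) (by omega)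
          (by omega) (by omega)]
        exact hdone e' hlt k hk s
      · rw [hrow k hk s]
        simp only [cmpLE_crit_iff]
  · rintro M' ⟨h10, h11, hw, hreal, hdone⟩
    refine ⟨?_, hw, hreal, fun e k he hk s => hdone e (by omega) k hk s⟩
    simp only [holds_wordLT, eval_wv, h10]
    rw [hw 3 (by omega) (by omega), h.w3]
    omega

/-! ### The decision procedure on the machine -/

/-- The cell for the lower side of the current row of the free space diagram in the column `i`. -/
def lowerE (i : WExp) : WExp := 64 + 3 * (wv 2 * wv 2) + i

/-- The entry of the table, whose address is in the word cell `5`, for the edge `e` and the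
vertex `k`. -/
def entryE (e k : WExp) : WExp := .load (wv 5 + e * wv 2 + k)

/-- Initializes the lower sides of the cells in the first row. -/
def lowerC : Cmd :=
  .setWord 20 0 ;;
  .loop (.wordLT (wv 20) (wv 0 - 1))
    (.setWord (lowerE (wv 20)) (1 - wv 20) ;; .setWord 20 (wv 20 + 1))

/-- Runs through the cells, row by row. -/
def rowsC : Cmd :=
  .setWord 21 0 ;;
  .loop (.wordLT (wv 21) (wv 1 - 1))
    (.setWord 22 (1 - wv 21) ;; .setWord 20 0 ;;
      .loop (.wordLT (wv 20) (wv 0 - 1))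
        (.setWord 23 (.load (lowerE (wv 20))) ;;
          .setWord 9 (wv 22 + wv 23) ;;
          .setWord (lowerE (wv 20))
            (.ifz (entryE (wv 20) (wv 0 + wv 21 + 1) - .ifz (wv 22) (wv 23) (wv 0 + wv 21 + 1))
              (.ifz (wv 22) (wv 23) (wv 0 + wv 21 + 1)) 0) ;;
          .setWord 22
            (.ifz (entryE (wv 0 + wv 21) (wv 20 + 1) - .ifz (wv 23) (wv 22) (wv 20 + 1))
              (.ifz (wv 23) (wv 22) (wv 20 + 1)) 0) ;;
          .setWord 20 (wv 20 + 1)) ;;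
      .setWord 21 (wv 21 + 1))

/-- Runs the dynamic program on the table whose address is in the word cell `5`. The result is left
in the word cell `9`; it is `0` if the last cell is not reachable. -/
def decideC : Cmd := lowerC ;; rowsC

theorem ends_decideC (h : Env p K R P M) (hroom : Room K R S W) (hp : 2 ≤ p) (hpK : p + 2 ≤ K)
    {b : ℕ} (h5 : M.word 5 = b) (hb : 64 ≤ b) (hbS : b + K * K ≤ 64 + 3 * (K * K))
    {T : ℕ → ℕ → ℕ} (hT : ∀ e k, M.word (b + e * K + k) = T e k) :
    Ends S W decideC M (40 * (K * K)) fun M' =>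
      (∀ a, (a < 9 ∨ 9 < a ∧ a < 20 ∨ 23 < a ∧ a < 64 + 3 * (K * K)) → M'.word a = M.word a) ∧
      M'.real = M.real ∧ (M'.word 9 ≠ 0 ↔ Entered T p (p - 2) (K - p - 2)) := by
  obtain ⟨hK, hS, hW⟩ := hroom
  have hKK : K * 4 ≤ K * K := Nat.mul_le_mul_left _ hK
  set B := 64 + 3 * (K * K) with hB
  -- what the program never changes
  let Fr : Mem → Prop := fun M' =>
    (∀ a, (a < 9 ∨ 9 < a ∧ a < 20 ∨ 23 < a ∧ a < B) → M'.word a = M.word a) ∧ M'.real = M.real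
  have haddr : ∀ {M' : Mem}, Fr M' → ∀ i : WExp, (lowerE i).eval M' = B + i.eval M' := by
    intro M' hM' i
    simp only [lowerE, eval_add, eval_ofNat, eval_mul, eval_wv, hM'.1 2 (by omega), h.w2, hB]
  have hent : ∀ {M' : Mem}, Fr M' → ∀ e k : WExp, e.eval M' + 1 < K → k.eval M' < K →
      (entryE e k).eval M' = T (e.eval M') (k.eval M') := by
    intro M' hM' e k he hk
    have : (e.eval M' + 1) * K ≤ K * K := Nat.mul_le_mul_right _ (by omega)
    rw [add_mul, one_mul] at this
    simp only [entryE, eval_add, eval_load, eval_mul, eval_wv, hM'.1 2 (by omega),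
      hM'.1 5 (by omega), h.w2, h5]
    rw [hM'.1 _ (by omega), hT]
  refine Ends.imp (T := (1 + 2 + ((p - 1) * 4 + 1)) + (((K - p - 1) *
    (((p - 1) * 10 + 1 + 1 + 1) + 2 + 2 + 1) + 1) + 2) + 1) ?_ ?_ fun _ h => h
  swap
  · obtain ⟨p, rfl⟩ : ∃ p', p = p' + 1 := ⟨p - 1, by omega⟩
    obtain ⟨n, rfl⟩ : ∃ n, K = p + 1 + (n + 1) := ⟨K - p - 2, by omega⟩
    rw [show p + 1 + (n + 1) - (p + 1) - 1 = n by omega, Nat.add_sub_cancel]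
    nlinarith
  have hinit : Ends S W lowerC M
        (1 + 2 + ((p - 1) * 4 + 1)) fun M' => Fr M' ∧ ∀ i < p - 1, M'.word (B + i) = 1 - i := by
    refine Ends.imp (T := (p - 1) * 4 + 1 + 2) ?_ (by omega) fun _ h => h
    refine Ends.setW_seq (by simp; omega) (by simp) <| Ends.loop
      (fun i M' => Fr M' ∧ M'.word 20 = i ∧ ∀ i' < i, M'.word (B + i') = 1 - i') (p - 1) 3
      ?_ ?_ ?_ le_rfl
    · refine ⟨⟨fun a ha => ?_, rfl⟩, ?_, fun i hi => by omega⟩ <;>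
        simp (disch := omega) only [eval_ofNat, setW_word_ne, setW_word_self]
    · rintro i M' hi ⟨hF, h20, hdone⟩
      have h0 : M'.word 0 = p := by rw [hF.1 0 (by omega), h.w0]
      refine ⟨by simp only [holds_wordLT, eval_wv, eval_sub, eval_ofNat, h20, h0]; omega, ?_⟩
      refine Ends.setW_seq (by rw [haddr hF, eval_wv, h20]; omega) (by simp; omega) <|
        Ends.setW le_rfl (by simp; omega) ?_ ⟨⟨fun a ha => ?_, ?_⟩, ?_, fun i' hi' => ?_⟩
      all_goals simp (disch := omega) only [haddr hF, eval_ofNat, eval_wv, eval_add, eval_sub,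
        setW_word_ne, setW_word_self, setW_real, h20, hF.2]
      · omega
      · exact hF.1 a ha
      · rcases Nat.lt_succ_iff_lt_or_eq.1 hi' with hlt | rfl
        · rw [setW_word_ne (by omega), hdone i' hlt]
        · rw [setW_word_self]
    · rintro M' ⟨hF, h20, hdone⟩
      refine ⟨?_, hF, hdone⟩
      simp only [holds_wordLT, eval_wv, eval_sub, eval_ofNat, h20, hF.1 0 (by omega), h.w0]
      omega
  have hmain : ∀ M₁, (Fr M₁ ∧ ∀ i < p - 1, M₁.word (B + i) = 1 - i) → Ends S W rowsC M₁ (((K - p - 1) *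
    (((p - 1) * 10 + 1 + 1 + 1) + 2 + 2 + 1) + 1) + 2) fun M' => Fr M' ∧
        M'.word 9 = dpV T p (dpH T p (K - p - 2)) (K - p - 2) (p - 2) +
          dpH T p (K - p - 2) (p - 2) := by
    rintro M₁ ⟨hF₁, hlow⟩
    refine Ends.setW_seq (by simp; omega) (by simp) <| Ends.loop
      (fun j M' => Fr M' ∧ M'.word 21 = j ∧ (∀ i < p - 1, M'.word (B + i) = dpH T p j i) ∧
        (1 ≤ j → M'.word 9 = dpV T p (dpH T p (j - 1)) (j - 1) (p - 2) + dpH T p (j - 1) (p - 2)))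
      (K - p - 1) (((p - 1) * 10 + 1 + 1 + 1) + 2 + 2) ?_ ?_ ?_ le_rfl
    · refine ⟨⟨fun a ha => ?_, ?_⟩, ?_, fun i hi => ?_, fun hj => by omega⟩
      all_goals simp (disch := omega) only [eval_ofNat, setW_word_ne, setW_word_self, setW_real,
        hF₁.2]
      · exact hF₁.1 a ha
      · rw [hlow i hi, dpH_zero]
    · rintro j M₂ hj ⟨hF₂, h21, hlow₂, -⟩
      refine ⟨by
        simp only [holds_wordLT, eval_wv, eval_sub, eval_ofNat, h21, hF₂.1 1 (by omega), h.w1]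
        omega, ?_⟩
      -- in the column `i`, the lower sides to the left already belong to the next row
      refine Ends.setW_seq (by simp; omega) (by simp; omega) <| Ends.setW_seq (by simp; omega)
        (by simp) <| Ends.seq (T₁ := (p - 1) * 10 + 1) (T₂ := 1) (Ends.loop (fun i M' => Fr M' ∧
          M'.word 21 = j ∧ M'.word 20 = i ∧ M'.word 22 = dpV T p (dpH T p j) j i ∧
          (∀ i' < i, M'.word (B + i') = dpH T p (j + 1) i') ∧
          (∀ i' < p - 1, i ≤ i' → M'.word (B + i') = dpH T p j i') ∧
          (1 ≤ i → M'.word 9 = dpV T p (dpH T p j) j (i - 1) + dpH T p j (i - 1)))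
          (p - 1) 9 ?_ ?_ ?_ le_rfl) le_rfl
      · refine ⟨⟨fun a ha => ?_, ?_⟩, ?_, ?_, ?_, fun i hi => by omega, fun i hi _ => ?_,
          fun hi => by omega⟩
        all_goals simp (disch := omega) only [eval_ofNat, eval_sub, eval_wv, setW_word_ne,
          setW_word_self, setW_real, hF₂.2, h21]
        · exact hF₂.1 a ha
        · rfl
        · exact hlow₂ i hi
      · rintro i M₃ hi ⟨hF, h21, h20, h22, hnew, hold, -⟩
        have h0 : M₃.word 0 = p := by rw [hF.1 0 (by omega), h.w0]
        refine ⟨by simp only [holds_wordLT, eval_wv, eval_sub, eval_ofNat, h20, h0]; omega, ?_⟩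
        have hh := hold i (by omega) le_rfl
        have bv := dpV_le T p (dpH T p j) j i
        have bh := dpH_le T p j i
        have bv' := dpV_le T p (dpH T p j) j (i + 1)
        have bh' := dpH_le T p (j + 1) i
        refine Ends.setW_seq (by simp; omega) (by simp [haddr hF, h20, hh]; omega) ?_
        rw [show (WExp.load (lowerE (wv 20))).eval M₃ = dpH T p j i by
          rw [eval_load, haddr hF, eval_wv, h20, hh], eval_ofNat]
        refine Ends.setW_seq (by simp; omega)
          (by simp (disch := omega) only [eval_add, eval_wv, setW_word_ne, setW_word_self, h22]
              omega) ?_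
        set M₄ := (M₃.setW 23 (dpH T p j i)).setW (WExp.eval (M₃.setW 23 (dpH T p j i)) 9)
          (WExp.eval (M₃.setW 23 (dpH T p j i)) (wv 22 + wv 23)) with hM₄
        have hF₄ : Fr M₄ := by
          refine ⟨fun a ha => ?_, ?_⟩
          · simp (disch := omega) only [hM₄, eval_ofNat, setW_word_ne]
            exact hF.1 a ha
          · simp only [hM₄, setW_real, hF.2]
        have e9 : M₄.word 9 = dpV T p (dpH T p j) j i + dpH T p j i := by
          simp (disch := omega) only [hM₄, eval_ofNat, eval_add, eval_wv, setW_word_ne,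
            setW_word_self, h22]
        have e23 : M₄.word 23 = dpH T p j i := by
          simp (disch := omega) only [hM₄, eval_ofNat, setW_word_ne, setW_word_self]
        have e4 : ∀ a, a ≠ 9 → a ≠ 23 → M₄.word a = M₃.word a := by
          intro a _ _
          simp (disch := omega) only [hM₄, eval_ofNat, setW_word_ne]
        clear_value M₄
        have ev : (WExp.ifz (entryE (wv 20) (wv 0 + wv 21 + 1) -
            .ifz (wv 22) (wv 23) (wv 0 + wv 21 + 1))
              (.ifz (wv 22) (wv 23) (wv 0 + wv 21 + 1)) 0).eval M₄ = dpH T p (j + 1) i := by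
          rw [eval_ifz, eval_sub, hent hF₄ _ _ (by simp [e4, h20]; omega)
            (by simp [e4, h0, h21]; omega), dpH_succ]
          simp (disch := omega) only [eval_ifz, eval_wv, eval_add, eval_ofNat, e23, e4, h20, h21,
            h22, h0, Nat.sub_eq_zero_iff_le]
        refine Ends.setW_seq (by rw [haddr hF₄, eval_wv, e4 20 (by omega) (by omega), h20]; omega)
          (by rw [ev]; omega) ?_
        rw [ev, haddr hF₄, eval_wv, e4 20 (by omega) (by omega), h20]
        have hF₅ : Fr (M₄.setW (B + i) (dpH T p (j + 1) i)) := by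
          refine ⟨fun a ha => ?_, by rw [setW_real, hF₄.2]⟩
          rw [setW_word_ne (by omega), hF₄.1 a ha]
        have e5 : ∀ a, a ≠ 9 → a ≠ 23 → a ≠ B + i →
            (M₄.setW (B + i) (dpH T p (j + 1) i)).word a = M₃.word a := fun a h1 h2 h3 => by
          rw [setW_word_ne h3, e4 a h1 h2]
        have e523 : (M₄.setW (B + i) (dpH T p (j + 1) i)).word 23 = dpH T p j i := by
          rw [setW_word_ne (by omega), e23]
        have e59 : (M₄.setW (B + i) (dpH T p (j + 1) i)).word 9 =
          dpV T p (dpH T p j) j i + dpH T p j i := by rw [setW_word_ne (by omega), e9]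
        have e5B : (M₄.setW (B + i) (dpH T p (j + 1) i)).word (B + i) = dpH T p (j + 1) i :=
          setW_word_self ..
        generalize M₄.setW (B + i) (dpH T p (j + 1) i) = M₅ at *
        have ev' : (WExp.ifz (entryE (wv 0 + wv 21) (wv 20 + 1) - .ifz (wv 23) (wv 22) (wv 20 + 1))
              (.ifz (wv 23) (wv 22) (wv 20 + 1)) 0).eval M₅ = dpV T p (dpH T p j) j (i + 1) := by
          rw [eval_ifz, eval_sub, hent hF₅ _ _
            (by simp (disch := omega) only [eval_add, eval_wv, e5, h0, h21]; omega)
            (by simp (disch := omega) only [eval_add, eval_wv, eval_ofNat, e5, h20]; omega), dpV]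
          simp (disch := omega) only [eval_ifz, eval_wv, eval_add, eval_ofNat, e523, e5, h20, h21,
            h22, h0, Nat.sub_eq_zero_iff_le]
        refine Ends.setW_seq (by simp; omega) (by rw [ev']; omega) ?_
        rw [ev', eval_ofNat]
        refine Ends.setW le_rfl (by simp; omega)
          (by simp (disch := omega) only [eval_add, eval_wv, eval_ofNat, setW_word_ne, e5, h20]
              omega)
          ⟨⟨fun a ha => ?_, ?_⟩, ?_, ?_, ?_, fun i' hi' => ?_, fun i' hi' hi'' => ?_, fun _ => ?_⟩
        all_goals simp (disch := omega) only [eval_ofNat, eval_add, eval_wv, setW_word_ne,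
          setW_word_self, setW_real, hF₅.2, e5, h20, h21]
        · exact hF.1 a ha
        · rcases Nat.lt_succ_iff_lt_or_eq.1 hi' with hlt | rfl
          · rw [e5 _ (by omega) (by omega) (by omega), hnew i' hlt]
          · exact e5B
        · exact hold i' hi' (by omega)
        · rw [e59, Nat.add_sub_cancel]
      · rintro M₃ ⟨hF, h21, h20, h22, hnew, hold, h9⟩
        refine ⟨by
          simp only [holds_wordLT, eval_wv, eval_sub, eval_ofNat, h20, hF.1 0 (by omega), h.w0]
          omega, ?_⟩
        refine Ends.setW le_rfl (by simp; omega) (by simp [h21]; omega)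
          ⟨⟨fun a ha => ?_, ?_⟩, ?_, fun i hi => ?_, fun _ => ?_⟩
        all_goals simp (disch := omega) only [eval_ofNat, eval_add, eval_wv, setW_word_ne,
          setW_word_self, setW_real, hF.2, h21]
        · exact hF.1 a ha
        · exact hnew i hi
        · rw [h9 (by omega), Nat.add_sub_cancel, Nat.sub_sub]
    · rintro M' ⟨hF, h21, -, h9⟩
      refine ⟨by
        simp only [holds_wordLT, eval_wv, eval_sub, eval_ofNat, h21, hF.1 1 (by omega), h.w1]
        omega, hF, ?_⟩
      rw [h9 (by omega), Nat.sub_sub _ 1 1]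
  refine Ends.seq (hinit.imp le_rfl fun M₁ hM₁ => (hmain M₁ hM₁).imp le_rfl ?_) le_rfl
  rintro M₂ ⟨hF, h9⟩
  exact ⟨hF.1, hF.2, by rw [h9, Entered]⟩

/-! ### Selecting a candidate on the machine -/

/-- The number of candidates at the place in the word cell `24`: the difference of the entries of the
tables at the addresses `64` and `64 + K * K`. -/
def gapE : WExp := .load (64 + wv 24) - .load (64 + wv 2 * wv 2 + wv 24)

/-- Counts all candidates, in the word cell `7`. -/
def countC : Cmd :=
  .setWord 7 0 ;; .setWord 24 0 ;;
  .loop (.wordLT (wv 24) (wv 3 * wv 2))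
    (.setWord 7 (wv 7 + gapE) ;; .setWord 24 (wv 24 + 1))

theorem ends_countC (h : Env p K R P M) (hroom : Room K R S W)
    (ha : ∀ x < (K - 1) * K, M.word (64 + x) ≤ K) :
    Ends S W countC M (5 * (K * K)) fun M' =>
      (∀ a, a ≠ 7 → a ≠ 24 → M'.word a = M.word a) ∧ M'.real = M.real ∧
      M'.word 7 = ∑ x ∈ Finset.range ((K - 1) * K),
        (M.word (64 + x) - M.word (64 + K * K + x)) := by
  obtain ⟨hK, hS, hW⟩ := hroom
  have hKK : K * 4 ≤ K * K := Nat.mul_le_mul_left _ hK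
  have hK1 : (K - 1) * K + K = K * K := by
    obtain ⟨K, rfl⟩ : ∃ K', K = K' + 1 := ⟨K - 1, by omega⟩
    rw [Nat.add_sub_cancel]; ring
  have hbound : ∀ x ≤ (K - 1) * K, ∑ y ∈ Finset.range x,
      (M.word (64 + y) - M.word (64 + K * K + y)) ≤ K * K * K := by
    intro x hx
    calc _ ≤ ∑ y ∈ Finset.range x, K := Finset.sum_le_sum fun y hy =>
            (Nat.sub_le _ _).trans (ha y ((Finset.mem_range.1 hy).trans_le hx))
      _ = x * K := by simp
      _ ≤ K * K * K := Nat.mul_le_mul_right _ (by omega)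
  refine Ends.imp (T := (K - 1) * K * 4 + 1 + 2 + 2) ?_ (by omega) fun _ h => h
  refine Ends.setW_seq (by simp; omega) (by simp) <| Ends.setW_seq (by simp; omega) (by simp) <|
    Ends.loop (fun x M' => M'.word 24 = x ∧ (∀ a, a ≠ 7 → a ≠ 24 → M'.word a = M.word a) ∧
      M'.real = M.real ∧ M'.word 7 = ∑ y ∈ Finset.range x,
        (M.word (64 + y) - M.word (64 + K * K + y))) _ 3 ?_ ?_ ?_ le_rfl
  · refine ⟨?_, fun a h1 h2 => ?_, rfl, ?_⟩
    all_goals simp (disch := omega) only [eval_ofNat, setW_word_ne, setW_word_self,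
      Finset.sum_range_zero]
  · rintro x M' hx ⟨h24, hw, hr, h7⟩
    have e2 : M'.word 2 = K := by rw [hw 2 (by omega) (by omega), h.w2]
    have e3 : M'.word 3 = K - 1 := by rw [hw 3 (by omega) (by omega), h.w3]
    have hgap : gapE.eval M' = M.word (64 + x) - M.word (64 + K * K + x) := by
      simp only [gapE, eval_sub, eval_load, eval_add, eval_mul, eval_wv, eval_ofNat, h24, e2]
      rw [hw _ (by omega) (by omega), hw _ (by omega) (by omega)]
    have hnew := hbound (x + 1) hx
    rw [Finset.sum_range_succ] at hnew
    refine ⟨by simp only [holds_wordLT, eval_wv, eval_mul, h24, e2, e3]; exact hx, ?_⟩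
    refine Ends.setW_seq (by simp; omega) (by simp only [eval_add, eval_wv, hgap, h7]; omega) <|
      Ends.setW le_rfl (by simp; omega) ?_ ⟨?_, fun a h1 h2 => ?_, ?_, ?_⟩
    all_goals simp (disch := omega) only [eval_ofNat, eval_add, eval_wv, setW_word_ne,
      setW_word_self, setW_real, h24, hgap, h7, hr]
    · omega
    · exact hw a h1 h2
    · rw [Finset.sum_range_succ]
  · rintro M' ⟨h24, hw, hr, h7⟩
    refine ⟨?_, hw, hr, h7⟩
    simp only [holds_wordLT, eval_wv, eval_mul, h24]
    rw [hw 2 (by omega) (by omega), hw 3 (by omega) (by omega), h.w2, h.w3]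
    omega

/-- Finds the place of the candidate with the number in the word cell `8`. The place is left in the
word cell `24`, and the number of the candidate at this place in the word cell `8`. -/
def findC : Cmd :=
  .setWord 24 0 ;;
  .loop (.not (.wordLT (wv 8) gapE)) (.setWord 8 (wv 8 - gapE) ;; .setWord 24 (wv 24 + 1))

theorem ends_findC (h : Env p K R P M) (hroom : Room K R S W) (hM : ∀ a, M.word a ≤ W) {x w : ℕ}
    (hx : x < (K - 1) * K)
    (h8 : M.word 8 = ∑ y ∈ Finset.range x, (M.word (64 + y) - M.word (64 + K * K + y)) + w)
    (hw : w < M.word (64 + x) - M.word (64 + K * K + x)) :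
    Ends S W findC M (5 * (K * K)) fun M' =>
      (∀ a, a ≠ 8 → a ≠ 24 → M'.word a = M.word a) ∧ M'.real = M.real ∧
      M'.word 8 = w ∧ M'.word 24 = x := by
  obtain ⟨hK, hS, hW⟩ := hroom
  have hKK : K * 4 ≤ K * K := Nat.mul_le_mul_left _ hK
  have hK1 : (K - 1) * K + K = K * K := by
    obtain ⟨K, rfl⟩ : ∃ K', K = K' + 1 := ⟨K - 1, by omega⟩
    rw [Nat.add_sub_cancel]; ring
  have hgap : ∀ {M' : Mem} {i : ℕ}, M'.word 24 = i →
      (∀ a, a ≠ 8 → a ≠ 24 → M'.word a = M.word a) →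
      gapE.eval M' = M.word (64 + i) - M.word (64 + K * K + i) := by
    intro M' i h24 hw
    have e2 : M'.word 2 = K := by rw [hw 2 (by omega) (by omega), h.w2]
    simp only [gapE, eval_sub, eval_load, eval_add, eval_mul, eval_wv, eval_ofNat, h24, e2]
    rw [hw _ (by omega) (by omega), hw _ (by omega) (by omega)]
  refine Ends.imp (T := x * 4 + 1 + 2) ?_ (by omega) fun _ h => h
  refine Ends.setW_seq (by simp; omega) (by simp) <|
    Ends.loop (fun i M' => M'.word 24 = i ∧ (∀ a, a ≠ 8 → a ≠ 24 → M'.word a = M.word a) ∧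
      M'.real = M.real ∧ M'.word 8 + ∑ y ∈ Finset.range i,
        (M.word (64 + y) - M.word (64 + K * K + y)) = M.word 8) x 3 ?_ ?_ ?_ le_rfl
  · refine ⟨?_, fun a h1 h2 => ?_, rfl, ?_⟩
    all_goals simp (disch := omega) only [eval_ofNat, setW_word_ne, setW_word_self,
      Finset.sum_range_zero, add_zero]
  · rintro i M' hi ⟨h24, hw', hr, h8'⟩
    have hle : ∑ y ∈ Finset.range (i + 1), (M.word (64 + y) - M.word (64 + K * K + y)) ≤
        ∑ y ∈ Finset.range x, (M.word (64 + y) - M.word (64 + K * K + y)) :=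
      Finset.sum_le_sum_of_subset (Finset.range_mono hi)
    rw [Finset.sum_range_succ] at hle
    have hM8 := hM 8
    refine ⟨by simp only [holds_not, holds_wordLT, eval_wv, hgap h24 hw']; omega, ?_⟩
    refine Ends.setW_seq (by simp; omega) (by simp only [eval_sub, eval_wv]; omega) <|
      Ends.setW le_rfl (by simp; omega) ?_ ⟨?_, fun a h1 h2 => ?_, ?_, ?_⟩
    all_goals simp (disch := omega) only [eval_ofNat, eval_add, eval_sub, eval_wv, setW_word_ne,
      setW_word_self, setW_real, h24, hgap h24 hw', hr]
    · omega
    · exact hw' a h1 h2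
    · rw [Finset.sum_range_succ]
      omega
  · rintro M' ⟨h24, hw', hr, h8'⟩
    have h8w : M'.word 8 = w := by omega
    refine ⟨?_, hw', hr, h8w, h24⟩
    simp only [holds_not, holds_wordLT, eval_wv, hgap h24 hw', h8w, not_not]
    exact hw

/-- Computes the value of the candidate that `findC` has found. The value is left in the real cell
`R`, for `R` in the word cell `4`. -/
def valueC (l : ℕ) : Cmd :=
  .setWord 25 (wv 24 / wv 2) ;;
  .setWord 26 (wv 24 - wv 25 * wv 2) ;;
  .setWord 27 (.load (64 + wv 2 * wv 2 + wv 24) + wv 8) ;;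
  .setReal (wv 4) (critE l (wv 25) (wv 26) (wv 26)) ;;
  .loop (.wordLT (wv 27) (wv 26 + 1))
    (.setReal (wv 4) (.max (rv 0) (critE l (wv 25) (wv 27) (wv 26))) ;;
      .setWord 27 (wv 27 + 1))

theorem ends_valueC (h : Env p K R P M) (hroom : Room K R S W) {x w s : ℕ}
    (hx : x < (K - 1) * K) (h24 : M.word 24 = x) (h8 : M.word 8 = w)
    (hs : M.word (64 + K * K + x) + w = s) (hsk : s ≤ x % K) :
    Ends S W (valueC l) M (5 * (K * K)) fun M' =>
      (∀ a, a ≠ 25 → a ≠ 26 → a ≠ 27 → M'.word a = M.word a) ∧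
      (∀ a, a ≠ R → M'.real a = M.real a) ∧ M'.real R = critMax P (x / K) (x % K) s := by
  obtain ⟨hK, hS, hW⟩ := hroom
  have hKK : K * 4 ≤ K * K := Nat.mul_le_mul_left _ hK
  have hxK : x / K < K - 1 := Nat.div_lt_of_lt_mul (by rwa [mul_comm])
  have hkK : x % K < K := Nat.mod_lt _ (by omega)
  have hxx : x - x / K * K = x % K := by
    have := Nat.div_add_mod' x K
    omega
  generalize hk : x % K = k at *
  generalize he : x / K = e at *
  let Fr : Mem → Prop := fun M' => (∀ a, a ≠ 25 → a ≠ 26 → a ≠ 27 → M'.word a = M.word a) ∧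
    (∀ a, a ≠ R → M'.real a = M.real a) ∧ M'.word 25 = e ∧ M'.word 26 = k
  have hEnv : ∀ {M' : Mem}, Fr M' → Env p K R P M' := fun hM' =>
    h.congr (fun a ha => hM'.1 a (by omega) (by omega) (by omega))
      (fun a ha => hM'.2.1 a (by omega))
  refine Ends.imp (T := (k + 1 - s) * 4 + 1 + 2 + 2 + 2 + 2) ?_ (by omega) fun _ h => h
  refine Ends.setW_seq (by simp; omega) ?_ <| Ends.setW_seq (by simp; omega) ?_ <|
    Ends.setW_seq (by simp; omega) ?_ ?_
  · simp only [eval_div, eval_wv, h24, h.w2, he]; omega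
  · simp (disch := omega) only [eval_div, eval_sub, eval_mul, eval_wv, eval_ofNat, setW_word_ne,
      setW_word_self, h24, h.w2, he, hxx]
    omega
  · simp (disch := omega) only [eval_div, eval_sub, eval_mul, eval_wv, eval_ofNat, setW_word_ne,
      setW_word_self, eval_add, eval_load, h24, h.w2, he, hxx, h8, hs]
    omega
  simp (disch := omega) only [eval_div, eval_sub, eval_mul, eval_wv, eval_ofNat, setW_word_ne,
    setW_word_self, eval_add, eval_load, h24, h.w2, he, hxx, h8, hs]
  set M₁ := ((M.setW 25 e).setW 26 k).setW 27 s with hM₁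
  have hF₁ : Fr M₁ := by
    refine ⟨fun a h1 h2 h3 => ?_, fun a ha => rfl, ?_, ?_⟩ <;>
      simp (disch := omega) only [hM₁, setW_word_ne, setW_word_self]
  have h27 : M₁.word 27 = s := setW_word_self ..
  clear_value M₁
  have hcrit : ∀ {M' : Mem}, Fr M' → ∀ {q : ℕ} (i : ℕ), M'.word i = q → q < K →
      (critE l (wv 25) (wv i) (wv 26)).eval M' = crit P e q k := by
    intro M' hM' q i hi hq
    rw [(hEnv hM').critE (by simp only [eval_wv, hM'.2.2.1]; omega)
      (by simp only [eval_wv, hi]; omega) (by simp only [eval_wv, hM'.2.2.2]; omega)]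
    simp only [eval_wv, hM'.2.2.1, hM'.2.2.2, hi]
  have hFr : ∀ {M' : Mem} (v : ℝ), Fr M' → Fr (M'.setR R v) := fun v hM' =>
    ⟨hM'.1, fun a ha => by rw [setR_real_ne ha, hM'.2.1 a ha], hM'.2.2⟩
  refine Ends.setR_seq (by simp only [eval_wv, (hEnv hF₁).w4]; omega) ?_
  rw [hcrit hF₁ 26 hF₁.2.2.2 hkK, eval_wv, (hEnv hF₁).w4]
  refine Ends.loop (fun i M' => Fr M' ∧ M'.word 27 = s + i ∧
    ∀ r, M'.real R ≤ r ↔ crit P e k k ≤ r ∧ ∀ q, s ≤ q → q < s + i → crit P e q k ≤ r)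
    (k + 1 - s) 3 ?_ ?_ ?_ le_rfl
  · refine ⟨hFr _ hF₁, by rw [setR_word, h27, add_zero], fun r => ?_⟩
    rw [setR_real_self, and_iff_left]
    intro q h1 h2
    omega
  · rintro i M' hi ⟨hF, h27, hmax⟩
    refine ⟨by simp only [holds_wordLT, eval_wv, eval_add, eval_ofNat, h27, hF.2.2.2]; omega, ?_⟩
    refine Ends.setR_seq (by simp only [eval_wv, (hEnv hF).w4]; omega) ?_
    rw [reval_max, hcrit hF 27 h27 (by omega), eval_wv, reval_rv, (hEnv hF).w4, add_zero]
    have hF' := hFr (max (M'.real R) (crit P e (s + i) k)) hF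
    refine Ends.setW le_rfl (by simp; omega)
      (by simp only [eval_add, eval_wv, eval_ofNat, setR_word, h27]; omega)
      ⟨⟨fun a h1 h2 h3 => ?_, hF'.2.1, ?_, ?_⟩, ?_, fun r => ?_⟩
    all_goals simp (disch := omega) only [eval_ofNat, eval_add, eval_wv, setW_word_ne,
      setW_word_self, setW_real, setR_word, setR_real_self, h27]
    · exact hF.1 a h1 h2 h3
    · exact hF.2.2.1
    · exact hF.2.2.2
    · omega
    · rw [max_le_iff, hmax]
      constructor
      · rintro ⟨⟨h1, h2⟩, h3⟩
        refine ⟨h1, fun q h4 h5 => ?_⟩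
        rcases Nat.lt_or_ge q (s + i) with h6 | h6
        · exact h2 q h4 h6
        · rwa [show q = s + i by omega]
      · rintro ⟨h1, h2⟩
        exact ⟨⟨h1, fun q h4 h5 => h2 q h4 (by omega)⟩, h2 _ (by omega) (by omega)⟩
  · rintro M' ⟨hF, h27, hmax⟩
    refine ⟨by simp only [holds_wordLT, eval_wv, eval_add, eval_ofNat, h27, hF.2.2.2]; omega,
      hF.1, hF.2.1, ?_⟩
    refine eq_of_forall_ge_iff fun r => ?_
    rw [hmax]
    have := cmpLE_critMax_iff (P := P) (e := e) (strict := false) (r := r) hsk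
    simp only [CmpLE, Bool.false_eq_true, if_false] at this
    rw [this]
    exact ⟨fun h q h1 h2 => h.2 q h1 (by omega),
      fun h => ⟨h k hsk le_rfl, fun q h1 h2 => h q h1 (by omega)⟩⟩

end Spec

section Spec

variable {l p K R m n : ℕ} {P : ℕ → EuclideanSpace ℝ (Fin l)} {M : Mem}
  {A : Fin (m + 1) → EuclideanSpace ℝ (Fin l)} {B : Fin (n + 1) → EuclideanSpace ℝ (Fin l)}
  {S W : ℕ}

/-! ### A round of the search on the machine -/

/-- Tests the threshold in the real cell `R`. -/
def testC (l : ℕ) : Cmd := tableC l ;; decideC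

theorem ends_testC (h : Env (m + 1) K R (vertex A B) M) (hroom : Room K R S W) (hm : 1 ≤ m)
    (hn : 1 ≤ n) (hK : m + 1 + (n + 1) = K) {b : ℕ} {r : ℝ} (h5 : M.word 5 = b) (hb : 64 ≤ b)
    (hbS : b + K * K ≤ 64 + 3 * (K * K)) (h6 : M.word 6 = 0) (hr : M.real R = r)
    (hr0 : endpointSq A B ≤ r) :
    Ends S W (testC l) M (91 * (K * (K * (Nat.clog 2 K + 1)))) fun M' =>
      (∀ a, (a < 9 ∨ 23 < a ∧ a < 64 + 3 * (K * K)) → (a < b ∨ b + K * K ≤ a) →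
        M'.word a = M.word a) ∧
      (∀ a < R + 32, M'.real a = M.real a) ∧
      IsTable (vertex A B) K false r (fun e k => M'.word (b + (e * K + k))) ∧
      (M'.word 9 ≠ 0 ↔ FrechetLE A B r) := by
  have hX : K * K ≤ K * (K * (Nat.clog 2 K + 1)) :=
    Nat.mul_le_mul_left _ (Nat.le_mul_of_pos_right _ (by omega))
  have hK4 := hroom.four_le
  have hKK : K * 4 ≤ K * K := Nat.mul_le_mul_left _ hK4
  refine Ends.seq ((ends_tableC h hroom h5 hb (by omega) (strict := false) h6 hr).imp le_rfl ?_)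
    (T₂ := 40 * (K * K)) (by omega)
  rintro M₁ ⟨hw₁, hr₁, hT₁⟩
  have h₁ : Env (m + 1) K R (vertex A B) M₁ :=
    h.congr (fun a ha => hw₁ a (by omega) (by omega)) (fun a ha => hr₁ a (by omega))
  refine (ends_decideC h₁ hroom (by omega) (by omega) (by rw [hw₁ 5 (by omega) (by omega), h5]) hb hbS
    (T := fun e k => M₁.word (b + e * K + k)) (fun _ _ => rfl)).imp le_rfl ?_
  rintro M₂ ⟨hw₂, hr₂, h9⟩
  refine ⟨fun a h1 h2 => ?_, fun a ha => by rw [hr₂, hr₁ a ha], fun e k he hk s => ?_, ?_⟩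
  · rw [hw₂ a (by omega), hw₁ a (by omega) h2]
  · have hx : e * K + k < (K - 1) * K := place_lt he hk
    have hle : (K - 1) * K ≤ K * K := Nat.mul_le_mul_right _ (by omega)
    beta_reduce
    rw [hw₂ _ (by omega), ← add_assoc]
    exact hT₁ e k he hk s
  · rw [h9, frechetLE_iff_entered hm hn hK hr0 hT₁]
    congr! 1
    omega

/-- Computes one of the two tables, and counts the candidates between them. -/
def refreshC (l : ℕ) : Cmd := tableC l ;; countC

theorem ends_refreshC (h : Env p K R P M) (hroom : Room K R S W) {b : ℕ} {strict : Bool} {r : ℝ}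
    (h5 : M.word 5 = b) (hb : b = 64 ∨ b = 64 + K * K)
    (h6 : M.word 6 = strict.toNat) (hr : M.real R = r)
    (ha : b = 64 ∨ ∀ x < (K - 1) * K, M.word (64 + x) ≤ K) :
    Ends S W (refreshC l) M (56 * (K * (K * (Nat.clog 2 K + 1)))) fun M' =>
      Env p K R P M' ∧
      (∀ a, 64 ≤ a → (a < b ∨ b + K * K ≤ a) → M'.word a = M.word a) ∧
      M'.real (R + 1) = M.real (R + 1) ∧
      IsTable P K strict r (fun e k => M'.word (b + (e * K + k))) ∧
      M'.word 7 = ∑ x ∈ Finset.range ((K - 1) * K),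
        (M'.word (64 + x) - M'.word (64 + K * K + x)) := by
  have hX : K * K ≤ K * (K * (Nat.clog 2 K + 1)) :=
    Nat.mul_le_mul_left _ (Nat.le_mul_of_pos_right _ (by omega))
  have hK4 := hroom.four_le
  have hKK : K * 4 ≤ K * K := Nat.mul_le_mul_left _ hK4
  have hle : (K - 1) * K ≤ K * K := Nat.mul_le_mul_right _ (by omega)
  refine Ends.seq ((ends_tableC h hroom h5 (by omega) (by omega) h6 hr).imp le_rfl ?_)
    (T₂ := 5 * (K * K)) (by omega)
  rintro M₁ ⟨hw₁, hr₁, hT₁⟩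
  have h₁ : Env p K R P M₁ :=
    h.congr (fun a ha => hw₁ a (by omega) (by omega)) (fun a ha => hr₁ a (by omega))
  refine (ends_countC h₁ hroom fun x hx => ?_).imp le_rfl ?_
  · by_cases hb' : b = 64
    · obtain ⟨he, hk, hx'⟩ := place_split hx
      have := hT₁.le_succ he hk
      rw [hb', add_assoc, hx'] at this
      omega
    · rw [hw₁ _ (by omega) (by omega)]
      exact ha.resolve_left hb' x hx
  · rintro M₂ ⟨hw₂, hr₂, h7⟩
    refine ⟨h₁.congr (fun a ha => hw₂ a (by omega) (by omega)) (fun a ha => by rw [hr₂]),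
      fun a h1 h2 => ?_, by rw [hr₂, hr₁ _ (by omega)], fun e k he hk s => ?_, ?_⟩
    · rw [hw₂ a (by omega) (by omega), hw₁ a (by omega) h2]
    · beta_reduce
      rw [hw₂ _ (by omega) (by omega), ← add_assoc]
      exact hT₁ e k he hk s
    · rw [h7]
      refine Finset.sum_congr rfl fun x _ => ?_
      rw [hw₂ (64 + x) (by omega) (by omega), hw₂ (64 + K * K + x) (by omega) (by omega)]

/-- The state of the search between two rounds: the memory holds the two tables and the number of the
candidates between them, and the upper threshold in the real cell `R + 1`, unless the upper table
is still the initial one. -/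
structure Searching (A : Fin (m + 1) → EuclideanSpace ℝ (Fin l))
    (B : Fin (n + 1) → EuclideanSpace ℝ (Fin l)) (K R : ℕ) (M : Mem) (α β : ℝ) : Prop where
  env : Env (m + 1) K R (vertex A B) M
  bracket : FrechetBracket A B K α β (fun x => M.word (64 + x)) (fun x => M.word (64 + K * K + x))
  count : M.word 7 = ∑ x ∈ Finset.range ((K - 1) * K),
    (M.word (64 + x) - M.word (64 + K * K + x))
  bound : M.real (R + 1) = β ∨ ∀ x < (K - 1) * K, M.word (64 + K * K + x) = 0

/-- The candidates between the two tables in the memory. -/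
def memCandidates (K : ℕ) (M : Mem) : Finset (Σ _ : ℕ, ℕ) :=
  candidates (fun x => M.word (64 + x)) (fun x => M.word (64 + K * K + x)) ((K - 1) * K)

theorem Searching.word_le {α β : ℝ} (h : Searching A B K R M α β) {x : ℕ}
    (hx : x < (K - 1) * K) : M.word (64 + x) ≤ K := by
  obtain ⟨he, hk, hx'⟩ := place_split hx
  have := h.bracket.tableLower.le_succ he hk
  rw [hx'] at this
  omega

/-- A round of the search, for the candidate with the number in the word cell `8`: its value becomes
the upper threshold, if it passes the test, and the lower threshold otherwise. -/
def roundC (l : ℕ) : Cmd :=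
  findC ;; valueC l ;; .setWord 5 (64 + 2 * (wv 2 * wv 2)) ;; .setWord 6 0 ;; testC l ;;
    .ite (.wordLT 0 (wv 9))
      (.setWord 5 (64 + wv 2 * wv 2) ;; .setWord 6 1 ;; .setReal (wv 4 + 1) (rv 0))
      (.setWord 5 64) ;;
    refreshC l

theorem ends_roundC {α β : ℝ} (h : Searching A B K R M α β) (hroom : Room K R S W)
    (hM : ∀ a, M.word a ≤ W) {z : ℕ} (hz : z < M.word 7) :
    Ends S W (roundC l) (M.setW 8 z) (180 * (K * (K * (Nat.clog 2 K + 1)))) fun M' =>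
      (∃ α' β', Searching A B K R M' α' β') ∧
      memCandidates K M' = remaining (candidateValue (vertex A B) K)
        (fun c => FrechetLE A B (candidateValue (vertex A B) K c)) (memCandidates K M)
        (pick (fun x => M.word (64 + x)) (fun x => M.word (64 + K * K + x)) ((K - 1) * K) z) := by
  obtain ⟨hE, hbr, hcount, hbound⟩ := h
  have hX : K * K ≤ K * (K * (Nat.clog 2 K + 1)) :=
    Nat.mul_le_mul_left _ (Nat.le_mul_of_pos_right _ (by omega))
  have hK4 := hroom.four_le
  have hS := hroom.space
  have hW := hroom.words
  have hKK : K * 4 ≤ K * K := Nat.mul_le_mul_left _ hK4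
  have hle : (K - 1) * K ≤ K * K := Nat.mul_le_mul_right _ (by omega)
  have hKlen := hbr.hK
  obtain ⟨x, hx, w, hw, hzx⟩ := exists_pick (a := fun x => M.word (64 + x))
    (b := fun x => M.word (64 + K * K + x)) (hcount ▸ hz)
  have hpick := pick_eq (a := fun x => M.word (64 + x)) (b := fun x => M.word (64 + K * K + x))
    (n := (K - 1) * K) hx hw
  rw [← hzx] at hpick
  rw [hpick]
  set c : Σ _ : ℕ, ℕ := ⟨x, M.word (64 + K * K + x) + w⟩ with hc
  have hcS : c ∈ candidates (fun x => M.word (64 + x)) (fun x => M.word (64 + K * K + x))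
      ((K - 1) * K) := mem_candidates.2 ⟨hx, by simp [hc], by simp only [hc]; omega⟩
  obtain ⟨hsk, hαv, hvβ⟩ := hbr.candidate hcS
  set v := candidateValue (vertex A B) K c with hv
  have hE₀ : Env (m + 1) K R (vertex A B) (M.setW 8 z) :=
    hE.congr (fun a ha => setW_word_ne (by omega)) (fun a ha => rfl)
  have h8ne : ∀ {a}, a ≠ 8 → (M.setW 8 z).word a = M.word a := fun ha => setW_word_ne ha
  have hz' : z ≤ W := hz.le.trans (hM 7)
  -- find the place of the candidate
  refine Ends.seq ((ends_findC hE₀ hroom (x := x) (w := w) (fun a => ?_) hx ?_ ?_).imp le_rfl ?_)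
    (T₂ := 175 * (K * (K * (Nat.clog 2 K + 1))) - 1) (by omega)
  · by_cases ha : a = 8
    · rw [ha, setW_word_self]; exact hz'
    · rw [h8ne ha]; exact hM a
  · rw [setW_word_self]
    refine hzx.trans ?_
    congr 1
    refine Finset.sum_congr rfl fun y _ => ?_
    rw [h8ne (by omega), h8ne (by omega)]
  · rwa [h8ne (by omega), h8ne (by omega)]
  rintro M₁ ⟨hw₁, hr₁, h8₁, h24₁⟩
  have hw₁' : ∀ a, a ≠ 8 → a ≠ 24 → M₁.word a = M.word a := fun a h1 h2 => by
    rw [hw₁ a h1 h2, h8ne h1]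
  have hE₁ : Env (m + 1) K R (vertex A B) M₁ :=
    hE.congr (fun a ha => hw₁' a (by omega) (by omega)) (fun a ha => by rw [hr₁]; rfl)
  -- compute its value
  refine Ends.seq ((ends_valueC hE₁ hroom hx h24₁ h8₁ (s := c.2)
    (by rw [hw₁' _ (by omega) (by omega)]) hsk).imp le_rfl ?_)
    (T₂ := 169 * (K * (K * (Nat.clog 2 K + 1)))) (by omega)
  rintro M₂ ⟨hw₂, hr₂, hv₂⟩
  have hE₂ : Env (m + 1) K R (vertex A B) M₂ :=
    hE₁.congr (fun a ha => hw₂ a (by omega) (by omega) (by omega)) (fun a ha => hr₂ a (by omega))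
  have hw₂' : ∀ a, 64 ≤ a → M₂.word a = M.word a := fun a ha => by
    rw [hw₂ a (by omega) (by omega) (by omega), hw₁' a (by omega) (by omega)]
  have hβ₂ : M₂.real (R + 1) = M.real (R + 1) := by rw [hr₂ _ (by omega), hr₁]; rfl
  have hv₂' : M₂.real R = v := hv₂
  clear hw₁ hr₁ h8₁ h24₁ hw₁' hE₁ hw₂ hr₂ hv₂ hpick h8ne hE₀
  -- test it
  refine (Ends.setW_seq (by simp; omega) (by simp [hE₂.w2]; omega) <|
    Ends.setW_seq (by simp; omega) (by simp) <|
    Ends.seq (T := 168 * (K * (K * (Nat.clog 2 K + 1)))) (T₁ := 91 * (K * (K * (Nat.clog 2 K + 1))))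
      (T₂ := 70 * (K * (K * (Nat.clog 2 K + 1)))) ?_ (by omega)).imp (by omega) fun _ h => h
  simp only [eval_add, eval_mul, eval_wv, eval_ofNat, hE₂.w2]
  set M₃ := (M₂.setW 5 (64 + 2 * (K * K))).setW 6 0 with hM₃
  have hw₃ : ∀ a, a ≠ 5 → a ≠ 6 → M₃.word a = M₂.word a := fun a h1 h2 => by
    rw [hM₃, setW_word_ne h2, setW_word_ne h1]
  have h5₃ : M₃.word 5 = 64 + 2 * (K * K) := by
    rw [hM₃, setW_word_ne (by omega), setW_word_self]
  have h6₃ : M₃.word 6 = 0 := setW_word_self ..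
  have hr₃ : M₃.real = M₂.real := rfl
  clear_value M₃
  have hE₃ : Env (m + 1) K R (vertex A B) M₃ :=
    hE₂.congr (fun a ha => hw₃ a (by omega) (by omega)) (fun a ha => by rw [hr₃])
  refine (ends_testC hE₃ hroom hbr.hm hbr.hn hbr.hK (r := v) h5₃ (by omega) (by omega) h6₃
    (by rw [hr₃, hv₂']) (hbr.endpoints.trans hαv.le)).imp le_rfl ?_
  rintro M₄ ⟨hw₄, hr₄, -, h9⟩
  have hE₄ : Env (m + 1) K R (vertex A B) M₄ :=
    hE₃.congr (fun a ha => hw₄ a (by omega) (by omega)) (fun a ha => hr₄ a (by omega))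
  have hw₄' : ∀ a, 64 ≤ a → a < 64 + 2 * (K * K) → M₄.word a = M.word a := fun a h1 h2 => by
    rw [hw₄ a (by omega) (by omega), hw₃ a (by omega) (by omega), hw₂' a h1]
  have h6₄ : M₄.word 6 = 0 := by rw [hw₄ 6 (by omega) (by omega), h6₃]
  have hv₄ : M₄.real R = v := by rw [hr₄ _ (by omega), hr₃, hv₂']
  have hβ₄ : M₄.real (R + 1) = M.real (R + 1) := by rw [hr₄ _ (by omega), hr₃, hβ₂]
  clear hw₂' hβ₂ hv₂' hE₂ hw₃ h5₃ h6₃ hr₃ hE₃ hw₄ hr₄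
  have hTA : ∀ x < (K - 1) * K, M.word (64 + x) ≤ K := fun x hx =>
    Searching.word_le ⟨hE, hbr, hcount, hbound⟩ hx
  refine Ends.seq (T₁ := 6) (T₂ := 56 * (K * (K * (Nat.clog 2 K + 1)))) ?_ (by omega)
  refine Ends.ite (T := 5) (fun hpos => ?_) (fun hpos => ?_)
  · -- the new upper threshold
    have hG : FrechetLE A B v := h9.1 (Nat.pos_iff_ne_zero.1 hpos)
    refine Ends.setW_seq (by simp; omega) (by simp [hE₄.w2]; omega) <|
      Ends.setW_seq (by simp; omega) (by simp; omega) <|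
      Ends.setR le_rfl (by simp (disch := omega) [setW_word_ne, hE₄.w4]; omega) ?_
    simp (disch := omega) only [eval_add, eval_mul, eval_wv, eval_ofNat, hE₄.w2, setW_word_ne,
      hE₄.w4, reval_rv, setW_real, add_zero, hv₄]
    set M₅ := ((M₄.setW 5 (64 + K * K)).setW 6 1).setR (R + 1) v with hM₅
    have hw₅ : ∀ a, a ≠ 5 → a ≠ 6 → M₅.word a = M₄.word a := fun a h1 h2 => by
      rw [hM₅, setR_word, setW_word_ne h2, setW_word_ne h1]
    have h5₅ : M₅.word 5 = 64 + K * K := by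
      rw [hM₅, setR_word, setW_word_ne (by omega), setW_word_self]
    have h6₅ : M₅.word 6 = 1 := by rw [hM₅, setR_word, setW_word_self]
    have hr₅ : ∀ a, a ≠ R + 1 → M₅.real a = M₄.real a := fun a ha => by
      rw [hM₅, setR_real_ne ha]; rfl
    have hβ₅ : M₅.real (R + 1) = v := setR_real_self ..
    clear_value M₅
    have hE₅ : Env (m + 1) K R (vertex A B) M₅ :=
      hE₄.congr (fun a ha => hw₅ a (by omega) (by omega)) (fun a ha => hr₅ a (by omega))
    have hw₅' : ∀ a, 64 ≤ a → a < 64 + 2 * (K * K) → M₅.word a = M.word a := fun a h1 h2 => by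
      rw [hw₅ a (by omega) (by omega), hw₄' a h1 h2]
    refine (ends_refreshC hE₅ hroom (strict := true) (r := v) h5₅ (Or.inr rfl) h6₅
      (by rw [hr₅ _ (by omega), hv₄])
      (Or.inr fun x hx => by rw [hw₅' _ (by omega) (by omega)]; exact hTA x hx)).imp le_rfl ?_
    rintro M₆ ⟨hE₆, hw₆, hβ₆, hT₆, h7₆⟩
    obtain ⟨h1, h2⟩ := hbr.set_upper hcS hG (b' := fun x => M₆.word (64 + K * K + x)) hT₆
    have heq : ∀ x < (K - 1) * K, M₆.word (64 + x) = M.word (64 + x) := fun x hx => by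
      rw [hw₆ _ (by omega) (by omega), hw₅' _ (by omega) (by omega)]
    exact ⟨⟨α, v, hE₆, h1.congr heq fun _ _ => rfl, h7₆, Or.inl (by rw [hβ₆, hβ₅])⟩,
      (candidates_congr heq fun _ _ => rfl).trans h2⟩
  · -- the new lower threshold
    have hG : ¬ FrechetLE A B v := fun hG => hpos (Nat.pos_iff_ne_zero.2 (h9.2 hG))
    refine Ends.setW (by omega) (by simp; omega) (by simp; omega) ?_
    simp only [eval_ofNat]
    set M₅ := M₄.setW 5 64 with hM₅
    have hw₅ : ∀ a, a ≠ 5 → M₅.word a = M₄.word a := fun a h1 => setW_word_ne h1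
    have h5₅ : M₅.word 5 = 64 := setW_word_self ..
    have hr₅ : M₅.real = M₄.real := rfl
    clear_value M₅
    have hE₅ : Env (m + 1) K R (vertex A B) M₅ :=
      hE₄.congr (fun a ha => hw₅ a (by omega)) (fun a ha => by rw [hr₅])
    refine (ends_refreshC hE₅ hroom (strict := false) (r := v) h5₅ (Or.inl rfl)
      (by rw [hw₅ 6 (by omega), h6₄]; rfl) (by rw [hr₅, hv₄]) (Or.inl rfl)).imp le_rfl ?_
    rintro M₆ ⟨hE₆, hw₆, hβ₆, hT₆, h7₆⟩
    obtain ⟨h1, h2⟩ := hbr.set_lower hcS hG (a' := fun x => M₆.word (64 + x)) hT₆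
    have heq : ∀ x < (K - 1) * K, M₆.word (64 + K * K + x) = M.word (64 + K * K + x) :=
      fun x hx => by rw [hw₆ _ (by omega) (by omega), hw₅ _ (by omega), hw₄' _ (by omega) (by omega)]
    refine ⟨⟨v, β, hE₆, h1.congr (fun _ _ => rfl) heq, h7₆, ?_⟩,
      (candidates_congr (fun _ _ => rfl) heq).trans h2⟩
    rw [hβ₆, hr₅, hβ₄]
    exact hbound.imp_right fun h0 x hx => by rw [heq x hx, h0 x hx]

/-! ### The random search on the machine -/

/-- Tests random candidates until none is left. -/
def searchC (l : ℕ) : Cmd := .loop (.wordLT 0 (wv 7)) (.rand 8 (wv 7 - 1) ;; roundC l)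

/-- Writes the result. -/
def outputC : Cmd := .setReal 0 (.sqrt (rv 1))

/-- If no candidate is left, two steps remain. -/
theorem good_output (hM : Fits S W M) (hS : 0 < S) (h7 : M.word 7 = 0) {r : ℝ}
    (hr : √(M.real (M.word 4 + 1)) = r) :
    Good S W r ⟨[searchC l, outputC], M⟩ (ENNReal.ofReal 2) := by
  have h : Good S W r ⟨[searchC l, outputC], M⟩ (1 + (1 + 0)) := by
    refine Good.of_step_pure hM (by simp [Config.Halted])
      (by rw [searchC, step, if_neg (by simp [h7])]) ?_
    refine Good.of_step_pure hM (by simp [Config.Halted]) rfl (Good.halted (hM.update_real hS) ?_)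
    simpa using hr
  refine h.mono ?_
  rw [add_zero, one_add_one_eq_two, ENNReal.ofReal_ofNat]

/-- The expected time of the search is bounded by the potential of the set of the remaining
candidates: a round takes a bounded time, and decreases the potential by one on average. -/
theorem good_search {α β : ℝ} (h : Searching A B K R M α β) (hroom : Room K R S W)
    (hM : Fits S W M) :
    Good S W (frechetDist (polyline A) (polyline B)) ⟨[searchC l, outputC], M⟩
      (ENNReal.ofReal ((180 * (K * (K * (Nat.clog 2 K + 1))) + 3 : ℕ) *
        searchPotential (fun c => FrechetLE A B (candidateValue (vertex A B) K c))
          (memCandidates K M) + 2)) := by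
  induction hN : (memCandidates K M).card using Nat.strong_induction_on generalizing M α β with
  | _ N ih =>
  set t := 180 * (K * (K * (Nat.clog 2 K + 1))) with ht
  set G : (Σ _ : ℕ, ℕ) → Prop := fun c => FrechetLE A B (candidateValue (vertex A B) K c) with hG
  have hS := hroom.space
  have h7 : M.word 7 = N := by rw [h.count, ← hN, memCandidates, card_candidates]
  have hpot := searchPotential_nonneg G (memCandidates K M)
  rcases Nat.eq_zero_or_pos N with h0 | h0
  · -- no candidate is left
    subst h0
    have hab : ∀ x < (K - 1) * K, M.word (64 + x) ≤ M.word (64 + K * K + x) := by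
      intro x hx
      have := Finset.sum_eq_zero_iff.1 (h.count.symm.trans h7) x (Finset.mem_range.2 hx)
      omega
    have hβ : M.real (R + 1) = β := h.bound.resolve_right fun hb => by
      obtain ⟨x, hx, hlt⟩ := h.bracket.exists_lt hb
      exact absurd (hab x hx) (not_le.2 hlt)
    refine (good_output hM (by omega) h7 ?_).mono (ENNReal.ofReal_le_ofReal ?_)
    · rw [h.env.w4, hβ, h.bracket.frechetDist_eq hab]
    · have : 0 ≤ ((t + 3 : ℕ) : ℝ) * searchPotential G (memCandidates K M) := by positivity
      linarith
  · have nh : ∀ {c : Cmd} {k : List Cmd} {M : Mem}, ¬ (Config.mk (c :: k) M).Halted := by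
      simp [Config.Halted]
    let sel : ℕ → Σ _ : ℕ, ℕ := pick (fun x => M.word (64 + x)) (fun x => M.word (64 + K * K + x))
      ((K - 1) * K)
    let f : ℕ → ℝ := fun z => t + ((t + 3 : ℕ) * searchPotential G
      (remaining (candidateValue (vertex A B) K) G (memCandidates K M) (sel z)) + 2)
    have hround : ∀ z < N, Good S W (frechetDist (polyline A) (polyline B))
        ⟨[roundC l, searchC l, outputC], M.setW 8 z⟩ (ENNReal.ofReal (f z)) := by
      intro z hz
      have hfit : Fits S W (M.setW 8 z) :=
        hM.update_word (by omega) (by have := hM.2 7; omega)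
      have hsel : sel z ∈ memCandidates K M := by
        obtain ⟨x, hx, w, hw, rfl⟩ := exists_pick (a := fun x => M.word (64 + x))
          (b := fun x => M.word (64 + K * K + x)) (n := (K - 1) * K) (z := z)
          (by rw [← h7, h.count] at hz; exact hz)
        have : sel _ = _ := pick_eq hx hw
        rw [this]
        exact mem_candidates.2 ⟨hx, by simp, by simp only; omega⟩
      refine ((ends_roundC h hroom hM.2 (by rw [h7]; exact hz)).good hfit
        (T' := ENNReal.ofReal ((t + 3 : ℕ) * searchPotential G
          (remaining (candidateValue (vertex A B) K) G (memCandidates K M) (sel z)) + 2))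
        ?_).mono ?_
      · rintro M' ⟨⟨α', β', h'⟩, hrem⟩ hM'
        have := ih _ (by rw [← hN, hrem]; exact card_remaining_lt hsel) h' hM' rfl
        rwa [hrem] at this
      · rw [← ENNReal.ofReal_natCast, ← ENNReal.ofReal_add (by positivity)]
        have := searchPotential_nonneg G
          (remaining (candidateValue (vertex A B) K) G (memCandidates K M) (sel z))
        positivity
    have hsum : ∑ z ∈ Finset.range N, f z ≤ N * ((t + 3 : ℕ) *
        searchPotential G (memCandidates K M) - 1) := by
      have h1 := sum_searchPotential_remaining_le (candidateValue (vertex A B) K) G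
        (memCandidates K M)
      have h3 : ∑ z ∈ Finset.range N, searchPotential G
          (remaining (candidateValue (vertex A B) K) G (memCandidates K M) (sel z)) =
          ∑ c ∈ memCandidates K M, searchPotential G
            (remaining (candidateValue (vertex A B) K) G (memCandidates K M) c) := by
        rw [← h7, h.count]
        exact sum_pick _ _ _ fun c => searchPotential G
          (remaining (candidateValue (vertex A B) K) G (memCandidates K M) c)
      rw [hN, ← h3] at h1
      simp only [f, Finset.sum_add_distrib, Finset.sum_const, Finset.card_range, nsmul_eq_mul,
        ← Finset.mul_sum]
      have h2 := mul_le_mul_of_nonneg_left h1 (Nat.cast_nonneg (α := ℝ) (t + 3))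
      push_cast at h2 ⊢
      linarith
    have hf : ∀ z ∈ Finset.range N, 0 ≤ f z := fun z _ => by
      have := searchPotential_nonneg G
        (remaining (candidateValue (vertex A B) K) G (memCandidates K M) (sel z))
      positivity
    have hN1 : (wv 7 - 1 : WExp).eval M + 1 = N := by simp [h7]; omega
    refine (Good.of_step_pure hM nh (by rw [searchC, step, if_pos (by simp [h7, h0])]) <|
      Good.of_step_pure hM nh rfl <| Good.rand hM (F := fun z => ENNReal.ofReal (f z))
        fun z hz => hround z (by omega)).mono ?_
    have hN0 : (0 : ℝ) < N := by exact_mod_cast h0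
    rw [hN1, ← ENNReal.ofReal_sum_of_nonneg hf, ← ENNReal.ofReal_natCast,
      ← ENNReal.ofReal_div_of_pos hN0, ← ENNReal.ofReal_one, ← ENNReal.ofReal_add one_pos.le
        (div_nonneg (Finset.sum_nonneg hf) hN0.le), ← ENNReal.ofReal_add one_pos.le
        (by have := div_nonneg (Finset.sum_nonneg hf) hN0.le; linarith),
      ← ENNReal.ofReal_add one_pos.le
        (by have := div_nonneg (Finset.sum_nonneg hf) hN0.le; linarith)]
    refine ENNReal.ofReal_le_ofReal ?_
    have := (div_le_iff₀' hN0).2 hsum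
    linarith

/-! ### The whole program -/

/-- Prepares the search: decides for the distances of the endpoints, and computes the first lower
table. -/
def initC (l : ℕ) : Cmd :=
  .setWord 2 (wv 0 + wv 1) ;; .setWord 3 (wv 2 - 1) ;; .setWord 4 (wv 2 * .const l) ;;
    .setReal (wv 4) (.max (dotE l 0 0 (wv 0)) (dotE l (wv 0 - 1) (wv 0 - 1) (wv 3))) ;;
    .setWord 5 64 ;; testC l ;;
    .ite (.wordLT 0 (wv 9)) (.setReal (wv 4 + 1) (rv 0)) countC

theorem coordList_eq {k : ℕ} (Q : Fin k → EuclideanSpace ℝ (Fin l)) {v : ℕ} (hv : v < k)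
    (d : Fin l) : coordList Q (v * l + d) = Q ⟨v, hv⟩ d := by
  have hd := d.isLt
  have hlt : v * l + d < k * l := by
    calc v * l + d < v * l + l := by omega
      _ = (v + 1) * l := by ring
      _ ≤ k * l := Nat.mul_le_mul_right _ hv
  have h1 : (v * l + d) / l = v := by
    rw [mul_comm, Nat.mul_add_div (by omega), Nat.div_eq_of_lt hd, add_zero]
  have h2 : (v * l + d) % l = d := by
    rw [mul_comm, Nat.mul_add_mod, Nat.mod_eq_of_lt hd]
  have e1 : Fin.divNat ⟨v * l + d, hlt⟩ = ⟨v, hv⟩ := Fin.ext h1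
  have e2 : Fin.modNat ⟨v * l + d, hlt⟩ = d := Fin.ext h2
  rw [coordList, dif_pos hlt, e1, e2]

theorem curvePairInput_real (hK : m + 1 + (n + 1) = K) {v : ℕ} (hv : v < K) (d : Fin l) :
    (curvePairInput A B).real (v * l + d) = vertex A B v d := by
  have hd := d.isLt
  simp only [curvePairInput]
  by_cases hvm : v < m + 1
  · have : (v + 1) * l ≤ (m + 1) * l := Nat.mul_le_mul_right _ hvm
    rw [add_mul, one_mul] at this
    rw [if_pos (by omega), coordList_eq A hvm, vertex_left A B hvm]
  · obtain ⟨j, rfl⟩ : ∃ j, v = m + 1 + j := ⟨v - (m + 1), by omega⟩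
    rw [add_mul (m + 1) j, if_neg (by omega), add_assoc, Nat.add_sub_cancel_left,
      coordList_eq B (by omega : j < n + 1), vertex_right A B]

theorem fits_curvePairInput (hK : m + 1 + (n + 1) = K) (hR : K * l = R) (hroom : Room K R S W) :
    Fits S W (curvePairInput A B) := by
  obtain ⟨h4, hS, hW⟩ := hroom
  have hKK : K * 4 ≤ K * K := Nat.mul_le_mul_left _ h4
  refine ⟨fun a ha => ⟨?_, ?_⟩, fun a => ?_⟩
  · simp only [curvePairInput]
    rw [if_neg (by omega), if_neg (by omega)]
  · have : (m + 1) * l + (n + 1) * l = R := by rw [← add_mul, hK, hR]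
    simp only [curvePairInput]
    rw [if_neg (by omega), coordList, dif_neg (by omega)]
  · simp only [curvePairInput]
    split_ifs <;> omega

theorem endpointSq_eq (hm : 1 ≤ m) (hn : 1 ≤ n) (hK : m + 1 + (n + 1) = K) :
    endpointSq A B = max (dist (vertex A B 0) (vertex A B (m + 1)) ^ 2)
      (dist (vertex A B m) (vertex A B (K - 1)) ^ 2) := by
  have h1 := arc_left_nat A B hm (Nat.zero_le m)
  have h2 := arc_right_nat A B hn (Nat.zero_le n)
  rw [Nat.cast_zero] at h1 h2
  rw [endpointSq, h1, h2, arc_left_nat A B hm le_rfl, arc_right_nat A B hn le_rfl,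
    show K - 1 = m + 1 + n by omega, add_zero]

theorem ends_initC (hm : 1 ≤ m) (hn : 1 ≤ n) (hK : m + 1 + (n + 1) = K) (hR : K * l = R)
    (hroom : Room K R S W) :
    Ends S W (initC l) (curvePairInput A B) (100 * (K * (K * (Nat.clog 2 K + 1)))) fun M' =>
      (∃ α β, Searching A B K R M' α β) ∨
      M'.word 7 = 0 ∧ √(M'.real (M'.word 4 + 1)) = frechetDist (polyline A) (polyline B) := by
  have hX : K * K ≤ K * (K * (Nat.clog 2 K + 1)) :=
    Nat.mul_le_mul_left _ (Nat.le_mul_of_pos_right _ (by omega))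
  have hK4 := hroom.four_le
  have hS := hroom.space
  have hW := hroom.words
  have hKK : K * 4 ≤ K * K := Nat.mul_le_mul_left _ hK4
  have hle : (K - 1) * K ≤ K * K := Nat.mul_le_mul_right _ (by omega)
  set M := curvePairInput A B with hM
  have h0 : M.word 0 = m + 1 := rfl
  have h1 : M.word 1 = n + 1 := rfl
  have hz : ∀ a, 2 ≤ a → M.word a = 0 := fun a ha => by
    simp only [hM, curvePairInput]
    rw [if_neg (by omega), if_neg (by omega)]
  have hcoord : ∀ v < K, ∀ d : Fin l, M.real (v * l + d) = vertex A B v d :=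
    fun v hv d => curvePairInput_real hK hv d
  clear_value M
  have hKR : K - 1 ≤ W := by omega
  refine (Ends.setW_seq (by simp; omega) (by simp [h0, h1]; omega) <|
    Ends.setW_seq (by simp; omega) (by simp [h0, h1]; omega) <|
    Ends.setW_seq (by simp; omega)
      (by simp (disch := omega) [h0, h1, setW_word_ne, hK, hR]; omega) ?_
      (T := 94 * (K * (K * (Nat.clog 2 K + 1))) + 5 * (K * K))).imp (by omega) fun _ h => h
  simp (disch := omega) only [eval_ofNat, eval_add, eval_sub, eval_mul, eval_wv, eval_const, h0, h1,
    setW_word_ne, setW_word_self, hK, hR]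
  set M₁ := ((M.setW 2 K).setW 3 (K - 1)).setW 4 R with hM₁
  have hE₁ : Env (m + 1) K R (vertex A B) M₁ := by
    refine ⟨?_, ?_, ?_, ?_, ?_, hcoord, hR⟩ <;>
      simp (disch := omega) only [hM₁, setW_word_ne, setW_word_self, h0, h1]
    omega
  have hz₁ : ∀ a, 5 ≤ a → M₁.word a = 0 := fun a ha => by
    simp (disch := omega) only [hM₁, setW_word_ne, hz]
  clear_value M₁
  clear hM₁ h0 h1 hz hcoord
  have hend : (RExp.max (dotE l 0 0 (wv 0)) (dotE l (wv 0 - 1) (wv 0 - 1) (wv 3))).eval M₁ =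
      endpointSq A B := by
    have e0 : (wv 0 : WExp).eval M₁ = m + 1 := hE₁.w0
    have e1 : (wv 0 - 1 : WExp).eval M₁ = m := by simp [hE₁.w0]
    have e3 : (wv 3 : WExp).eval M₁ = K - 1 := hE₁.w3
    rw [reval_max, hE₁.dotE (by simp; omega) (by simp; omega) (by omega),
      hE₁.dotE (by omega) (by omega) (by omega), e0, e1, e3, eval_ofNat, endpointSq_eq hm hn hK,
      real_inner_self_eq_norm_sq, real_inner_self_eq_norm_sq, ← dist_eq_norm, ← dist_eq_norm]
  refine (Ends.setR_seq (by simp [hE₁.w4]; omega) <| Ends.setW_seq (by simp; omega)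
    (by simp; omega) (T := 92 * (K * (K * (Nat.clog 2 K + 1))) + 5 * (K * K)) ?_).imp (by omega)
    fun _ h => h
  rw [hend, eval_wv, hE₁.w4]
  set r := endpointSq A B with hr
  simp only [eval_ofNat]
  set M₂ := (M₁.setR R r).setW 5 64 with hM₂
  have hw₂ : ∀ a, a ≠ 5 → M₂.word a = M₁.word a := fun a ha => by
    rw [hM₂, setW_word_ne ha, setR_word]
  have h5₂ : M₂.word 5 = 64 := setW_word_self ..
  have hR₂ : M₂.real R = r := by rw [hM₂, setW_real, setR_real_self]
  have hE₂ : Env (m + 1) K R (vertex A B) M₂ :=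
    hE₁.congr (fun a ha => hw₂ a (by omega)) (fun a ha => by
      rw [hM₂, setW_real, setR_real_ne (by omega)])
  have hz₂ : ∀ a, 6 ≤ a → M₂.word a = 0 := fun a ha => by
    rw [hw₂ a (by omega), hz₁ a (by omega)]
  clear_value M₂
  refine Ends.seq ((ends_testC hE₂ hroom hm hn hK h5₂ le_rfl (by omega) (hz₂ 6 le_rfl) hR₂ le_rfl).imp
    le_rfl ?_) (T₂ := 5 * (K * K) + 1) (by omega)
  rintro M₃ ⟨hw₃, hr₃, hT₃, h9⟩
  have hE₃ : Env (m + 1) K R (vertex A B) M₃ :=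
    hE₂.congr (fun a ha => hw₃ a (by omega) (by omega)) (fun a ha => hr₃ a (by omega))
  have h7₃ : M₃.word 7 = 0 := by rw [hw₃ 7 (by omega) (by omega), hz₂ 7 (by omega)]
  have hR₃ : M₃.real R = r := by rw [hr₃ R (by omega), hR₂]
  have hb₃ : ∀ x < (K - 1) * K, M₃.word (64 + K * K + x) = 0 := fun x hx => by
    rw [hw₃ _ (by omega) (by omega), hz₂ _ (by omega)]
  refine Ends.ite (fun hpos => ?_) (fun hpos => ?_)
  · have hG : FrechetLE A B r := h9.1 (Nat.pos_iff_ne_zero.1 hpos)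
    refine Ends.setR (by omega) (by simp [hE₃.w4]; omega) (Or.inr ⟨h7₃, ?_⟩)
    rw [setR_word, eval_add, eval_wv, eval_ofNat, setR_real_self, reval_rv, hE₃.w4, add_zero, hR₃,
      frechetDist_eq_of_endpointSq hG]
  · have hG : ¬ FrechetLE A B r := fun hG => hpos (Nat.pos_iff_ne_zero.2 (h9.2 hG))
    refine (ends_countC hE₃ hroom fun x hx => ?_).imp le_rfl ?_
    · obtain ⟨he, hk, hx'⟩ := place_split hx
      have := hT₃.le_succ he hk
      rw [hx'] at this
      omega
    · rintro M₄ ⟨hw₄, hr₄, h7₄⟩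
      have hw₄' : ∀ a, 64 ≤ a → M₄.word a = M₃.word a := fun a ha =>
        hw₄ a (by omega) (by omega)
      have hb₄ : ∀ x < (K - 1) * K, M₄.word (64 + K * K + x) = 0 := fun x hx => by
        rw [hw₄' _ (by omega), hb₃ x hx]
      obtain ⟨β, hβ⟩ := exists_bracket (a := fun x => M₄.word (64 + x))
        (b := fun x => M₄.word (64 + K * K + x)) hm hn hK hG
        (hT₃.congr (a := fun x => M₃.word (64 + x)) (a' := fun x => M₄.word (64 + x))
          fun x _ => hw₄' _ (by omega)) hb₄
      refine Or.inl ⟨r, β, hE₃.congr (fun a ha => hw₄ a (by omega) (by omega))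
        (fun a ha => by rw [hr₄]), hβ, ?_, Or.inr hb₄⟩
      rw [h7₄]
      refine Finset.sum_congr rfl fun x _ => ?_
      rw [hw₄' _ (by omega), hw₄' _ (by omega)]

/-- The program that computes the Fréchet distance. -/
def frechetC (l : ℕ) : Cmd := initC l ;; searchC l ;; outputC

theorem Searching.card_le {α β : ℝ} (h : Searching A B K R M α β) :
    (memCandidates K M).card ≤ K * K * K := by
  rw [memCandidates, card_candidates]
  calc _ ≤ ∑ x ∈ Finset.range ((K - 1) * K), K := Finset.sum_le_sum fun x hx =>
          (Nat.sub_le _ _).trans (h.word_le (Finset.mem_range.1 hx))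
    _ = (K - 1) * K * K := by simp
    _ ≤ K * K * K := by gcongr; omega

theorem good_frechetC (hm : 1 ≤ m) (hn : 1 ≤ n) (hK : m + 1 + (n + 1) = K) (hR : K * l = R)
    (hroom : Room K R S W) :
    Good S W (frechetDist (polyline A) (polyline B)) ⟨[frechetC l], curvePairInput A B⟩
      (ENNReal.ofReal (4 + (100 * (K * (K * (Nat.clog 2 K + 1))) : ℕ) +
        (180 * (K * (K * (Nat.clog 2 K + 1))) + 3 : ℕ) *
          (2 * (1 + Real.log (K * K * K : ℕ))))) := by
  set X := K * (K * (Nat.clog 2 K + 1)) with hX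
  set Y : ℝ := (180 * X + 3 : ℕ) * (2 * (1 + Real.log (K * K * K : ℕ))) with hY
  have hM := fits_curvePairInput (A := A) (B := B) hK hR hroom
  have nh : ∀ {c : Cmd} {k : List Cmd} {M : Mem}, ¬ (Config.mk (c :: k) M).Halted := by
    simp [Config.Halted]
  have hY0 : 0 ≤ Y := by positivity
  refine (Good.of_step_pure hM nh rfl <| (ends_initC hm hn hK hR hroom).good hM
    (T' := 1 + ENNReal.ofReal (Y + 2)) fun M' h hM' => Good.of_step_pure hM' nh rfl ?_).mono ?_
  · rcases h with ⟨α, β, h⟩ | ⟨h7, hr⟩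
    · refine (good_search h hroom hM').mono (ENNReal.ofReal_le_ofReal ?_)
      have := mul_le_mul_of_nonneg_left (searchPotential_le
        (fun c => FrechetLE A B (candidateValue (vertex A B) K c)) _ h.card_le)
        (Nat.cast_nonneg (α := ℝ) (180 * X + 3))
      linarith
    · have := hroom.space
      exact (good_output hM' (by omega) h7 hr).mono (ENNReal.ofReal_le_ofReal (by linarith))
  · rw [← ENNReal.ofReal_natCast, ← ENNReal.ofReal_one, ← ENNReal.ofReal_add one_pos.le (by linarith),
      ← ENNReal.ofReal_add (by positivity) (by linarith), ← ENNReal.ofReal_add one_pos.le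
        (by positivity)]
    exact ENNReal.ofReal_le_ofReal (by linarith)

/-! ### The bounds in terms of the complexity of the curves -/

theorem room_of_le {N C : ℕ} (hN : 2 ≤ N) (h4 : 4 ≤ K) (hK : K ≤ 2 * N) (hR : K * l = R)
    (hC : 67 + 2 * l ≤ C) : Room K R (C * N ^ 2) (N ^ C) := by
  have hKK : K * K ≤ 4 * N ^ 2 := by nlinarith
  have hKKK : K * K * K ≤ 8 * N ^ 3 := by
    calc K * K * K ≤ (2 * N) * (2 * N) * (2 * N) := by gcongr
      _ = 8 * N ^ 3 := by ring
  have hRN : R ≤ 2 * l * N ^ 2 := by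
    rw [← hR]
    calc K * l ≤ 2 * N * l := by gcongr
      _ = 2 * l * (N * 1) := by ring
      _ ≤ 2 * l * (N * N) := by gcongr; omega
      _ = 2 * l * N ^ 2 := by ring
  have h16 : 64 ≤ 16 * N ^ 2 := by nlinarith
  have hspace : 64 + R + 8 * (K * K) ≤ (48 + 2 * l) * N ^ 2 := by
    rw [add_mul]; omega
  refine ⟨h4, hspace.trans (Nat.mul_le_mul_right _ (by omega)), ?_⟩
  have h23 : N ^ 2 ≤ N ^ 3 := Nat.pow_le_pow_right (by omega) (by omega)
  calc 64 + R + 8 * (K * K) + K * K * K ≤ (48 + 2 * l) * N ^ 3 + 8 * N ^ 3 :=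
        add_le_add (hspace.trans (Nat.mul_le_mul_left _ h23)) hKKK
    _ ≤ (64 + 2 * l) * N ^ 3 := by rw [← add_mul]; exact Nat.mul_le_mul_right _ (by omega)
    _ ≤ N ^ (64 + 2 * l) * N ^ 3 := by
        gcongr
        exact (Nat.lt_two_pow_self).le.trans (Nat.pow_le_pow_left hN _)
    _ = N ^ (67 + 2 * l) := by rw [← pow_add]; congr 1; omega
    _ ≤ N ^ C := Nat.pow_le_pow_right (by omega) hC

theorem time_le {N : ℕ} (hN : 2 ≤ N) (h4 : 4 ≤ K) (hK : K ≤ 2 * N) :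
    4 + (100 * (K * (K * (Nat.clog 2 K + 1))) : ℕ) +
        (180 * (K * (K * (Nat.clog 2 K + 1))) + 3 : ℕ) *
          (2 * (1 + Real.log (K * K * K : ℕ))) ≤ (100000 : ℝ) * (N : ℝ) ^ 2 * Real.log N ^ 2 := by
  have hN' : (2 : ℝ) ≤ N := by exact_mod_cast hN
  have hK' : (K : ℝ) ≤ 2 * N := by exact_mod_cast hK
  have hK0 : (4 : ℝ) ≤ K := by exact_mod_cast h4
  have hlog2 : (1 / 2 : ℝ) ≤ Real.log 2 := by linarith [Real.log_two_gt_d9]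
  set L := Real.log N with hL
  have hL2 : Real.log 2 ≤ L := Real.log_le_log two_pos hN'
  have hlogK : Real.log K ≤ 2 * L := by
    have := Real.log_le_log (by linarith) hK'
    rw [Real.log_mul two_ne_zero (by linarith)] at this
    linarith
  have hpot : 2 * (1 + Real.log (K * K * K : ℕ)) ≤ 16 * L := by
    push_cast
    rw [Real.log_mul (by positivity) (by positivity), Real.log_mul (by positivity) (by positivity)]
    linarith
  have hclog : (Nat.clog 2 K : ℝ) + 1 ≤ 8 * L := by
    have h1 : Nat.clog 2 K ≤ Nat.log 2 N + 2 := by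
      refine (Nat.clog_le_iff_le_pow one_lt_two).2 (hK.trans ?_)
      have := Nat.lt_pow_succ_log_self one_lt_two N
      rw [pow_succ] at this ⊢
      omega
    have h2 : (Nat.log 2 N : ℝ) * Real.log 2 ≤ L := by
      rw [← Real.log_pow]
      refine Real.log_le_log (by positivity) ?_
      exact_mod_cast Nat.pow_log_le_self 2 (by omega)
    have h3 : (Nat.clog 2 K : ℝ) ≤ Nat.log 2 N + 2 := by exact_mod_cast h1
    nlinarith [Nat.cast_nonneg (α := ℝ) (Nat.log 2 N)]
  have hX : ((K * (K * (Nat.clog 2 K + 1)) : ℕ) : ℝ) ≤ 32 * N ^ 2 * L := by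
    push_cast
    calc (K : ℝ) * (K * (Nat.clog 2 K + 1)) ≤ (2 * N) * ((2 * N) * (8 * L)) := by gcongr
      _ = 32 * N ^ 2 * L := by ring
  have hX1 : (16 : ℝ) ≤ ((K * (K * (Nat.clog 2 K + 1)) : ℕ) : ℝ) := by
    have : 4 * (4 * 1) ≤ K * (K * (Nat.clog 2 K + 1)) := by gcongr; omega
    exact_mod_cast this
  set X : ℝ := ((K * (K * (Nat.clog 2 K + 1)) : ℕ) : ℝ) with hXdef
  have hL0 : (1 / 2 : ℝ) ≤ L := hlog2.trans hL2
  -- the summands of lower order are absorbed by `16 ≤ X` and `1 ≤ 2 * L`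
  calc _ = 4 + 100 * X + (180 * X + 3) * (2 * (1 + Real.log (K * K * K : ℕ))) := by
        rw [hXdef]; push_cast; ring
    _ ≤ 101 * X + 181 * X * (16 * L) := by gcongr <;> linarith
    _ ≤ 101 * X * (2 * L) + 181 * X * (16 * L) := by
        have := mul_le_mul_of_nonneg_left (show 1 ≤ 2 * L by linarith) (show 0 ≤ 101 * X by linarith)
        linarith
    _ = 3098 * L * X := by ring
    _ ≤ 3098 * L * (32 * N ^ 2 * L) := by gcongr
    _ ≤ 100000 * N ^ 2 * L ^ 2 := by
        have : (0 : ℝ) ≤ N ^ 2 * L ^ 2 := by positivity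
        linarith

end Spec

end RealRAM

end

theorem mainTheorem3 (l : ℕ) :
    ∃ (prog : RealRAM.Cmd) (C : ℕ),
      ∀ (m n : ℕ) (_hm : 1 ≤ m) (_hn : 1 ≤ n)
        (A : Fin (m + 1) → EuclideanSpace ℝ (Fin l))
        (B : Fin (n + 1) → EuclideanSpace ℝ (Fin l))
        (N : ℕ) (_hN : N = max (m + 1) (n + 1)),
        RealRAM.Outputs prog (curvePairInput A B) (frechetDist (polyline A) (polyline B)) ∧
        RealRAM.expectedTime prog (curvePairInput A B) ≤
          ENNReal.ofReal ((C : ℝ) * (N : ℝ) ^ 2 * Real.log (N : ℝ) ^ 2) ∧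
        RealRAM.RunsInSpace prog (curvePairInput A B) (C * N ^ 2) (N ^ C) := by
  -- the constant hides the dimension: a list of `K` points has `K * l` coordinates
  refine ⟨RealRAM.frechetC l, 100000 + 2 * l, fun m n hm hn A B N hN => ?_⟩
  have hN2 : 2 ≤ N := by omega
  have hroom := RealRAM.room_of_le (l := l) (K := m + 1 + (n + 1)) (C := 100000 + 2 * l) hN2
    (by omega) (by omega) rfl (by omega)
  obtain ⟨h1, h2, h3⟩ := RealRAM.outputs_of_good
    (RealRAM.good_frechetC (A := A) (B := B) hm hn rfl rfl hroom)
  refine ⟨h1, h2.trans (ENNReal.ofReal_le_ofReal ?_), h3⟩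
  refine (RealRAM.time_le (K := m + 1 + (n + 1)) hN2 (by omega) (by omega)).trans ?_
  gcongr
  push_cast
  linarith [Nat.cast_nonneg (α := ℝ) l]
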